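/- **Setting.** Let $\Omega\subset\mathbb R^d$ be open and bounded with $\mathscr L^d(\partial\Omega)=0$, let $E$ be a finite-dimensional Euclidean space with unit sphere $\mathbb S_E$ and open unit ball $\mathbb B_E$, let $Z=\mathbb R^d/\mathbb Z^d$ with its normalized Lebesgue measure $\mathscr L^d_Z$, let $\langle x\rangle\in Z$ be the class of $x\in\mathbb R^d$, and let $Q=[0,1]^d$. Below, $U$ stands for $\Omega$ or $Q$. *Two-scale\* Young measures.* $\mathbf Y^2(U;E)$ is the set of $\boldsymbol\nu=(\nu,\lambda,\rho,\nu^\infty)$ where $\nu$ is a weak-\* measurable map from $\overline U\times Z$ into the probability measures on $E$ with $\int_{\overline U\times Z}\int_E|z|\,d\nu_{x,\xi}\,d\xi\,dx<\infty$; $\lambda$ is a finite positive measure on $\overline U$; $\rho$ is a weak-\* $\lambda$-measurable map from $\overline U$ into the probability measures on $Z$; and $\nu^\infty$ is a weak-\* $(\lambda\otimes\rho_x)$-measurable map from $\overline U\times Z$ into the probability measures on $\mathbb S_E$ (all maps being understood up to null sets). $\lambda^{ac}$ denotes the density of the absolutely continuous part of $\lambda$ with respect to $\mathscr L^d$. *Integrands.*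 $\mathbf E^2(U;E)$ is the set of $f\in C(U\times Z\times E)$ such that $(x,\xi,\hat z)\mapsto(1-|\hat z|)f(x,\xi,\hat z/(1-|\hat z|))$ extends continuously from $U\times Z\times\mathbb B_E$ to its closure. Its recession function is $f^\infty(x,\xi,z)=\lim_{x'\to x,\,\xi'\to\xi,\,t\to\infty}f(x',\xi',tz)/t$. Put $$\langle\!\langle f,\boldsymbol\nu\rangle\!\rangle=\int_U\int_Z\int_E f\,d\nu_{x,\xi}\,d\xi\,dx+\int_{\overline U}\int_Z\int_{\mathbb S_E}f^\infty\,d\nu^\infty_{x,\xi}\,d\rho_x(\xi)\,d\lambda(x).$$ *Generation.* Write $\mu=\mu^{ac}\mathscr L^d+\mu_s|\mu^s|$ for the Lebesgue decomposition of an $E$-valued measure $\mu\in\mathcal M(U;E)$, with $|\mu_s|=1$. For positive numbers $\epsilon_i\to0$, a sequence $(\mu_i)\subset\mathcal M(U;E)$ *generates* $\boldsymbol\nu\in\mathbf Y^2(U;E)$ at the scales $(\epsilon_i)$ if for all $f\in\mathbf E^2(U;E)$ $$\int_U f(x,\langle x/\epsilon_i\rangle,\mu_i^{ac})\,dx+\int_U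 f^\infty(x,\langle x/\epsilon_i\rangle,(\mu_i)_s)\,d|\mu_i^s|\longrightarrow\langle\!\langle f,\boldsymbol\nu\rangle\!\rangle .$$ *Blow-ups.* Extend measures by zero to $\mathbb R^d$, put $T^{(x_0,r)}(x)=(x-x_0)/r$ and let $T^{(x_0,r)}_\#\mu$ denote the push-forward restricted to $Q$. For a positive measure $\kappa$, $\mathrm{Tan}_1(\kappa,x_0)$ is the set of probability measures on $Q$ that are weak-\* limits of $\kappa(x_0+r_jQ)^{-1}T^{(x_0,r_j)}_\#\kappa$ for some positive $r_j\to0$ with $\kappa(x_0+r_jQ)>0$. If $(\mu_i)\subset\mathcal M(\Omega;E)$ generates a Young measure at the scales $(\epsilon_i)$, then $\boldsymbol{D\nu}\in\mathbf Y^2(Q;E)$ is called a *tangent two-scale\* Young measure* of it at $x_0$ (generated by blow-ups of $(\mu_i)$) if there are positive radii $r_j\to0$, a subsequence $(n(i))_i$ and $\boldsymbol\sigma^{(j)}\in\mathbf Y^2(Q;E)$ such that: for each $j$, the sequence $\big(r_j^{-d}T^{(x_0,r_j)}_\#\mu_{n(i)}\big)_i$ generates $\boldsymbol\sigma^{(j)}$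 at the scales $(\epsilon_{n(i)}/r_j)_i$; $\langle\!\langle f,\boldsymbol\sigma^{(j)}\rangle\!\rangle\to\langle\!\langle f,\boldsymbol{D\nu}\rangle\!\rangle$ for all $f\in\mathbf E^2(Q;E)$; and, for some further subsequence $(n(m(j)))_j$ with $\epsilon_{n(m(j))}/r_j\to0$, the diagonal sequence $\big(r_j^{-d}T^{(x_0,r_j)}_\#\mu_{n(m(j))}\big)_j$ generates $\boldsymbol{D\nu}$ at the scales $(\epsilon_{n(m(j))}/r_j)_j$. **Lemma (localization at regular points).** Let $\boldsymbol\nu=(\nu,\lambda,\rho,\nu^\infty)\in\mathbf Y^2(\Omega;E)$ be generated by a sequence $(\mu_i)\subset\mathcal M(\Omega;E)$ at scales $\epsilon_i\to0$, $\epsilon_i>0$. Then at $\mathscr L^d$-almost every $x_0\in\Omega$ there exist $\xi_0\in Z$ and a tangent two-scale\* Young measure $\boldsymbol{D\nu}=(D\nu,D\lambda,D\rho,D\nu^\infty)\in\mathbf Y^2(Q;E)$ of $\boldsymbol\nu$ at $x_0$, generated by blow-ups of $(\mu_i)$, such that: 1. $D\lambda=\lambda^{ac}(x_0)\,\mathscr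 L^d\llcorner Q$; this is the weak-\* limit on $Q$ of $r^{-d}\,T^{(x_0,r)}_\#\lambda$ as $r\downarrow0$, and if $\lambda^{ac}(x_0)\neq0$, then $D\lambda/D\lambda(Q)\in\mathrm{Tan}_1(\lambda,x_0)$; 2. $D\rho_y$ is the push-forward of $\rho_{x_0}$ under $\xi\mapsto\xi-\xi_0$, for $D\lambda$-almost every $y$; 3. $D\nu_{y,\xi}=\nu_{x_0,\xi+\xi_0}$ for $(\mathscr L^d\otimes\mathscr L^d_Z)$-almost every $(y,\xi)\in Q\times Z$; 4. $D\nu^\infty_{y,\xi}=\nu^\infty_{x_0,\xi+\xi_0}$ for $(D\lambda\otimes D\rho_y)$-almost every $(y,\xi)\in Q\times Z$. -/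

import Mathlib

open MeasureTheory Filter Topology Set

noncomputable section

namespace TwoScale

/-- The macroscopic space `ℝᵈ`. -/
abbrev Space (d : ℕ) : Type := EuclideanSpace ℝ (Fin d)

/-- The flat torus `Z = ℝᵈ / ℤᵈ`; its `volume` is the normalized Lebesgue measure `𝓛ᵈ_Z`. -/
abbrev Torus (d : ℕ) : Type := UnitAddTorus (Fin d)

/-- The class `⟨x⟩` of `x ∈ ℝᵈ` in the torus. -/
def toTorus {d : ℕ} (x : Space d) : Torus d := fun i => ((x i : ℝ) : UnitAddCircle)

/-- The closed unit cube `Q = [0,1]ᵈ`. -/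
def unitCube (d : ℕ) : Set (Space d) := {y | ∀ i, y i ∈ Icc (0 : ℝ) 1}

/-- The blow-up map `T^(x₀,r) (x) = (x - x₀) / r`. -/
def blowUpMap {d : ℕ} (x₀ : Space d) (r : ℝ) : Space d → Space d := fun x => r⁻¹ • (x - x₀)

/-- The generalized product `λ ⊗ ρ_x`, that is
`U ↦ ∫ ρ_x {ξ | (x, ξ) ∈ U} dλ(x)`. -/
def genProd {X Y : Type*} [MeasurableSpace X] [MeasurableSpace Y]
    (lam : Measure X) (rho : X → Measure Y) : Measure (X × Y) :=
  lam.bind (fun x => (rho x).map (Prod.mk x))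

/-! ### Vector measures -/

section VectorMeasures

variable {X E : Type*} [MeasurableSpace X] [NormedAddCommGroup E] [InnerProductSpace ℝ E]

/-- The coordinate `⟨v, μ⟩` of a vector measure `μ` in the direction `v`, a signed measure. -/
def coord (μ : VectorMeasure X E) (v : E) : SignedMeasure X :=
  μ.mapRange (AddMonoidHomClass.toAddMonoidHom (innerSL ℝ v)) (innerSL ℝ v).continuous

theorem coord_apply (μ : VectorMeasure X E) (v : E) (s : Set X) :
    coord μ v s = inner ℝ v (μ s) := rfl

/-- The Radon-Nikodym density `dμ/dτ` of a vector measure `μ` with respect to a positive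
measure `τ`, taken coordinatewise in an orthonormal basis of `E`. -/
def density [FiniteDimensional ℝ E] (μ : VectorMeasure X E) (τ : Measure X) (x : X) : E :=
  ∑ i, (coord μ (stdOrthonormalBasis ℝ E i)).rnDeriv τ x • stdOrthonormalBasis ℝ E i

end VectorMeasures

section

variable {d : ℕ} {E : Type*} [NormedAddCommGroup E] [InnerProductSpace ℝ E]
  [FiniteDimensional ℝ E]

/-- The density `μ^ac` of the absolutely continuous part of `μ`. -/
def acDensity (μ : VectorMeasure (Space d) E) : Space d → E := density μ volume

/-- The singular part `μ^s = μ - μ^ac 𝓛ᵈ`. -/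
def singPart (μ : VectorMeasure (Space d) E) : VectorMeasure (Space d) E :=
  μ - (volume : Measure (Space d)).withDensityᵥ (acDensity μ)

/-- The total variation `|μ^s|` of the singular part. -/
def singVar (μ : VectorMeasure (Space d) E) : Measure (Space d) := (singPart μ).variation

/-- The polar density `μ_s = dμ^s / d|μ^s|`, so that `μ = μ^ac 𝓛ᵈ + μ_s |μ^s|`. -/
def singDensity (μ : VectorMeasure (Space d) E) : Space d → E := density (singPart μ) (singVar μ)

/-- The rescaled blow-up `r⁻ᵈ T^(x₀,r)_# μ`, as an element of `𝓜(Q; E)`. -/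
def blowUp (μ : VectorMeasure (Space d) E) (x₀ : Space d) (r : ℝ) :
    VectorMeasure (Space d) E :=
  (r ^ d)⁻¹ • (μ.map (blowUpMap x₀ r)).restrict (unitCube d)

/-! ### Integrands -/

/-- The space `𝐄²(Ω; E)`: functions `f`, continuous on `Ω × Z × E`, such that
`(Tf)(x, ξ, ẑ) = (1 - |ẑ|) f(x, ξ, ẑ / (1 - |ẑ|))`, defined for `|ẑ| < 1`, has a continuous
extension to the closure of `Ω × Z × 𝔹_E`. (Values of `f` at `x ∉ Ω` are irrelevant.) -/
def IsIntegrand (Ω : Set (Space d)) (f : Space d → Torus d → E → ℝ) : Prop :=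
  ContinuousOn (fun p : Space d × Torus d × E => f p.1 p.2.1 p.2.2) (Ω ×ˢ univ ×ˢ univ) ∧
  ∃ F : Space d × Torus d × E → ℝ,
    ContinuousOn F (closure Ω ×ˢ univ ×ˢ Metric.closedBall 0 1) ∧
    ∀ x ∈ Ω, ∀ ξ : Torus d, ∀ z ∈ Metric.ball (0 : E) 1,
      F (x, ξ, z) = (1 - ‖z‖) * f x ξ ((1 - ‖z‖)⁻¹ • z)

/-- The strong recession function
`f^∞(x, ξ, z) = lim f(x', ξ', t z) / t` as `x' → x` in `Ω`, `ξ' → ξ`, `t → ∞`.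
The limit exists for every `f ∈ 𝐄²(Ω; E)` and `x ∈ closure Ω`. -/
def recession (Ω : Set (Space d)) (f : Space d → Torus d → E → ℝ)
    (x : Space d) (ξ : Torus d) (z : E) : ℝ :=
  limUnder (𝓝[Ω] x ×ˢ 𝓝 ξ ×ˢ atTop)
    (fun p : Space d × Torus d × ℝ => f p.1 p.2.1 (p.2.2 • z) / p.2.2)

/-- The functional
`I^ε_f(μ) = ∫_Ω f(x, x/ε, μ^ac(x)) dx + ∫_Ω f^∞(x, x/ε, μ_s(x)) d|μ^s|(x)`. -/
def energy (Ω : Set (Space d)) (f : Space d → Torus d → E → ℝ) (ε : ℝ)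
    (μ : VectorMeasure (Space d) E) : ℝ :=
  (∫ x in Ω, f x (toTorus (ε⁻¹ • x)) (acDensity μ x)) +
    ∫ x in Ω, recession Ω f x (toTorus (ε⁻¹ • x)) (singDensity μ x) ∂(singVar μ)

end

/-! ### Two-scale* Young measures -/

section Young

variable {d : ℕ}

/-- The set `𝐘²(Ω; E)` of two-scale* Young measures `(ν, λ, ρ, ν^∞)`. The maps `ν`, `ρ`, `ν^∞`
are total functions of which only the values almost everywhere with respect to
`𝓛ᵈ ⊗ 𝓛ᵈ_Z` on `closure Ω × Z`, to `λ`, and to `λ ⊗ ρ_x` respectively matter.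
The space `Measure _` carries the σ-algebra generated by the evaluations on measurable sets, so
that `AEMeasurable` is weak-* measurability. -/
structure TwoScaleYoungMeasure (Ω : Set (Space d)) (E : Type*) [NormedAddCommGroup E]
    [MeasurableSpace E] where
  nu : Space d → Torus d → Measure E
  lam : Measure (Space d)
  rho : Space d → Measure (Torus d)
  nuInf : Space d → Torus d → Measure (Metric.sphere (0 : E) 1)
  aemeasurable_nu : AEMeasurable (fun p : Space d × Torus d => nu p.1 p.2)
    ((volume.restrict (closure Ω)).prod volume)
  prob_nu : ∀ᵐ p : Space d × Torus d ∂((volume.restrict (closure Ω)).prod volume),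
    IsProbabilityMeasure (nu p.1 p.2)
  moment_nu : ∫⁻ p : Space d × Torus d, (∫⁻ z, ‖z‖ₑ ∂(nu p.1 p.2))
    ∂((volume.restrict (closure Ω)).prod volume) < ⊤
  finite_lam : IsFiniteMeasure lam
  support_lam : lam (closure Ω)ᶜ = 0
  aemeasurable_rho : AEMeasurable rho lam
  prob_rho : ∀ᵐ x ∂lam, IsProbabilityMeasure (rho x)
  aemeasurable_nuInf : AEMeasurable (fun p : Space d × Torus d => nuInf p.1 p.2)
    (genProd lam rho)
  prob_nuInf : ∀ᵐ p : Space d × Torus d ∂(genProd lam rho),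
    IsProbabilityMeasure (nuInf p.1 p.2)

variable {E : Type*} [NormedAddCommGroup E] [InnerProductSpace ℝ E] [FiniteDimensional ℝ E]
  [MeasurableSpace E]

/-- The duality pairing `⟪f, ν⟫` of an integrand and a two-scale* Young measure. -/
def pairing (Ω : Set (Space d)) (f : Space d → Torus d → E → ℝ)
    (ν : TwoScaleYoungMeasure Ω E) : ℝ :=
  (∫ x in Ω, ∫ ξ, ∫ z, f x ξ z ∂(ν.nu x ξ)) +
    ∫ x in closure Ω, ∫ ξ, ∫ z, recession Ω f x ξ (z : E) ∂(ν.nuInf x ξ) ∂(ν.rho x) ∂ν.lam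

/-- The sequence `μ` of measures, at the scales `ε`, generates `ν`:
`I^{ε_i}_f(μ_i) → ⟪f, ν⟫` for all `f ∈ 𝐄²(Ω; E)`. -/
def Generates (Ω : Set (Space d)) (ε : ℕ → ℝ) (μ : ℕ → VectorMeasure (Space d) E)
    (ν : TwoScaleYoungMeasure Ω E) : Prop :=
  ∀ f : Space d → Torus d → E → ℝ, IsIntegrand Ω f →
    Tendsto (fun i => energy Ω f (ε i) (μ i)) atTop (𝓝 (pairing Ω f ν))

/-- Weak-* convergence of two-scale* Young measures in `𝐄²(Ω; E)^*`. -/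
def WeakStarTendsto (Ω : Set (Space d)) (σ : ℕ → TwoScaleYoungMeasure Ω E)
    (ν : TwoScaleYoungMeasure Ω E) : Prop :=
  ∀ f : Space d → Torus d → E → ℝ, IsIntegrand Ω f →
    Tendsto (fun j => pairing Ω f (σ j)) atTop (𝓝 (pairing Ω f ν))

/-- `D ∈ 𝐘²(Q; E)` is a (regular) tangent two-scale* Young measure at `x₀` of the Young measure
generated by `μ` at the scales `ε`. There are radii `r_j → 0` and a subsequence `n` such that
for each fixed `j` the blow-ups `r_j⁻ᵈ T^(x₀,r_j)_# μ_{n(i)}`, at the scales `ε_{n(i)} / r_j`,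
generate some `σ_j ∈ 𝐘²(Q; E)` as `i → ∞`, and `σ_j` converges weakly-* to `D` as `j → ∞`.
Moreover a diagonal blow-up sequence, at scales converging to zero, generates `D` itself. -/
def IsTangent (ε : ℕ → ℝ) (μ : ℕ → VectorMeasure (Space d) E) (x₀ : Space d)
    (D : TwoScaleYoungMeasure (unitCube d) E) : Prop :=
  ∃ (r : ℕ → ℝ) (n : ℕ → ℕ) (σ : ℕ → TwoScaleYoungMeasure (unitCube d) E),
    (∀ j, 0 < r j) ∧ Tendsto r atTop (𝓝 0) ∧ StrictMono n ∧
    (∀ j, Generates (unitCube d) (fun i => ε (n i) / r j)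
      (fun i => blowUp (μ (n i)) x₀ (r j)) (σ j)) ∧
    WeakStarTendsto (unitCube d) σ D ∧
    ∃ m : ℕ → ℕ, StrictMono m ∧
      Tendsto (fun j => ε (n (m j)) / r j) atTop (𝓝 0) ∧
      Generates (unitCube d) (fun j => ε (n (m j)) / r j)
        (fun j => blowUp (μ (n (m j))) x₀ (r j)) D

end Young

/-! ### Tangent measures of positive measures -/

/-- The push-forward `T^(x₀,r)_# κ`, restricted to the closed cube `Q`. Its total mass is
`κ (x₀ + r Q)`. -/
def blowUpPos {d : ℕ} (κ : Measure (Space d)) (x₀ : Space d) (r : ℝ) : Measure (Space d) :=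
  (κ.map (blowUpMap x₀ r)).restrict (unitCube d)

/-- The set `Tan₁(κ, x₀)` of probability tangent measures on `Q`: weak-* limits of the
normalized blow-ups `κ(Q_{r_j}(x₀))⁻¹ T^(x₀,r_j)_# κ` along some `r_j → 0`. -/
def Tan₁ {d : ℕ} (κ : Measure (Space d)) (x₀ : Space d) : Set (Measure (Space d)) :=
  {τ | IsProbabilityMeasure τ ∧ τ (unitCube d)ᶜ = 0 ∧
    ∃ r : ℕ → ℝ, (∀ j, 0 < r j) ∧ Tendsto r atTop (𝓝 0) ∧
      (∀ j, 0 < blowUpPos κ x₀ (r j) univ) ∧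
      ∀ φ : Space d → ℝ, Continuous φ →
        Tendsto (fun j => ((blowUpPos κ x₀ (r j)).real univ)⁻¹ *
          ∫ y, φ y ∂(blowUpPos κ x₀ (r j))) atTop (𝓝 (∫ y, φ y ∂τ))}

end TwoScale

end

noncomputable section

namespace TwoScale

open ProbabilityTheory
open scoped BoundedContinuousFunction

/-! ### Compactification of the fibre -/

section Compactification

variable {E : Type*} [NormedAddCommGroup E] [InnerProductSpace ℝ E]

/-! On a bounded set, integrands are continuous functions on a compact space in disguise: write f(x,
ξ, z) = (1 + |z|) F(x, ξ, z / (1 + |z|)); the recession function is then |z| F(x, ξ, z / |z|).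
Energy and duality pairing become integrals of `F` against finite measures on `Space d × Fiber d E`
(`liftEnergy` and `liftKernels`), and generation is exactly weak convergence of these measures
(`IsLift.generates_iff`).

Since ((x - x₀) / r) / (ε / r) = x / ε - x₀ / ε, a blow-up acts on the lifted measure by rescaling
the macroscopic variable, translating the torus variable by -⟨x₀ / ε⟩ and multiplying by r⁻ᵈ
(`integral_liftEnergy_blowUp`). The torus is compact, so ⟨x₀ / ε⟩ converges to some ξ₀ along a
subsequence that does not depend on r; this is the ξ₀ of the theorem. For a fixed radius whose cube
has a boundary that is null for the limit, weak convergence survives both the restriction to the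
cube and the uniformly converging translations (`weakTendsto_liftEnergy_blowUp`). This gives the
measures σ_j.

The limit r → 0 is a Lebesgue point argument. Disintegrate the lifted Young measure into kernels A
over Lebesgue measure and B over λ, and consider the functionals h ↦ ∫ h dA_x + λ^ac(x) ∫ h dB_x on
continuous functions of the fibre. Separability of that function space makes almost every x₀ a
Lebesgue point for all of them at once, while the singular part of λ has zero density almost
everywhere (`ae_tendsto_blowUp_kernels`). The limit has the constant kernels A_{x₀} and B_{x₀}: the
components are frozen at x₀ and shifted by ξ₀. A diagonal argument, again by separability, gives the
diagonal sequence (`exists_strictMono_weakTendsto_diagonal`), and `exists_isTangent` assembles the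
pieces. -/

/-- The closed unit ball of `E`, the compactification of `E` used to define integrands. -/
abbrev UnitBall (E : Type*) [NormedAddCommGroup E] : Type _ := Metric.closedBall (0 : E) 1

/-- The compact space in which the micro-variable and the compactified values live. -/
abbrev Fiber (d : ℕ) (E : Type*) [NormedAddCommGroup E] : Type _ := Torus d × UnitBall E

theorem norm_squash_lt (z : E) : ‖(1 + ‖z‖)⁻¹ • z‖ < 1 := by
  rw [norm_smul, norm_inv, Real.norm_of_nonneg (by positivity), inv_mul_lt_one₀ (by positivity)]
  linarith

/-- The homeomorphism `z ↦ z / (1 + |z|)` of `E` onto the open unit ball. -/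
def squash (z : E) : UnitBall E :=
  ⟨(1 + ‖z‖)⁻¹ • z, by simpa using (norm_squash_lt z).le⟩

theorem continuous_squash : Continuous (squash : E → UnitBall E) := by
  refine Continuous.subtype_mk ?_ _
  exact (Continuous.inv₀ (by fun_prop) fun z => by positivity).smul continuous_id

/-- The direction `z / |z|` of a vector, with the convention that the direction of `0` is `0`. -/
def direction (z : E) : UnitBall E :=
  ⟨‖z‖⁻¹ • z, by
    rw [mem_closedBall_zero_iff, norm_smul, norm_inv, norm_norm]
    exact inv_mul_le_one⟩

theorem measurable_direction [MeasurableSpace E] [BorelSpace E] [FiniteDimensional ℝ E] :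
    Measurable (direction : E → UnitBall E) :=
  Measurable.subtype_mk (by fun_prop)

/-- The inclusion of the unit sphere into the unit ball. -/
def sphereIncl (z : Metric.sphere (0 : E) 1) : UnitBall E :=
  ⟨z, Metric.sphere_subset_closedBall z.2⟩

omit [InnerProductSpace ℝ E] in
theorem continuous_sphereIncl : Continuous (sphereIncl : Metric.sphere (0 : E) 1 → UnitBall E) :=
  Continuous.subtype_mk continuous_subtype_val _

theorem direction_sphere (z : Metric.sphere (0 : E) 1) : direction (z : E) = sphereIncl z := by
  have : ‖(z : E)‖ = 1 := by simp
  simp [direction, sphereIncl, this]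

theorem tendsto_squash_smul (z : E) (hz : z ≠ 0) :
    Tendsto (fun t : ℝ => squash (t • z)) atTop (𝓝 (direction z)) := by
  rw [tendsto_subtype_rng]
  have hz' : ‖z‖ ≠ 0 := norm_ne_zero_iff.2 hz
  -- For t > 0, t / (1 + t|z|) = 1 / (1/t + |z|), whose limit is visible.
  have h1 : Tendsto (fun t : ℝ => (t⁻¹ + ‖z‖)⁻¹ • z) atTop (𝓝 ((0 + ‖z‖)⁻¹ • z)) :=
    ((tendsto_inv_atTop_zero.add_const _).inv₀ (by simpa using hz')).smul_const z
  rw [zero_add] at h1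
  refine h1.congr' ?_
  filter_upwards [eventually_gt_atTop 0] with t ht
  simp only [squash, norm_smul, Real.norm_of_nonneg ht.le, smul_smul]
  congr 1
  field_simp

end Compactification

/-! ### Integrands as continuous functions on the compactification -/

section Representation

variable {d : ℕ} {E : Type*} [NormedAddCommGroup E] [InnerProductSpace ℝ E]

/-- The integrand with values in `E` determined by a function on the compactification. -/
def toIntegrand (F : Space d × Fiber d E → ℝ) (x : Space d) (ξ : Torus d) (z : E) : ℝ :=
  (1 + ‖z‖) * F (x, ξ, squash z)

/-- On `Ω`, the integrand `f` is the one determined by `F`. -/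
def Represents (Ω : Set (Space d)) (f : Space d → Torus d → E → ℝ)
    (F : Space d × Fiber d E → ℝ) : Prop :=
  ∀ x ∈ Ω, ∀ ξ z, f x ξ z = toIntegrand F x ξ z

/-- The map ẑ ↦ ẑ / (1 - |ẑ|) inverts `squash`, and 1 + |z| = 1 / (1 - |ẑ|) cancels the factor in
the transform; the required extension to the closed ball is therefore `F` itself. -/
theorem isIntegrand_toIntegrand (Ω : Set (Space d)) (F : Space d × Fiber d E → ℝ)
    (hF : Continuous F) : IsIntegrand Ω (toIntegrand F) := by
  classical
  refine ⟨?_, fun p => if h : ‖p.2.2‖ ≤ 1 then F (p.1, p.2.1, ⟨p.2.2, by simpa using h⟩) else 0,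
    ?_, ?_⟩
  · refine Continuous.continuousOn ?_
    unfold toIntegrand
    have := continuous_squash (E := E)
    fun_prop
  · rw [continuousOn_iff_continuous_domRestrict]
    have : Continuous fun p : closure Ω ×ˢ (univ : Set (Torus d)) ×ˢ Metric.closedBall (0 : E) 1 =>
        F (p.1.1, p.1.2.1, ⟨p.1.2.2, p.2.2.2⟩) := by
      refine hF.comp ?_
      refine (continuous_fst.comp continuous_subtype_val).prodMk
        ((continuous_fst.comp (continuous_snd.comp continuous_subtype_val)).prodMk ?_)
      exact Continuous.subtype_mk
        (continuous_snd.comp (continuous_snd.comp continuous_subtype_val)) _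
    refine this.congr fun p => ?_
    have : ‖p.1.2.2‖ ≤ 1 := by simpa using p.2.2.2
    simp [this]
  · intro x _ ξ z hz
    have hz : ‖z‖ < 1 := by simpa using hz
    have h1 : 0 < 1 - ‖z‖ := by linarith
    have hn : 1 + ‖(1 - ‖z‖)⁻¹ • z‖ = (1 - ‖z‖)⁻¹ := by
      rw [norm_smul, norm_inv, Real.norm_of_nonneg h1.le]
      field_simp
      ring
    simp only [hz.le, dite_true, toIntegrand, hn]
    rw [← mul_assoc, mul_inv_cancel₀ h1.ne', one_mul]
    congr 3
    ext
    simp only [squash, hn, inv_inv, smul_smul, mul_inv_cancel₀ h1.ne', one_smul]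

/-- The extended transform lives on a compact set because `Ω` is bounded; Tietze's theorem then
yields a bounded continuous function on the whole space, which can serve as a test function for weak
convergence. -/
theorem IsIntegrand.exists_represents [FiniteDimensional ℝ E] {Ω : Set (Space d)}
    (hΩ : Bornology.IsBounded Ω) {f : Space d → Torus d → E → ℝ} (hf : IsIntegrand Ω f) :
    ∃ F : Space d × Fiber d E →ᵇ ℝ, Represents Ω f F := by
  obtain ⟨-, F, hF, hFf⟩ := hf
  have hc : IsCompact (closure Ω ×ˢ (univ : Set (Fiber d E))) :=
    hΩ.isCompact_closure.prod isCompact_univ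
  have : CompactSpace (closure Ω ×ˢ (univ : Set (Fiber d E)) : Set _) :=
    isCompact_iff_compactSpace.1 hc
  let G : C((closure Ω ×ˢ (univ : Set (Fiber d E)) : Set _), ℝ) :=
    ⟨fun p => F (p.1.1, p.1.2.1, (p.1.2.2 : E)), by
      refine hF.comp_continuous (by fun_prop) fun p => ?_
      exact ⟨p.2.1, mem_univ _, p.1.2.2.2⟩⟩
  obtain ⟨H, -, hH⟩ := BoundedContinuousFunction.exists_norm_eq_domRestrict_eq_of_closed
    (BoundedContinuousFunction.mkOfCompact G) hc.isClosed
  refine ⟨H, fun x hx ξ z => ?_⟩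
  have h1 := DFunLike.congr_fun hH ⟨(x, ξ, squash z), subset_closure hx, mem_univ _⟩
  have h2 : H (x, ξ, squash z) = F (x, ξ, (squash z : E)) := h1
  have hp : (0 : ℝ) < 1 + ‖z‖ := by positivity
  have hn : 1 - ‖(1 + ‖z‖)⁻¹ • z‖ = (1 + ‖z‖)⁻¹ := by
    rw [norm_smul, norm_inv, Real.norm_of_nonneg hp.le]
    field_simp
    ring
  rw [toIntegrand, h2, hFf x hx ξ _ (by simpa [squash] using norm_squash_lt z)]
  simp only [squash, hn, inv_inv, smul_smul, mul_inv_cancel₀ hp.ne', one_smul]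
  rw [← mul_assoc, mul_inv_cancel₀ hp.ne', one_mul]

/-- Here f(x', ξ', tz) / t = (1/t + |z|) F(x', ξ', squash (tz)). Allowing every `z`, including 0,
means that the energy can be rewritten without knowing that the polar density has norm one. -/
theorem Represents.recession_eq {Ω : Set (Space d)} {f : Space d → Torus d → E → ℝ}
    {F : Space d × Fiber d E → ℝ} (hf : Represents Ω f F) (hF : Continuous F)
    {x : Space d} (hx : x ∈ closure Ω) (ξ : Torus d) (z : E) :
    recession Ω f x ξ z = ‖z‖ * F (x, ξ, direction z) := by
  have : NeBot (𝓝[Ω] x) := mem_closure_iff_nhdsWithin_neBot.1 hx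
  refine Tendsto.limUnder_eq ?_
  have ht : Tendsto (fun p : Space d × Torus d × ℝ => p.2.2) (𝓝[Ω] x ×ˢ 𝓝 ξ ×ˢ atTop) atTop :=
    tendsto_snd.comp tendsto_snd
  have hx' : Tendsto (fun p : Space d × Torus d × ℝ => p.1) (𝓝[Ω] x ×ˢ 𝓝 ξ ×ˢ atTop) (𝓝 x) :=
    tendsto_fst.mono_right nhdsWithin_le_nhds
  have hξ : Tendsto (fun p : Space d × Torus d × ℝ => p.2.1) (𝓝[Ω] x ×ˢ 𝓝 ξ ×ˢ atTop) (𝓝 ξ) :=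
    tendsto_fst.comp tendsto_snd
  have hsq : Tendsto (fun t : ℝ => squash (t • z)) atTop (𝓝 (direction z)) := by
    rcases eq_or_ne z 0 with rfl | hz
    · simpa [squash, direction] using tendsto_const_nhds
    · exact tendsto_squash_smul z hz
  have key : Tendsto (fun p : Space d × Torus d × ℝ =>
      (p.2.2⁻¹ + ‖z‖) * F (p.1, p.2.1, squash (p.2.2 • z))) (𝓝[Ω] x ×ˢ 𝓝 ξ ×ˢ atTop)
      (𝓝 ((0 + ‖z‖) * F (x, ξ, direction z))) :=
    ((tendsto_inv_atTop_zero.comp ht).add_const _).mul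
      ((hF.tendsto _).comp (hx'.prodMk_nhds (hξ.prodMk_nhds (hsq.comp ht))))
  rw [zero_add] at key
  refine key.congr' ?_
  have hmem : ∀ᶠ p : Space d × Torus d × ℝ in 𝓝[Ω] x ×ˢ 𝓝 ξ ×ˢ atTop, p.1 ∈ Ω :=
    tendsto_fst.eventually self_mem_nhdsWithin
  filter_upwards [hmem, ht.eventually (eventually_gt_atTop 0)] with p hp hp'
  rw [hf p.1 hp, toIntegrand, norm_smul, Real.norm_of_nonneg hp'.le]
  field_simp

theorem Represents.recession_sphere {Ω : Set (Space d)} {f : Space d → Torus d → E → ℝ}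
    {F : Space d × Fiber d E → ℝ} (hf : Represents Ω f F) (hF : Continuous F)
    {x : Space d} (hx : x ∈ closure Ω) (ξ : Torus d) (z : Metric.sphere (0 : E) 1) :
    recession Ω f x ξ z = F (x, ξ, sphereIncl z) := by
  have : ‖(z : E)‖ = 1 := by simp
  rw [hf.recession_eq hF hx, this, one_mul, direction_sphere]

end Representation

/-! ### Blow-ups of vector measures -/

section VectorBlowUp

variable {X : Type*} [MeasurableSpace X]

/-- Radon-Nikodym derivatives are transported by rescaled push-forwards. -/
theorem rnDeriv_smul_map_restrict (s : SignedMeasure X) (τ τ' : Measure X) [SigmaFinite τ]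
    (T : X ≃ᵐ X) {Q : Set X} (hQ : MeasurableSet Q) {c : ℝ} (hc : 0 ≤ c)
    (h : ENNReal.ofReal c • (τ.map T).restrict Q = τ'.restrict Q) :
    SignedMeasure.rnDeriv (c • (s.map T).restrict Q) τ' =ᵐ[τ'] Q.indicator (s.rnDeriv τ ∘ T.symm) := by
  have hrn : Integrable (s.rnDeriv τ) τ := s.integrable_rnDeriv τ
  have hint : Integrable (s.rnDeriv τ ∘ T.symm) (τ.map T) := by
    rw [integrable_map_equiv]
    simpa [Function.comp_def] using hrn
  have hint' : IntegrableOn (s.rnDeriv τ ∘ T.symm) Q τ' := by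
    rw [IntegrableOn, ← h]
    exact hint.integrableOn.smul_measure ENNReal.ofReal_ne_top
  have hint'' : Integrable (Q.indicator (s.rnDeriv τ ∘ T.symm)) τ' :=
    (integrable_indicator_iff hQ).2 hint'
  -- Uniqueness of the Lebesgue decomposition: the transported singular part and the transported
  -- density decompose the transported measure.
  refine (SignedMeasure.eq_rnDeriv (c • ((s.singularPart τ).map T).restrict Q) _ hint'' ?_ ?_).symm
  · obtain ⟨u, hu, hsu, hτu⟩ := s.mutuallySingular_singularPart τ
    -- The complement of `Q` joins the set on which the transported singular part vanishes, since
    -- `h` controls `τ'` only inside `Q`.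
    refine VectorMeasure.MutuallySingular.mk (T.symm ⁻¹' u ∪ Qᶜ)
      ((T.symm.measurable hu).union hQ.compl) (fun v hv hvm => ?_) (fun v hv hvm => ?_)
    · rw [_root_.smul_apply, VectorMeasure.restrict_apply _ hQ hvm,
        VectorMeasure.map_apply _ T.measurable (hvm.inter hQ), hsu _ ?_, smul_zero]
      rintro x ⟨hx, hxQ⟩
      rcases hv hx with h1 | h1
      · simpa using h1
      · exact absurd hxQ h1
    · rw [Measure.toENNRealVectorMeasure_apply_measurable hvm]
      have hvQ : v ⊆ Q := fun x hx => by
        by_contra hn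
        exact hv hx (Or.inr hn)
      rw [← Measure.restrict_eq_self τ' hvQ, ← h, Measure.smul_apply,
        Measure.restrict_eq_self _ hvQ, T.map_apply]
      have := hτu (T ⁻¹' v) (fun x hx hxu => hv hx (Or.inl (by simpa using hxu)))
      rw [Measure.toENNRealVectorMeasure_apply_measurable (T.measurable hvm)] at this
      simp [this]
  · ext v hv
    have hvQ := hv.inter hQ
    have hdec := congrArg (fun m => m (T ⁻¹' (v ∩ Q)))
      (s.singularPart_add_withDensity_rnDeriv_eq τ)
    simp only [_root_.add_apply] at hdec
    rw [_root_.add_apply, _root_.smul_apply, _root_.smul_apply,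
      VectorMeasure.restrict_apply _ hQ hv, VectorMeasure.restrict_apply _ hQ hv,
      VectorMeasure.map_apply _ T.measurable hvQ, VectorMeasure.map_apply _ T.measurable hvQ,
      ← hdec, smul_add, withDensityᵥ_apply hrn (T.measurable hvQ), withDensityᵥ_apply hint'' hv,
      setIntegral_indicator hQ]
    congr 1
    have h1 : τ'.restrict (v ∩ Q) = ENNReal.ofReal c • (τ.map T).restrict (v ∩ Q) := by
      rw [← Measure.restrict_restrict hv, ← h, Measure.restrict_smul, Measure.restrict_restrict hv]
    rw [h1, integral_smul_measure, ENNReal.toReal_ofReal hc, setIntegral_map_equiv]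
    simp

variable {E : Type*} [NormedAddCommGroup E] [InnerProductSpace ℝ E] [FiniteDimensional ℝ E]

theorem integrable_density (μ : VectorMeasure X E) (τ : Measure X) : Integrable (density μ τ) τ :=
  integrable_finsetSum _ fun _ _ => (SignedMeasure.integrable_rnDeriv _ _).smul_const _

theorem measurable_density [MeasurableSpace E] [BorelSpace E] (μ : VectorMeasure X E)
    (τ : Measure X) : Measurable (density μ τ) :=
  Finset.measurable_fun_sum _ fun _ _ => (SignedMeasure.measurable_rnDeriv _ _).smul_const _

/-- Each coordinate is a signed measure, so the scalar case applies in an orthonormal basis. The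
general pair `τ`, `τ'` serves twice: with Lebesgue measure, and with the total variation of the
singular part. -/
theorem density_smul_map_restrict (μ : VectorMeasure X E) (τ τ' : Measure X) [SigmaFinite τ]
    (T : X ≃ᵐ X) {Q : Set X} (hQ : MeasurableSet Q) {c : ℝ} (hc : 0 ≤ c)
    (h : ENNReal.ofReal c • (τ.map T).restrict Q = τ'.restrict Q) :
    density (c • (μ.map T).restrict Q) τ' =ᵐ[τ'] Q.indicator (density μ τ ∘ T.symm) := by
  have hco : ∀ v : E, coord (c • (μ.map T).restrict Q) v = c • ((coord μ v).map T).restrict Q := by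
    intro v
    ext s hs
    rw [coord_apply, _root_.smul_apply, _root_.smul_apply,
      VectorMeasure.restrict_apply _ hQ hs, VectorMeasure.restrict_apply _ hQ hs,
      VectorMeasure.map_apply _ T.measurable (hs.inter hQ),
      VectorMeasure.map_apply _ T.measurable (hs.inter hQ), coord_apply, inner_smul_right]
    rfl
  have hall := fun i => rnDeriv_smul_map_restrict (coord μ (stdOrthonormalBasis ℝ E i)) τ τ' T hQ
    hc h
  filter_upwards [ae_all_iff.2 hall] with x hx
  simp only [density, hco, hx]
  by_cases hxQ : x ∈ Q <;> simp [hxQ, density]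

/-- Expand each value of `μ` in an orthonormal basis. The bound makes variations finite, as is
needed for densities with respect to `singVar`. -/
theorem variation_le_sum_totalVariation_coord (μ : VectorMeasure X E) :
    μ.variation ≤ ∑ i, (coord μ (stdOrthonormalBasis ℝ E i)).totalVariation := by
  refine VectorMeasure.variation_le_of_forall_enorm_le fun s _ => ?_
  rw [Measure.finsetSum_apply]
  calc ‖μ s‖ₑ = ‖∑ i, inner ℝ (stdOrthonormalBasis ℝ E i) (μ s) • stdOrthonormalBasis ℝ E i‖ₑ := by
        rw [(stdOrthonormalBasis ℝ E).sum_repr']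
    _ ≤ ∑ i, ‖inner ℝ (stdOrthonormalBasis ℝ E i) (μ s) • stdOrthonormalBasis ℝ E i‖ₑ :=
        enorm_sum_le _ _
    _ ≤ _ := Finset.sum_le_sum fun i _ => by
        rw [enorm_smul, ← ofReal_norm (stdOrthonormalBasis ℝ E i),
          (stdOrthonormalBasis ℝ E).norm_eq_one, ENNReal.ofReal_one, mul_one, ← coord_apply]
        exact SignedMeasure.enorm_le_totalVariation _ _

instance isFiniteMeasure_variation (μ : VectorMeasure X E) : IsFiniteMeasure μ.variation := by
  refine isFiniteMeasure_of_le _ (variation_le_sum_totalVariation_coord μ)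

end VectorBlowUp

/-! ### Lebesgue decomposition of a blow-up on the unit cube -/

section SpaceBlowUp

variable {d : ℕ} {E : Type*} [NormedAddCommGroup E] [InnerProductSpace ℝ E]
  [FiniteDimensional ℝ E]

/-- The blow-up map as a homeomorphism. -/
def blowUpHomeo (x₀ : Space d) {r : ℝ} (hr : 0 < r) : Space d ≃ₜ Space d :=
  (Homeomorph.subRight x₀).trans (Homeomorph.smulOfNeZero r⁻¹ (inv_ne_zero hr.ne'))

/-- The blow-up map as a measurable equivalence. -/
def blowUpEquiv (x₀ : Space d) {r : ℝ} (hr : 0 < r) : Space d ≃ᵐ Space d :=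
  (blowUpHomeo x₀ hr).toMeasurableEquiv

@[simp]
theorem coe_blowUpEquiv (x₀ : Space d) {r : ℝ} (hr : 0 < r) :
    ⇑(blowUpEquiv x₀ hr) = blowUpMap x₀ r := rfl

theorem blowUpEquiv_symm_apply (x₀ : Space d) {r : ℝ} (hr : 0 < r) (y : Space d) :
    (blowUpEquiv x₀ hr).symm y = x₀ + r • y := by
  rw [MeasurableEquiv.symm_apply_eq, coe_blowUpEquiv, blowUpMap, add_sub_cancel_left,
    inv_smul_smul₀ hr.ne']

theorem map_blowUpMap_volume (x₀ : Space d) {r : ℝ} (hr : 0 < r) :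
    ENNReal.ofReal (r ^ d)⁻¹ • (volume : Measure (Space d)).map (blowUpMap x₀ r) = volume := by
  have h1 : blowUpMap x₀ r = (fun x => r⁻¹ • x) ∘ (fun x => x - x₀) := rfl
  have h2 : Measurable fun x : Space d => r⁻¹ • x := by fun_prop
  rw [h1, ← Measure.map_map h2 (by fun_prop), map_sub_right_eq_self,
    Measure.map_addHaar_smul _ (inv_ne_zero hr.ne'), smul_smul, finrank_euclideanSpace_fin,
    inv_pow, inv_inv, abs_of_pos (by positivity), ← ENNReal.ofReal_mul (by positivity),
    inv_mul_cancel₀ (by positivity), ENNReal.ofReal_one, one_smul]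

theorem isClosed_unitCube : IsClosed (unitCube d) := by
  have : unitCube d = ⋂ i, (fun y : Space d => y i) ⁻¹' Icc (0 : ℝ) 1 := by
    ext; simp [unitCube]
  rw [this]
  exact isClosed_iInter fun i => isClosed_Icc.preimage (by fun_prop)

theorem measurableSet_unitCube : MeasurableSet (unitCube d) := isClosed_unitCube.measurableSet

theorem integrable_acDensity (μ : VectorMeasure (Space d) E) : Integrable (acDensity μ) :=
  integrable_density _ _

/-- The factor r⁻ᵈ is exactly the Jacobian of the blow-up, so the density is composed with the
inverse map but not rescaled. -/
theorem acDensity_blowUp (μ : VectorMeasure (Space d) E) (x₀ : Space d) {r : ℝ} (hr : 0 < r) :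
    acDensity (blowUp μ x₀ r) =ᵐ[volume]
      (unitCube d).indicator fun y => acDensity μ (x₀ + r • y) := by
  have h := density_smul_map_restrict μ volume volume (blowUpEquiv x₀ hr) measurableSet_unitCube
    (c := (r ^ d)⁻¹) (by positivity) (by
      rw [← Measure.restrict_smul, coe_blowUpEquiv, map_blowUpMap_volume x₀ hr])
  have h2 : density μ volume ∘ (blowUpEquiv x₀ hr).symm = fun y => acDensity μ (x₀ + r • y) := by
    ext y
    simp [blowUpEquiv_symm_apply, acDensity]
  rw [h2] at h
  exact h

theorem singPart_blowUp (μ : VectorMeasure (Space d) E) (x₀ : Space d) {r : ℝ} (hr : 0 < r) :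
    singPart (blowUp μ x₀ r) = blowUp (singPart μ) x₀ r := by
  ext s hs
  have hsQ := hs.inter (measurableSet_unitCube (d := d))
  have hT : Measurable (blowUpMap x₀ r) := (blowUpEquiv x₀ hr).measurable
  simp only [singPart, blowUp, sub_apply, _root_.smul_apply,
    VectorMeasure.restrict_apply _ measurableSet_unitCube hs,
    VectorMeasure.map_apply _ hT hsQ, smul_sub]
  congr 1
  rw [withDensityᵥ_apply (integrable_acDensity _) hs,
    withDensityᵥ_apply (integrable_acDensity _) (hT hsQ)]
  change ∫ x in s, acDensity (blowUp μ x₀ r) x = _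
  rw [setIntegral_congr_ae hs ((acDensity_blowUp μ x₀ hr).mono fun x hx _ => hx),
    setIntegral_indicator measurableSet_unitCube]
  nth_rw 1 [← map_blowUpMap_volume x₀ hr]
  rw [Measure.restrict_smul, integral_smul_measure, ENNReal.toReal_ofReal (by positivity),
    ← coe_blowUpEquiv x₀ hr, setIntegral_map_equiv]
  simp_rw [← blowUpEquiv_symm_apply x₀ hr, MeasurableEquiv.symm_apply_apply]

theorem singVar_blowUp (μ : VectorMeasure (Space d) E) (x₀ : Space d) {r : ℝ} (hr : 0 < r) :
    singVar (blowUp μ x₀ r) =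
      ENNReal.ofReal (r ^ d)⁻¹ • ((singVar μ).map (blowUpMap x₀ r)).restrict (unitCube d) := by
  rw [singVar, singPart_blowUp μ x₀ hr, blowUp, VectorMeasure.variation_smul,
    VectorMeasure.variation_restrict measurableSet_unitCube, ← coe_blowUpEquiv x₀ hr,
    (blowUpEquiv x₀ hr).measurableEmbedding.variation_map]
  have : ((‖(r ^ d)⁻¹‖₊ : NNReal) : ENNReal) = ENNReal.ofReal (r ^ d)⁻¹ := by
    rw [← enorm_eq_nnnorm, Real.enorm_of_nonneg (by positivity)]
  rw [← this]
  rfl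

/-- By `singVar_blowUp` the measure and its variation are transported by the same rescaled
push-forward, so the factor cancels in their ratio. -/
theorem singDensity_blowUp (μ : VectorMeasure (Space d) E) (x₀ : Space d) {r : ℝ} (hr : 0 < r) :
    singDensity (blowUp μ x₀ r) =ᵐ[singVar (blowUp μ x₀ r)]
      fun y => singDensity μ (x₀ + r • y) := by
  have hfin : IsFiniteMeasure (singVar μ) := isFiniteMeasure_variation _
  have h := density_smul_map_restrict (singPart μ) (singVar μ) (singVar (blowUp μ x₀ r))
    (blowUpEquiv x₀ hr) measurableSet_unitCube (c := (r ^ d)⁻¹) (by positivity) (by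
      rw [singVar_blowUp μ x₀ hr, Measure.restrict_smul,
        Measure.restrict_restrict measurableSet_unitCube, inter_self, coe_blowUpEquiv])
  have hQ : ∀ᵐ y ∂(singVar (blowUp μ x₀ r)), y ∈ unitCube d := by
    rw [singVar_blowUp μ x₀ hr]
    exact Measure.ae_smul_measure (ae_restrict_mem measurableSet_unitCube) _
  rw [singDensity, singPart_blowUp μ x₀ hr]
  filter_upwards [h, hQ] with y hy hyQ
  refine hy.trans ?_
  rw [indicator_of_mem hyQ, Function.comp_apply, blowUpEquiv_symm_apply, singDensity]

end SpaceBlowUp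

/-! ### The measure on the compactification that represents the energy -/

section LiftEnergy

variable {d : ℕ} {E : Type*} [NormedAddCommGroup E] [InnerProductSpace ℝ E]
  [FiniteDimensional ℝ E] [MeasurableSpace E] [BorelSpace E]

theorem measurable_toTorus : Measurable (toTorus : Space d → Torus d) :=
  measurable_pi_iff.2 fun i => AddCircle.measurable_mk'.comp (by fun_prop)

theorem measurable_acDensity (μ : VectorMeasure (Space d) E) : Measurable (acDensity μ) :=
  measurable_density _ _

theorem measurable_singDensity (μ : VectorMeasure (Space d) E) : Measurable (singDensity μ) :=
  measurable_density _ _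

/-- The point of the fibre given by the fast variable and the density `μ^ac`. -/
def acFiber (ε : ℝ) (μ : VectorMeasure (Space d) E) (x : Space d) : Fiber d E :=
  (toTorus (ε⁻¹ • x), squash (acDensity μ x))

/-- The point of the fibre given by the fast variable and the polar density `μ_s`. -/
def singFiber (ε : ℝ) (μ : VectorMeasure (Space d) E) (x : Space d) : Fiber d E :=
  (toTorus (ε⁻¹ • x), direction (singDensity μ x))

theorem measurable_acFiber (ε : ℝ) (μ : VectorMeasure (Space d) E) : Measurable (acFiber ε μ) :=
  (measurable_toTorus.comp (by fun_prop)).prodMk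
    (continuous_squash.measurable.comp (measurable_acDensity μ))

theorem measurable_singFiber (ε : ℝ) (μ : VectorMeasure (Space d) E) :
    Measurable (singFiber ε μ) :=
  (measurable_toTorus.comp (by fun_prop)).prodMk
    (measurable_direction.comp (measurable_singDensity μ))

/-- The measure on `U × Z × 𝔹_E` against which the energy of `μ` on `U` is an integral. -/
def liftEnergy (U : Set (Space d)) (ε : ℝ) (μ : VectorMeasure (Space d) E) :
    Measure (Space d × Fiber d E) :=
  ((volume.restrict U).withDensity fun x => ENNReal.ofReal (1 + ‖acDensity μ x‖)).map
      (fun x => (x, acFiber ε μ x)) +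
    (((singVar μ).restrict U).withDensity fun x => ENNReal.ofReal ‖singDensity μ x‖).map
      (fun x => (x, singFiber ε μ x))

omit [BorelSpace E] in
theorem isFiniteMeasure_liftEnergy {U : Set (Space d)} (hU : volume U ≠ ⊤) (ε : ℝ)
    (μ : VectorMeasure (Space d) E) : IsFiniteMeasure (liftEnergy U ε μ) := by
  have : IsFiniteMeasure ((volume : Measure (Space d)).restrict U) :=
    ⟨by simpa using hU.lt_top⟩
  have h1 : IsFiniteMeasure
      ((volume.restrict U).withDensity fun x => ENNReal.ofReal (1 + ‖acDensity μ x‖)) :=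
    isFiniteMeasure_withDensity_ofReal
      ((integrable_const _).add (integrable_acDensity μ).restrict.norm).2
  have h2 : IsFiniteMeasure
      (((singVar μ).restrict U).withDensity fun x => ENNReal.ofReal ‖singDensity μ x‖) :=
    isFiniteMeasure_withDensity_ofReal (integrable_density _ _).restrict.norm.2
  unfold liftEnergy
  infer_instance

theorem integral_liftEnergy {U : Set (Space d)} (hU : volume U ≠ ⊤) (ε : ℝ)
    (μ : VectorMeasure (Space d) E) (F : Space d × Fiber d E →ᵇ ℝ) :
    ∫ p, F p ∂(liftEnergy U ε μ) =
      (∫ x in U, (1 + ‖acDensity μ x‖) * F (x, acFiber ε μ x)) +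
        ∫ x in U, ‖singDensity μ x‖ * F (x, singFiber ε μ x) ∂(singVar μ) := by
  have hfin := isFiniteMeasure_liftEnergy hU ε μ
  have hint := F.integrable (liftEnergy U ε μ)
  have hFm : Measurable F := F.continuous.measurable
  have hac := measurable_acDensity μ
  have hsing := measurable_singDensity μ
  have hm1 : Measurable fun x => (x, acFiber ε μ x) :=
    measurable_id.prodMk (measurable_acFiber ε μ)
  have hm2 : Measurable fun x => (x, singFiber ε μ x) :=
    measurable_id.prodMk (measurable_singFiber ε μ)
  unfold liftEnergy at hint ⊢
  rw [integral_add_measure (integrable_add_measure.1 hint).1 (integrable_add_measure.1 hint).2,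
    integral_map hm1.aemeasurable hFm.aestronglyMeasurable,
    integral_map hm2.aemeasurable hFm.aestronglyMeasurable,
    integral_withDensity_eq_integral_toReal_smul (by fun_prop) (by simp),
    integral_withDensity_eq_integral_toReal_smul (by fun_prop) (by simp)]
  congr 1
  · refine integral_congr_ae (ae_of_all _ fun x => ?_)
    simp only [smul_eq_mul]
    rw [ENNReal.toReal_ofReal (by positivity)]
  · refine integral_congr_ae (ae_of_all _ fun x => ?_)
    simp only [smul_eq_mul]
    rw [ENNReal.toReal_ofReal (by positivity)]

theorem energy_eq_integral_liftEnergy {U : Set (Space d)} (hUm : MeasurableSet U)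
    (hU : volume U ≠ ⊤) (ε : ℝ) (μ : VectorMeasure (Space d) E)
    {f : Space d → Torus d → E → ℝ} (F : Space d × Fiber d E →ᵇ ℝ) (hf : Represents U f F) :
    energy U f ε μ = ∫ p, F p ∂(liftEnergy U ε μ) := by
  rw [integral_liftEnergy hU, energy]
  congr 1
  · refine setIntegral_congr_fun hUm fun x hx => ?_
    simp only [hf x hx, toIntegrand, acFiber]
  · refine setIntegral_congr_fun hUm fun x hx => ?_
    simp only [hf.recession_eq F.continuous (subset_closure hx), singFiber]

theorem restrict_liftEnergy {K U : Set (Space d)} (hK : MeasurableSet K) (hKU : K ⊆ U) (ε : ℝ)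
    (μ : VectorMeasure (Space d) E) :
    (liftEnergy U ε μ).restrict (K ×ˢ univ) = liftEnergy K ε μ := by
  have hKm : MeasurableSet (K ×ˢ (univ : Set (Fiber d E))) := hK.prod MeasurableSet.univ
  have hm1 : Measurable fun x => (x, acFiber ε μ x) :=
    measurable_id.prodMk (measurable_acFiber ε μ)
  have hm2 : Measurable fun x => (x, singFiber ε μ x) :=
    measurable_id.prodMk (measurable_singFiber ε μ)
  have hp : ∀ g : Space d → Fiber d E,
      (fun x => (x, g x)) ⁻¹' (K ×ˢ (univ : Set (Fiber d E))) = K := fun g => by ext; simp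
  rw [liftEnergy, Measure.restrict_add, Measure.restrict_map hm1 hKm, Measure.restrict_map hm2 hKm,
    hp, hp, restrict_withDensity hK, restrict_withDensity hK, Measure.restrict_restrict hK,
    Measure.restrict_restrict hK, inter_eq_self_of_subset_left hKU, liftEnergy]

theorem toTorus_sub (x y : Space d) : toTorus (x - y) = toTorus x - toTorus y := by
  ext i
  simp [toTorus]

/-- The blow-up of macroscopic points together with a translation of the microscopic variable. -/
def blowUpShift (x₀ : Space d) (r : ℝ) (τ : Torus d) (p : Space d × Fiber d E) :
    Space d × Fiber d E :=
  (blowUpMap x₀ r p.1, p.2.1 - τ, p.2.2)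

omit [InnerProductSpace ℝ E] [FiniteDimensional ℝ E] [MeasurableSpace E] [BorelSpace E] in
theorem continuous_blowUpShift (x₀ : Space d) (r : ℝ) (τ : Torus d) :
    Continuous (blowUpShift x₀ r τ : Space d × Fiber d E → Space d × Fiber d E) := by
  unfold blowUpShift blowUpMap
  fun_prop

/-- The cube `x₀ + r Q`. -/
def cubeAt (x₀ : Space d) (r : ℝ) : Set (Space d) := blowUpMap x₀ r ⁻¹' unitCube d

theorem isClosed_cubeAt (x₀ : Space d) (r : ℝ) : IsClosed (cubeAt x₀ r) :=
  isClosed_unitCube.preimage (by unfold blowUpMap; fun_prop)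

theorem volume_unitCube : volume (unitCube d) = 1 := by
  have h : unitCube d = WithLp.ofLp ⁻¹' (univ.pi fun _ => Icc (0 : ℝ) 1) := by
    ext
    simp only [unitCube, mem_ofPred_eq, mem_preimage, mem_univ_pi]
  rw [h, (PiLp.volume_preserving_ofLp (Fin d)).measure_preimage
    (MeasurableSet.univ_pi fun _ => measurableSet_Icc).nullMeasurableSet, volume_pi_pi]
  simp

theorem volume_unitCube_ne_top : volume (unitCube d) ≠ ⊤ := by
  simp [volume_unitCube]

theorem volume_cubeAt_ne_top (x₀ : Space d) {r : ℝ} (hr : 0 < r) : volume (cubeAt x₀ r) ≠ ⊤ := by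
  intro h
  have h2 := volume_unitCube_ne_top (d := d)
  rw [← map_blowUpMap_volume x₀ hr, Measure.smul_apply, ← coe_blowUpEquiv x₀ hr,
    MeasurableEquiv.map_apply, coe_blowUpEquiv] at h2
  refine h2 ?_
  change _ • volume (cubeAt x₀ r) = _
  rw [h, smul_eq_mul, ENNReal.mul_top]
  simp [hr]

theorem restrict_unitCube_eq_map (τ : Measure (Space d)) (x₀ : Space d) {r : ℝ} (hr : 0 < r) :
    (τ.map (blowUpMap x₀ r)).restrict (unitCube d) =
      (τ.restrict (cubeAt x₀ r)).map (blowUpMap x₀ r) := by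
  rw [← coe_blowUpEquiv x₀ hr, MeasurableEquiv.restrict_map]
  rfl

/-- The blown-up fast variable is ((x - x₀) / r) / (ε / r) = x / ε - x₀ / ε. Hence the only
microscopic effect of a blow-up is a torus translation, whose amount does not depend on r. -/
theorem integral_liftEnergy_blowUp (ε : ℝ) (μ : VectorMeasure (Space d) E) (x₀ : Space d)
    {r : ℝ} (hr : 0 < r) (F : Space d × Fiber d E →ᵇ ℝ) :
    ∫ p, F p ∂(liftEnergy (unitCube d) (ε / r) (blowUp μ x₀ r)) =
      (r ^ d)⁻¹ * ∫ p, F (blowUpShift x₀ r (toTorus (ε⁻¹ • x₀)) p)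
        ∂(liftEnergy (cubeAt x₀ r) ε μ) := by
  have hrd : (0 : ℝ) ≤ (r ^ d)⁻¹ := by positivity
  have hpt : ∀ x, toTorus ((ε / r)⁻¹ • blowUpMap x₀ r x) =
      toTorus (ε⁻¹ • x) - toTorus (ε⁻¹ • x₀) := by
    intro x
    rw [← toTorus_sub, ← smul_sub, blowUpMap, smul_smul, inv_div]
    congr 2
    field_simp
  have hsymm : ∀ x, x₀ + r • blowUpMap x₀ r x = x := by
    intro x
    rw [← blowUpEquiv_symm_apply x₀ hr, ← coe_blowUpEquiv x₀ hr, MeasurableEquiv.symm_apply_apply]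
  have key : ∀ (τ : Measure (Space d)) (g : Space d → ℝ),
      ∫ y, g y ∂(ENNReal.ofReal (r ^ d)⁻¹ • (τ.map (blowUpMap x₀ r)).restrict (unitCube d)) =
        (r ^ d)⁻¹ * ∫ x in cubeAt x₀ r, g (blowUpMap x₀ r x) ∂τ := by
    intro τ g
    rw [restrict_unitCube_eq_map τ x₀ hr, integral_smul_measure, ENNReal.toReal_ofReal hrd,
      ← coe_blowUpEquiv x₀ hr, integral_map_equiv, smul_eq_mul]
  let G := F.compContinuous ⟨_, continuous_blowUpShift (E := E) x₀ r (toTorus (ε⁻¹ • x₀))⟩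
  have hG := integral_liftEnergy (volume_cubeAt_ne_top x₀ hr) ε μ G
  rw [integral_liftEnergy volume_unitCube_ne_top]
  refine Eq.trans ?_ (congrArg _ hG.symm)
  rw [mul_add]
  congr 1
  · have h1 : ∀ᵐ y ∂(volume.restrict (unitCube d)),
        (1 + ‖acDensity (blowUp μ x₀ r) y‖) * F (y, acFiber (ε / r) (blowUp μ x₀ r) y) =
        (1 + ‖acDensity μ (x₀ + r • y)‖) * F (y, toTorus ((ε / r)⁻¹ • y),
          squash (acDensity μ (x₀ + r • y))) := by
      filter_upwards [ae_restrict_of_ae (acDensity_blowUp μ x₀ hr),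
        ae_restrict_mem measurableSet_unitCube] with y hy hyQ
      rw [indicator_of_mem hyQ] at hy
      rw [acFiber, hy]
    rw [integral_congr_ae h1]
    nth_rw 1 [← map_blowUpMap_volume x₀ hr]
    rw [Measure.restrict_smul, key]
    simp only [hpt, hsymm]
    rfl
  · have h1 : ∀ᵐ y ∂(singVar (blowUp μ x₀ r)).restrict (unitCube d),
        ‖singDensity (blowUp μ x₀ r) y‖ * F (y, singFiber (ε / r) (blowUp μ x₀ r) y) =
        ‖singDensity μ (x₀ + r • y)‖ * F (y, toTorus ((ε / r)⁻¹ • y),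
          direction (singDensity μ (x₀ + r • y))) := by
      filter_upwards [ae_restrict_of_ae (singDensity_blowUp μ x₀ hr)] with y hy
      rw [singFiber, hy]
    rw [integral_congr_ae h1, singVar_blowUp μ x₀ hr, Measure.restrict_smul,
      Measure.restrict_restrict measurableSet_unitCube, inter_self, key]
    simp only [hpt, hsymm]
    rfl

end LiftEnergy

/-! ### Weak convergence of finite measures -/

section WeakConvergence

variable {P : Type*} [MetricSpace P] [MeasurableSpace P] [BorelSpace P]

/-- Weak convergence of measures, tested against bounded continuous functions. -/
def WeakTendsto (M : ℕ → Measure P) (M₀ : Measure P) : Prop :=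
  ∀ F : P →ᵇ ℝ, Tendsto (fun i => ∫ p, F p ∂(M i)) atTop (𝓝 (∫ p, F p ∂M₀))

/-- A continuous majorant of the indicator function of the frontier of `A`. -/
def frontierBump (A : Set P) {δ : ℝ} (hδ : 0 < δ) : P →ᵇ ℝ :=
  BoundedContinuousFunction.mkOfBound
    ⟨fun p => (thickenedIndicator hδ A p : ℝ) + (thickenedIndicator hδ Aᶜ p : ℝ) - 1, by fun_prop⟩
    4 (by
      intro p q
      have h : ∀ (B : Set P) p, (thickenedIndicator hδ B p : ℝ) ≤ 1 := fun B p => by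
        exact_mod_cast thickenedIndicator_le_one hδ B p
      have h0 : ∀ (B : Set P) p, (0 : ℝ) ≤ thickenedIndicator hδ B p := fun B p => by positivity
      rw [Real.dist_eq, abs_le]
      constructor <;>
        simp only [ContinuousMap.coe_mk] <;>
        linarith [h A p, h A q, h Aᶜ p, h Aᶜ q, h0 A p, h0 A q, h0 Aᶜ p, h0 Aᶜ q])

omit [MeasurableSpace P] [BorelSpace P] in
theorem frontierBump_apply (A : Set P) {δ : ℝ} (hδ : 0 < δ) (p : P) :
    frontierBump A hδ p =
      (thickenedIndicator hδ A p : ℝ) + (thickenedIndicator hδ Aᶜ p : ℝ) - 1 := rfl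

/-- The thickened indicator function as a real-valued bounded continuous function. -/
def realThickenedIndicator (A : Set P) {δ : ℝ} (hδ : 0 < δ) : P →ᵇ ℝ :=
  BoundedContinuousFunction.mkOfBound
    ⟨fun p => (thickenedIndicator hδ A p : ℝ), by fun_prop⟩ 1 (by
      intro p q
      have h : ∀ p, (thickenedIndicator hδ A p : ℝ) ≤ 1 := fun p => by
        exact_mod_cast thickenedIndicator_le_one hδ A p
      have h0 : ∀ p, (0 : ℝ) ≤ thickenedIndicator hδ A p := fun p => by positivity
      rw [Real.dist_eq, abs_le]
      constructor <;>
        simp only [ContinuousMap.coe_mk] <;>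
        linarith [h p, h q, h0 p, h0 q])

omit [MeasurableSpace P] [BorelSpace P] in
theorem realThickenedIndicator_apply (A : Set P) {δ : ℝ} (hδ : 0 < δ) (p : P) :
    realThickenedIndicator A hδ p = (thickenedIndicator hδ A p : ℝ) := rfl

-- On `A` the left side is zero. Off `A` the indicator of the complement is already 1, so the bump
-- reduces to the thickened indicator of `A`.
omit [MeasurableSpace P] [BorelSpace P] in
theorem abs_indicator_sub_le_frontierBump (A : Set P) {δ : ℝ} (hδ : 0 < δ) (F : P →ᵇ ℝ) (p : P) :
    |A.indicator F p - F p * realThickenedIndicator A hδ p| ≤ ‖F‖ * frontierBump A hδ p := by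
  rw [frontierBump_apply, realThickenedIndicator_apply]
  by_cases hp : p ∈ A
  · have h1 := thickenedIndicator_one hδ A hp
    rw [indicator_of_mem hp, h1]
    simp only [NNReal.coe_one, mul_one, sub_self, abs_zero]
    have : (0 : ℝ) ≤ thickenedIndicator hδ Aᶜ p := by positivity
    have := norm_nonneg F
    nlinarith
  · have h1 := thickenedIndicator_one hδ Aᶜ (show p ∈ Aᶜ from hp)
    rw [indicator_of_notMem hp, h1, zero_sub, abs_neg, abs_mul,
      abs_of_nonneg (by positivity : (0 : ℝ) ≤ thickenedIndicator hδ A p), NNReal.coe_one,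
      add_sub_cancel_right]
    exact mul_le_mul_of_nonneg_right (F.norm_coe_le_norm p) (by positivity)

/-- As the thickening shrinks, the bump tends to 1_{closure A} + 1_{closure Aᶜ} - 1, the indicator
of the frontier; dominated convergence applies. -/
theorem tendsto_integral_frontierBump (M : Measure P) [IsFiniteMeasure M] {A : Set P}
    (hA : M (frontier A) = 0) :
    Tendsto (fun k : ℕ => ∫ p, frontierBump A (Nat.one_div_pos_of_nat (n := k) : (0 : ℝ) < _) p ∂M)
      atTop (𝓝 0) := by
  have hlim : ∀ B : Set P, ∀ p, Tendsto (fun k : ℕ =>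
      (thickenedIndicator (Nat.one_div_pos_of_nat (n := k) : (0 : ℝ) < _) B p : ℝ)) atTop
      (𝓝 ((closure B).indicator (fun _ => (1 : ℝ)) p)) := by
    intro B p
    have h := thickenedIndicator_tendsto_indicator_closure
      (fun k => (Nat.one_div_pos_of_nat (n := k) : (0 : ℝ) < _))
      tendsto_one_div_add_atTop_nhds_zero_nat B
    have h2 := (NNReal.continuous_coe.tendsto _).comp ((tendsto_pi_nhds.1 h) p)
    refine h2.trans (le_of_eq ?_)
    by_cases hp : p ∈ closure B <;> simp [hp]
  have h0 : ∫ p, ((closure A).indicator (fun _ => (1 : ℝ)) p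
      + (closure Aᶜ).indicator (fun _ => (1 : ℝ)) p - 1) ∂M = 0 := by
    refine integral_eq_zero_of_ae ?_
    have : ∀ᵐ p ∂M, p ∉ frontier A := measure_eq_zero_iff_ae_notMem.1 hA
    filter_upwards [this] with p hp
    have h1 : p ∈ closure A ∨ p ∈ closure Aᶜ := by
      by_cases h : p ∈ A
      · exact Or.inl (subset_closure h)
      · exact Or.inr (subset_closure h)
    rw [frontier_eq_closure_inter_closure] at hp
    by_cases h2 : p ∈ closure A
    · have h3 : p ∉ closure Aᶜ := fun h => hp ⟨h2, h⟩
      rw [indicator_of_mem h2, indicator_of_notMem h3]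
      simp
    · have h3 : p ∈ closure Aᶜ := h1.resolve_left h2
      rw [indicator_of_notMem h2, indicator_of_mem h3]
      simp
  rw [← h0]
  refine tendsto_integral_of_dominated_convergence (fun _ => 1)
    (fun k => (BoundedContinuousFunction.continuous _).aestronglyMeasurable)
    (integrable_const _) (fun k => ae_of_all _ fun p => ?_) (ae_of_all _ fun p => ?_)
  · have hk : (0 : ℝ) < 1 / ((k : ℝ) + 1) := Nat.one_div_pos_of_nat
    have h : ∀ (B : Set P), (thickenedIndicator hk B p : ℝ) ≤ 1 := fun B => by
      exact_mod_cast thickenedIndicator_le_one hk B p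
    have h0 : ∀ (B : Set P), (0 : ℝ) ≤ thickenedIndicator hk B p := fun B => by positivity
    rw [frontierBump_apply, Real.norm_eq_abs, abs_le]
    constructor <;> linarith [h A, h Aᶜ, h0 A, h0 Aᶜ]
  · simp only [frontierBump_apply]
    exact ((hlim A p).add (hlim Aᶜ p)).sub_const 1

theorem abs_setIntegral_sub_le_frontierBump (M : Measure P) [IsFiniteMeasure M] {A : Set P}
    (hA : MeasurableSet A) {δ : ℝ} (hδ : 0 < δ) (F : P →ᵇ ℝ) :
    |∫ p in A, F p ∂M - ∫ p, (F * realThickenedIndicator A hδ) p ∂M| ≤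
      ‖F‖ * ∫ p, frontierBump A hδ p ∂M := by
  rw [← integral_indicator hA, ← integral_sub ((F.integrable M).indicator hA)
    ((F * realThickenedIndicator A hδ).integrable M), ← integral_const_mul]
  refine abs_integral_le_integral_abs.trans (integral_mono ?_ ?_ fun p => ?_)
  · exact (((F.integrable M).indicator hA).sub
      ((F * realThickenedIndicator A hδ).integrable M)).abs
  · exact ((frontierBump A hδ).integrable M).const_mul _
  · exact abs_indicator_sub_le_frontierBump A hδ F p

/-- Replace the indicator of `A` by a thickened one. The error is bounded by the integral of a
continuous bump, so once the thickening is chosen small for `M₀`, weak convergence keeps the error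
small for all large `i`. -/
theorem WeakTendsto.tendsto_setIntegral {M : ℕ → Measure P} {M₀ : Measure P}
    [∀ i, IsFiniteMeasure (M i)] [IsFiniteMeasure M₀] (h : WeakTendsto M M₀) {A : Set P}
    (hAm : MeasurableSet A) (hA : M₀ (frontier A) = 0) (F : P →ᵇ ℝ) :
    Tendsto (fun i => ∫ p in A, F p ∂(M i)) atTop (𝓝 (∫ p in A, F p ∂M₀)) := by
  rw [Metric.tendsto_atTop']
  intro η hη
  have h1 := (tendsto_integral_frontierBump M₀ hA).const_mul ‖F‖
  rw [mul_zero] at h1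
  obtain ⟨k, hk⟩ := (h1.eventually (gt_mem_nhds (show (0 : ℝ) < η / 3 by positivity))).exists
  have hkpos : (0 : ℝ) < 1 / ((k : ℝ) + 1) := Nat.one_div_pos_of_nat
  have h2 := (h (frontierBump A hkpos)).const_mul ‖F‖
  have h3 := h (F * realThickenedIndicator A hkpos)
  have h4 := (h2.eventually (gt_mem_nhds hk)).and
    (h3.eventually (Metric.ball_mem_nhds _ (show (0 : ℝ) < η / 3 by positivity)))
  obtain ⟨N, hN⟩ := eventually_atTop.1 h4
  refine ⟨N, fun i hi => ?_⟩
  obtain ⟨h5, h6⟩ := hN i hi.le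
  rw [Real.dist_eq] at h6
  rw [Real.dist_eq]
  have h7 := abs_setIntegral_sub_le_frontierBump (M i) hAm hkpos F
  have h8 := abs_setIntegral_sub_le_frontierBump M₀ hAm hkpos F
  rw [abs_lt] at h6 ⊢
  rw [abs_le] at h7 h8
  constructor <;> linarith [h7.1, h7.2, h8.1, h8.2, h6.1, h6.2]

/-- The masses of `A` converge, hence stay bounded, and uniform convergence of the integrands then
costs nothing in the limit. -/
theorem WeakTendsto.tendsto_setIntegral_of_tendstoUniformlyOn {M : ℕ → Measure P} {M₀ : Measure P}
    [∀ i, IsFiniteMeasure (M i)] [IsFiniteMeasure M₀] (h : WeakTendsto M M₀) {A : Set P}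
    (hAm : MeasurableSet A) (hA : M₀ (frontier A) = 0) {G : ℕ → P →ᵇ ℝ} {F : P →ᵇ ℝ}
    (hG : TendstoUniformlyOn (fun i p => G i p) F atTop A) :
    Tendsto (fun i => ∫ p in A, G i p ∂(M i)) atTop (𝓝 (∫ p in A, F p ∂M₀)) := by
  have h1 := h.tendsto_setIntegral hAm hA F
  have hmass : Tendsto (fun i => ∫ p in A, (1 : P →ᵇ ℝ) p ∂(M i)) atTop _ :=
    h.tendsto_setIntegral hAm hA 1
  have h2 : Tendsto (fun i => ∫ p in A, (G i p - F p) ∂(M i)) atTop (𝓝 0) := by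
    rw [Metric.tendsto_atTop']
    intro η hη
    set c := ∫ p in A, (1 : P →ᵇ ℝ) p ∂M₀ with hc
    have hc0 : 0 ≤ c := integral_nonneg fun p => zero_le_one
    have hδ : 0 < η / (c + 1) := by positivity
    have h3 := (hmass.eventually (gt_mem_nhds (show c < c + 1 by linarith))).and
      (Metric.tendstoUniformlyOn_iff.1 hG _ hδ)
    obtain ⟨N, hN⟩ := eventually_atTop.1 h3
    refine ⟨N, fun i hi => ?_⟩
    obtain ⟨h4, h5⟩ := hN i hi.le
    rw [dist_zero_right]
    have hm : (M i).real A < c + 1 := by simpa using h4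
    rcases eq_or_lt_of_le (measureReal_nonneg (μ := M i) (s := A)) with h0 | h0
    · have : ‖∫ p in A, (G i p - F p) ∂(M i)‖ ≤ (η / (c + 1)) * (M i).real A :=
        norm_setIntegral_le_of_norm_le_const (measure_lt_top _ _) fun p hp => by
          have := h5 p hp
          rw [dist_comm, Real.dist_eq] at this
          exact this.le
      rw [← h0, mul_zero] at this
      exact this.trans_lt hη
    · calc ‖∫ p in A, (G i p - F p) ∂(M i)‖ ≤ (η / (c + 1)) * (M i).real A :=
            norm_setIntegral_le_of_norm_le_const (measure_lt_top _ _) fun p hp => by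
              have := h5 p hp
              rw [dist_comm, Real.dist_eq] at this
              exact this.le
        _ < (η / (c + 1)) * (c + 1) := by gcongr
        _ = η := by field_simp
  have h3 := h1.add h2
  rw [add_zero] at h3
  refine h3.congr fun i => ?_
  have h4 : Integrable (fun p => G i p - F p) ((M i).restrict A) :=
    ((G i).integrable _).sub (F.integrable _)
  rw [← integral_add (F.integrable _) h4]
  simp

/-- Weak convergence of finite measures carried by a common compact set can be realized along a
diagonal sequence, subject to countably many further eventual requirements. -/
theorem exists_strictMono_weakTendsto_diagonal {M : ℕ → ℕ → Measure P} {M' : ℕ → Measure P}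
    {M₀ : Measure P} [∀ j i, IsFiniteMeasure (M j i)] [∀ j, IsFiniteMeasure (M' j)]
    [IsFiniteMeasure M₀] {S : Set P} (hS : IsCompact S) (hM : ∀ j i, ∀ᵐ p ∂(M j i), p ∈ S)
    (hM₀ : ∀ᵐ p ∂M₀, p ∈ S) (h : ∀ j, WeakTendsto (M j) (M' j)) (h' : WeakTendsto M' M₀)
    {q : ℕ → ℕ → Prop} (hq : ∀ j, ∀ᶠ i in atTop, q j i) :
    ∃ m : ℕ → ℕ, StrictMono m ∧ (∀ j, q j (m j)) ∧ WeakTendsto (fun j => M j (m j)) M₀ := by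
  have hSc : CompactSpace S := isCompact_iff_compactSpace.1 hS
  obtain ⟨u, hu⟩ := TopologicalSpace.exists_dense_seq C(S, ℝ)
  have hext : ∀ v : C(S, ℝ), ∃ G : P →ᵇ ℝ, ∀ p : S, G p = v p := by
    intro v
    obtain ⟨G, -, hG⟩ := BoundedContinuousFunction.exists_norm_eq_domRestrict_eq_of_closed
      (BoundedContinuousFunction.mkOfCompact v) hS.isClosed
    exact ⟨G, fun p => DFunLike.congr_fun hG p⟩
  choose G hG using fun k => hext (u k)
  -- At stage `j` the first `j + 1` functions of the dense sequence are tested. The constant 1 is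
  -- tested at every stage, to bound the masses when a general `F` is approximated.
  have hev : ∀ j, ∀ᶠ i in atTop, q j i ∧
      dist (∫ p, (1 : P →ᵇ ℝ) p ∂(M j i)) (∫ p, (1 : P →ᵇ ℝ) p ∂(M' j)) < 1 / ((j : ℝ) + 1) ∧
      ∀ k ∈ Finset.range (j + 1),
        dist (∫ p, G k p ∂(M j i)) (∫ p, G k p ∂(M' j)) < 1 / ((j : ℝ) + 1) := by
    intro j
    have hj : (0 : ℝ) < 1 / ((j : ℝ) + 1) := Nat.one_div_pos_of_nat
    refine (hq j).and (((h j 1).eventually (Metric.ball_mem_nhds _ hj)).and ?_)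
    rw [Filter.eventually_all_finset]
    exact fun k _ => (h j (G k)).eventually (Metric.ball_mem_nhds _ hj)
  obtain ⟨m, hm, hmj⟩ := extraction_forall_of_eventually hev
  refine ⟨m, hm, fun j => (hmj j).1, fun F => ?_⟩
  have hto : ∀ (H : P →ᵇ ℝ) (k₀ : ℕ), (∀ j ≥ k₀,
      dist (∫ p, H p ∂(M j (m j))) (∫ p, H p ∂(M' j)) < 1 / ((j : ℝ) + 1)) →
      Tendsto (fun j => ∫ p, H p ∂(M j (m j))) atTop (𝓝 (∫ p, H p ∂M₀)) := by
    intro H k₀ hH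
    have h0 : Tendsto (fun j => dist (∫ p, H p ∂(M' j)) (∫ p, H p ∂(M j (m j)))) atTop (𝓝 0) := by
      refine squeeze_zero' (Eventually.of_forall fun j => dist_nonneg) ?_
        tendsto_one_div_add_atTop_nhds_zero_nat
      filter_upwards [eventually_ge_atTop k₀] with j hj
      rw [dist_comm]
      exact (hH j hj).le
    exact (tendsto_iff_of_dist h0).1 (h' H)
  have hmass := hto 1 0 fun j _ => (hmj j).2.1
  have hGk : ∀ k, Tendsto (fun j => ∫ p, G k p ∂(M j (m j))) atTop (𝓝 (∫ p, G k p ∂M₀)) :=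
    fun k => hto (G k) k fun j hj => (hmj j).2.2 k (by simpa using Nat.lt_succ_of_le hj)
  set c := ∫ p, (1 : P →ᵇ ℝ) p ∂M₀ with hc
  have hc0 : 0 ≤ c := integral_nonneg fun p => zero_le_one
  rw [Metric.tendsto_atTop']
  intro η hη
  -- All masses involved are eventually below `c + 1`, so each of the two approximation errors is
  -- below η / 3.
  set δ := η / (3 * (c + 1)) with hδ
  have hδ0 : 0 < δ := by positivity
  obtain ⟨k, hk⟩ := hu.exists_dist_lt (F.toContinuousMap.restrict S) hδ0
  have hFG : ∀ p ∈ S, |F p - G k p| ≤ δ := by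
    intro p hp
    have h1 := (ContinuousMap.dist_lt_iff hδ0).1 hk ⟨p, hp⟩
    rw [Real.dist_eq, ← hG k ⟨p, hp⟩] at h1
    exact h1.le
  have hdiff : ∀ (N : Measure P) [IsFiniteMeasure N], (∀ᵐ p ∂N, p ∈ S) →
      |∫ p, F p ∂N - ∫ p, G k p ∂N| ≤ δ * ∫ p, (1 : P →ᵇ ℝ) p ∂N := by
    intro N _ hN
    rw [← integral_sub (F.integrable N) ((G k).integrable N)]
    have := norm_integral_le_of_norm_le_const (μ := N) (f := fun p => F p - G k p) (C := δ)
      (hN.mono fun p hp => hFG p hp)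
    simpa using this
  have h4 := (hmass.eventually (gt_mem_nhds (show c < c + 1 by linarith))).and
    ((hGk k).eventually (Metric.ball_mem_nhds _ (show (0 : ℝ) < η / 3 by positivity)))
  obtain ⟨N, hN⟩ := eventually_atTop.1 h4
  refine ⟨N, fun j hj => ?_⟩
  obtain ⟨h5, h6⟩ := hN j hj.le
  rw [Real.dist_eq] at h6 ⊢
  have h7 := hdiff (M j (m j)) (hM _ _)
  have h8 := hdiff M₀ hM₀
  have h9 : δ * ∫ p, (1 : P →ᵇ ℝ) p ∂(M j (m j)) < η / 3 := by
    calc _ < δ * (c + 1) := by gcongr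
      _ = η / 3 := by rw [hδ]; field_simp
  have h10 : δ * c < η / 3 := by
    calc _ < δ * (c + 1) := by gcongr; linarith
      _ = η / 3 := by rw [hδ]; field_simp
  rw [abs_lt] at h6 ⊢
  rw [abs_le] at h7 h8
  constructor <;> linarith [h7.1, h7.2, h8.1, h8.2, h6.1, h6.2]

end WeakConvergence

/-! ### Blow-ups at Lebesgue points -/

section Cubes

variable {d : ℕ}

theorem continuous_blowUpMap (x₀ : Space d) (r : ℝ) : Continuous (blowUpMap x₀ r) := by
  unfold blowUpMap
  fun_prop

theorem blowUpMap_add_smul (x₀ : Space d) {r : ℝ} (hr : 0 < r) (y : Space d) :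
    blowUpMap x₀ r (x₀ + r • y) = y := by
  rw [← blowUpEquiv_symm_apply x₀ hr, ← coe_blowUpEquiv x₀ hr, MeasurableEquiv.apply_symm_apply]

theorem add_smul_blowUpMap (x₀ : Space d) {r : ℝ} (hr : 0 < r) (x : Space d) :
    x₀ + r • blowUpMap x₀ r x = x := by
  rw [← blowUpEquiv_symm_apply x₀ hr, ← coe_blowUpEquiv x₀ hr, MeasurableEquiv.symm_apply_apply]

theorem add_smul_mem_cubeAt {x₀ : Space d} {r : ℝ} (hr : 0 < r) {y : Space d}
    (hy : y ∈ unitCube d) : x₀ + r • y ∈ cubeAt x₀ r := by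
  rw [cubeAt, mem_preimage, blowUpMap_add_smul x₀ hr]
  exact hy

theorem isCompact_unitCube : IsCompact (unitCube d) := by
  have h : unitCube d = WithLp.toLp 2 '' (univ.pi fun _ => Icc (0 : ℝ) 1) := by
    ext y
    refine ⟨fun hy => ⟨WithLp.ofLp y, fun i _ => hy i, rfl⟩, ?_⟩
    rintro ⟨z, hz, rfl⟩ i
    exact hz i (mem_univ i)
  rw [h]
  exact (isCompact_univ_pi fun _ => isCompact_Icc).image (PiLp.continuous_toLp 2 _)

instance isProbabilityMeasure_unitCube :
    IsProbabilityMeasure ((volume : Measure (Space d)).restrict (unitCube d)) :=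
  ⟨by simp [volume_unitCube]⟩

theorem lintegral_unitCube_comp (x₀ : Space d) {r : ℝ} (hr : 0 < r) (g : Space d → ENNReal) :
    ∫⁻ y in unitCube d, g (x₀ + r • y) =
      ENNReal.ofReal (r ^ d)⁻¹ * ∫⁻ x in cubeAt x₀ r, g x := by
  nth_rw 1 [← map_blowUpMap_volume x₀ hr]
  rw [Measure.restrict_smul, restrict_unitCube_eq_map _ x₀ hr, lintegral_smul_measure,
    ← coe_blowUpEquiv x₀ hr, lintegral_map_equiv, smul_eq_mul]
  simp_rw [coe_blowUpEquiv, add_smul_blowUpMap x₀ hr]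

theorem integral_unitCube_comp (x₀ : Space d) {r : ℝ} (hr : 0 < r) (g : Space d → ℝ) :
    ∫ y in unitCube d, g (x₀ + r • y) = (r ^ d)⁻¹ * ∫ x in cubeAt x₀ r, g x := by
  nth_rw 1 [← map_blowUpMap_volume x₀ hr]
  rw [Measure.restrict_smul, restrict_unitCube_eq_map _ x₀ hr, integral_smul_measure,
    ← coe_blowUpEquiv x₀ hr, integral_map_equiv, smul_eq_mul,
    ENNReal.toReal_ofReal (by positivity)]
  simp_rw [coe_blowUpEquiv, add_smul_blowUpMap x₀ hr]

theorem ae_unitCube_comp (x₀ : Space d) {r : ℝ} (hr : 0 < r) {p : Space d → Prop}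
    (h : ∀ᵐ x ∂(volume.restrict (cubeAt x₀ r)), p x) :
    ∀ᵐ y ∂(volume.restrict (unitCube d)), p (x₀ + r • y) := by
  rw [← map_blowUpMap_volume x₀ hr, Measure.restrict_smul, restrict_unitCube_eq_map _ x₀ hr]
  refine Measure.ae_smul_measure ?_ _
  rw [← coe_blowUpEquiv x₀ hr, (blowUpEquiv x₀ hr).measurableEmbedding.ae_map_iff]
  simpa [add_smul_blowUpMap x₀ hr] using h

/-- The point `x₀` is a corner of the cube, whereas the differentiation theorems concern balls
centred at `x₀`. A ball of radius R r encloses the cube, and r⁻ᵈ times its volume is constant. -/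
theorem exists_cubeAt_subset_closedBall (d : ℕ) :
    ∃ R : ℝ, 0 < R ∧ ∀ (x₀ : Space d) (r : ℝ), 0 < r → cubeAt x₀ r ⊆ Metric.closedBall x₀ (R * r) ∧
      ENNReal.ofReal (r ^ d)⁻¹ * volume (Metric.closedBall x₀ (R * r)) =
        volume (Metric.closedBall (0 : Space d) R) := by
  obtain ⟨R, hR0, hR⟩ := (isCompact_unitCube (d := d)).isBounded.subset_closedBall_lt 0 0
  refine ⟨R, hR0, fun x₀ r hr => ⟨fun x hx => ?_, ?_⟩⟩
  · have h1 := hR hx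
    rw [mem_closedBall_zero_iff, blowUpMap, norm_smul, norm_inv, Real.norm_of_nonneg hr.le,
      inv_mul_le_iff₀ hr] at h1
    rwa [mem_closedBall_iff_norm, mul_comm]
  · rw [mul_comm R r, Measure.addHaar_closedBall_mul_of_pos _ _ hr, ← mul_assoc,
      finrank_euclideanSpace_fin, ← ENNReal.ofReal_mul (by positivity),
      inv_mul_cancel₀ (by positivity), ENNReal.ofReal_one, one_mul]

theorem eventually_cubeAt_subset {Ω : Set (Space d)} (hΩ : IsOpen Ω) {x₀ : Space d}
    (hx₀ : x₀ ∈ Ω) : ∀ᶠ r in 𝓝[>] (0 : ℝ), cubeAt x₀ r ⊆ Ω := by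
  obtain ⟨R, hR0, hR⟩ := exists_cubeAt_subset_closedBall d
  obtain ⟨δ, hδ, hδΩ⟩ := Metric.isOpen_iff.1 hΩ x₀ hx₀
  have h1 : Tendsto (fun r : ℝ => R * r) (𝓝[>] 0) (𝓝 (R * 0)) :=
    (tendsto_id.const_mul R).mono_left nhdsWithin_le_nhds
  rw [mul_zero] at h1
  filter_upwards [h1.eventually (gt_mem_nhds hδ), self_mem_nhdsWithin] with r hr hr0
  exact ((hR x₀ r hr0).1.trans (Metric.closedBall_subset_ball hr)).trans hδΩ

/-- Only the bound of the cube by the enclosing ball is used; it suffices because the limiting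
density is zero. -/
theorem tendsto_cubeAt_of_tendsto_closedBall {x₀ : Space d} (m : Measure (Space d))
    (h : Tendsto (fun r => m (Metric.closedBall x₀ r) / volume (Metric.closedBall x₀ r)) (𝓝[>] 0)
      (𝓝 0)) :
    Tendsto (fun r : ℝ => ENNReal.ofReal (r ^ d)⁻¹ * m (cubeAt x₀ r)) (𝓝[>] 0) (𝓝 0) := by
  obtain ⟨R, hR0, hR⟩ := exists_cubeAt_subset_closedBall d
  have hRr : Tendsto (fun r : ℝ => R * r) (𝓝[>] 0) (𝓝[>] 0) := by
    refine tendsto_nhdsWithin_iff.2 ⟨?_, ?_⟩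
    · have h1 : Tendsto (fun r : ℝ => R * r) (𝓝[>] 0) (𝓝 (R * 0)) :=
        (tendsto_id.const_mul R).mono_left nhdsWithin_le_nhds
      rwa [mul_zero] at h1
    · filter_upwards [self_mem_nhdsWithin] with r hr
      exact mul_pos hR0 hr
  have hC : volume (Metric.closedBall (0 : Space d) R) ≠ ⊤ := measure_closedBall_lt_top.ne
  have h2 := ENNReal.Tendsto.const_mul (h.comp hRr) (Or.inr hC)
  rw [mul_zero] at h2
  refine tendsto_of_tendsto_of_tendsto_of_le_of_le' tendsto_const_nhds h2
    (Eventually.of_forall fun _ => zero_le) ?_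
  filter_upwards [self_mem_nhdsWithin] with r hr
  have hr : 0 < r := hr
  obtain ⟨h3, h4⟩ := hR x₀ r hr
  have hv0 : volume (Metric.closedBall x₀ (R * r)) ≠ 0 :=
    (Metric.measure_closedBall_pos _ _ (by positivity)).ne'
  have hvt : volume (Metric.closedBall x₀ (R * r)) ≠ ⊤ := measure_closedBall_lt_top.ne
  rw [← h4, Function.comp_apply, mul_assoc, ENNReal.mul_div_cancel hv0 hvt]
  gcongr

/-- At a Lebesgue point, |h - h(x₀)| dx is a measure with zero density at `x₀` along balls, and this
passes to cubes. -/
theorem ae_tendsto_lintegral_unitCube_sub {h : Space d → ℝ} (hh : LocallyIntegrable h) :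
    ∀ᵐ x₀ : Space d, Tendsto (fun r : ℝ => ∫⁻ y in unitCube d, ‖h (x₀ + r • y) - h x₀‖ₑ) (𝓝[>] 0)
      (𝓝 0) := by
  have h1 := VitaliFamily.ae_tendsto_lintegral_enorm_sub_div
    (Besicovitch.vitaliFamily (volume : Measure (Space d))) hh
  filter_upwards [h1] with x₀ hx₀
  have h2 := hx₀.comp (Besicovitch.tendsto_filterAt volume x₀)
  have h3 := tendsto_cubeAt_of_tendsto_closedBall (x₀ := x₀)
    (volume.withDensity fun y => ‖h y - h x₀‖ₑ) (h2.congr fun r => by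
      rw [withDensity_apply _ measurableSet_closedBall]
      rfl)
  refine h3.congr' ?_
  filter_upwards [self_mem_nhdsWithin] with r hr
  rw [withDensity_apply _ (isClosed_cubeAt x₀ r).measurableSet,
    lintegral_unitCube_comp x₀ hr fun x => ‖h x - h x₀‖ₑ]

theorem ae_tendsto_cubeAt_of_mutuallySingular (m : Measure (Space d)) [IsFiniteMeasure m]
    (hm : m ⟂ₘ volume) :
    ∀ᵐ x₀ : Space d, Tendsto (fun r : ℝ => ENNReal.ofReal (r ^ d)⁻¹ * m (cubeAt x₀ r)) (𝓝[>] 0)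
      (𝓝 0) := by
  filter_upwards [Besicovitch.ae_tendsto_rnDeriv m volume, hm.rnDeriv_ae_eq_zero] with x₀ h1 h2
  rw [h2] at h1
  exact tendsto_cubeAt_of_tendsto_closedBall m h1

end Cubes

/-! ### Lebesgue points of fields of measures on a compact fibre -/

section LebesguePoints

variable {d : ℕ} {Y : Type*} [TopologicalSpace Y] [CompactSpace Y]

/-- Lebesgue points of a measurable field of Lipschitz functionals on `C(Y, ℝ)`. -/
theorem ae_tendsto_lintegral_unitCube_functional
    [TopologicalSpace.SeparableSpace C(Y, ℝ)] {C : Space d → C(Y, ℝ) → ℝ} {m : Space d → ℝ}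
    (hCm : ∀ h, Measurable fun x => C x h) (hmm : Measurable m)
    (hC : ∀ h, LocallyIntegrable fun x => C x h) (hm : LocallyIntegrable m)
    (hm0 : ∀ x, 0 ≤ m x) (hlip : ∀ᵐ x, ∀ g h, |C x g - C x h| ≤ ‖g - h‖ * m x) :
    ∀ᵐ x₀ : Space d, ∀ G : Space d → C(Y, ℝ), Continuous G →
      Tendsto (fun r : ℝ => ∫⁻ y in unitCube d, ‖C (x₀ + r • y) (G y) - C x₀ (G y)‖ₑ) (𝓝[>] 0)
        (𝓝 0) := by
  obtain ⟨u, hu⟩ := TopologicalSpace.exists_dense_seq C(Y, ℝ)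
  filter_upwards [ae_all_iff.2 fun k => ae_tendsto_lintegral_unitCube_sub (hC (u k)),
    ae_tendsto_lintegral_unitCube_sub hm, hlip] with x₀ h1 h2 h3 G hG
  rw [ENNReal.tendsto_nhds_zero]
  intro η hη
  -- Replacing `G y` by a δ-close `u k` at both x₀ + r y and x₀ costs δ m(x₀ + r y) + δ m(x₀), which
  -- is at most 2 δ m(x₀) plus δ times the oscillation of `m`.
  obtain ⟨δ, hδ, hδη⟩ : ∃ δ : ℝ, 0 < δ ∧ ENNReal.ofReal (2 * δ * m x₀) < η := by
    have hc : Continuous fun δ : ℝ => ENNReal.ofReal (2 * δ * m x₀) :=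
      ENNReal.continuous_ofReal.comp (by fun_prop)
    have ht : Tendsto (fun δ : ℝ => ENNReal.ofReal (2 * δ * m x₀)) (𝓝[>] 0) (𝓝 0) := by
      have := (hc.tendsto 0).mono_left (nhdsWithin_le_nhds (s := Ioi 0))
      simpa using this
    exact (Eventually.and (self_mem_nhdsWithin (s := Ioi (0 : ℝ))) (ht.eventually (gt_mem_nhds hη))).exists
  -- The image of the compact cube under `G` is compact, so finitely many members of the dense
  -- sequence suffice.
  obtain ⟨s, hs⟩ : ∃ s : Finset ℕ, ∀ y ∈ unitCube d, ∃ k ∈ s, ‖G y - u k‖ < δ := by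
    obtain ⟨s, hs⟩ := (isCompact_unitCube (d := d)).elim_finite_subcover
      (fun k => {y | ‖G y - u k‖ < δ})
      (fun k => isOpen_lt (by fun_prop) continuous_const) (fun y _ => by
        obtain ⟨k, hk⟩ := hu.exists_dist_lt (G y) hδ
        exact mem_iUnion.2 ⟨k, by rwa [dist_eq_norm] at hk⟩)
    refine ⟨s, fun y hy => ?_⟩
    simpa using hs hy
  have hlim : Tendsto (fun r : ℝ =>
      (∑ k ∈ s, ∫⁻ y in unitCube d, ‖C (x₀ + r • y) (u k) - C x₀ (u k)‖ₑ) +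
        (ENNReal.ofReal δ * ∫⁻ y in unitCube d, ‖m (x₀ + r • y) - m x₀‖ₑ) +
          ENNReal.ofReal (2 * δ * m x₀)) (𝓝[>] 0)
      (𝓝 ((∑ k ∈ s, 0) + ENNReal.ofReal δ * 0 + ENNReal.ofReal (2 * δ * m x₀))) :=
    ((tendsto_finsetSum s fun k _ => h1 k).add
      (ENNReal.Tendsto.const_mul h2 (Or.inr ENNReal.ofReal_ne_top))).add_const _
  simp only [Finset.sum_const_zero, mul_zero, zero_add] at hlim
  filter_upwards [hlim.eventually (gt_mem_nhds hδη), self_mem_nhdsWithin] with r hr hr0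
  refine le_trans ?_ hr.le
  have hadd : Measurable fun y : Space d => x₀ + r • y := by fun_prop
  have hmeas : ∀ k, Measurable fun y : Space d => ‖C (x₀ + r • y) (u k) - C x₀ (u k)‖ₑ :=
    fun k => (((hCm (u k)).comp hadd).sub_const _).enorm
  have hmeas' : Measurable fun y : Space d => ‖m (x₀ + r • y) - m x₀‖ₑ :=
    ((hmm.comp hadd).sub_const _).enorm
  calc ∫⁻ y in unitCube d, ‖C (x₀ + r • y) (G y) - C x₀ (G y)‖ₑ
      ≤ ∫⁻ y in unitCube d, ((∑ k ∈ s, ‖C (x₀ + r • y) (u k) - C x₀ (u k)‖ₑ) +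
          ENNReal.ofReal δ * ‖m (x₀ + r • y) - m x₀‖ₑ + ENNReal.ofReal (2 * δ * m x₀)) := by
        refine lintegral_mono_ae ?_
        filter_upwards [ae_unitCube_comp x₀ hr0 (ae_restrict_of_ae hlip),
          ae_restrict_mem measurableSet_unitCube] with y hy hyQ
        obtain ⟨k, hks, hk⟩ := hs y hyQ
        have h4 : ‖C (x₀ + r • y) (G y) - C x₀ (G y)‖ ≤
            ‖C (x₀ + r • y) (u k) - C x₀ (u k)‖ + δ * ‖m (x₀ + r • y) - m x₀‖ + 2 * δ * m x₀ := by
          have h5 := hy (G y) (u k)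
          have h6 := h3 (G y) (u k)
          simp only [Real.norm_eq_abs]
          have h7 := mul_le_mul_of_nonneg_right hk.le (hm0 (x₀ + r • y))
          have h8 := mul_le_mul_of_nonneg_right hk.le (hm0 x₀)
          have h9 := abs_le.1 (h5.trans h7)
          have h10 := abs_le.1 (h6.trans h8)
          have h11 := mul_le_mul_of_nonneg_left (le_abs_self (m (x₀ + r • y) - m x₀)) hδ.le
          have h12 := neg_abs_le (C (x₀ + r • y) (u k) - C x₀ (u k))
          have h13 := le_abs_self (C (x₀ + r • y) (u k) - C x₀ (u k))
          rw [abs_le]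
          constructor <;> linarith [h9.1, h9.2, h10.1, h10.2]
        calc ‖C (x₀ + r • y) (G y) - C x₀ (G y)‖ₑ
            ≤ ‖C (x₀ + r • y) (u k) - C x₀ (u k)‖ₑ + ENNReal.ofReal δ * ‖m (x₀ + r • y) - m x₀‖ₑ
              + ENNReal.ofReal (2 * δ * m x₀) := by
              rw [← ofReal_norm, ← ofReal_norm, ← ofReal_norm, ← ENNReal.ofReal_mul hδ.le,
                ← ENNReal.ofReal_add (by positivity) (by positivity),
                ← ENNReal.ofReal_add (by positivity) (by have := hm0 x₀; positivity)]
              exact ENNReal.ofReal_le_ofReal h4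
          _ ≤ _ := by
              gcongr
              exact Finset.single_le_sum (f := fun k => ‖C (x₀ + r • y) (u k) - C x₀ (u k)‖ₑ)
                (fun _ _ => zero_le) hks
    _ = _ := by
        rw [lintegral_add_right _ measurable_const, lintegral_add_right _ (hmeas'.const_mul _),
          lintegral_finsetSum _ fun k _ => hmeas k, lintegral_const_mul _ hmeas',
          lintegral_const, measure_univ, mul_one]

variable [MeasurableSpace Y] [BorelSpace Y]

theorem abs_integral_sub_integral_le (m : Measure Y) [IsFiniteMeasure m] (g h : C(Y, ℝ)) :
    |∫ w, g w ∂m - ∫ w, h w ∂m| ≤ ‖g - h‖ * m.real univ := by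
  have hi : ∀ g : C(Y, ℝ), Integrable g m := fun g =>
    (BoundedContinuousFunction.mkOfCompact g).integrable m
  rw [← integral_sub (hi g) (hi h)]
  exact norm_integral_le_of_norm_le_const (ae_of_all _ fun w => (g - h).norm_coe_le_norm w)

variable [SecondCountableTopology Y]

omit [CompactSpace Y] [BorelSpace Y] [SecondCountableTopology Y] in
theorem norm_integral_le_of_bounded (m : Measure Y) [IsFiniteMeasure m]
    (F : Space d × Y →ᵇ ℝ) (x : Space d) : ‖∫ w, F (x, w) ∂m‖ ≤ ‖F‖ * m.real univ :=
  norm_integral_le_of_norm_le_const (ae_of_all _ fun w => F.norm_coe_le_norm (x, w))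

omit [CompactSpace Y] in
theorem stronglyMeasurable_integral_kernel_comp (A : Kernel (Space d) Y) [IsSFiniteKernel A]
    (F : Space d × Y →ᵇ ℝ) {S : Space d → Space d} (hS : Continuous S) :
    StronglyMeasurable fun x => ∫ w, F (S x, w) ∂(A x) := by
  have h : StronglyMeasurable fun p : Space d × Y => F (S p.1, p.2) :=
    Continuous.stronglyMeasurable (by fun_prop)
  exact h.integral_kernel_prod_right'

omit [CompactSpace Y] in
theorem integrable_integral_kernel_comp (B : Kernel (Space d) Y) [IsFiniteKernel B]
    (F : Space d × Y →ᵇ ℝ) {S : Space d → Space d} (hS : Continuous S)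
    (m : Measure (Space d)) [IsFiniteMeasure m] :
    Integrable (fun x => ∫ w, F (S x, w) ∂(B x)) m := by
  refine Integrable.of_bound (stronglyMeasurable_integral_kernel_comp B F hS).aestronglyMeasurable
    (‖F‖ * (B.bound).toReal) (ae_of_all _ fun x => ?_)
  refine (norm_integral_le_of_bounded (B x) F (S x)).trans ?_
  gcongr
  exact ENNReal.toReal_mono (Kernel.bound_ne_top B) (Kernel.measure_le_bound B x univ)

/-- Localization at Lebesgue points of measures that are disintegrated with respect to the
Lebesgue measure and to a finite measure `lam`. -/
theorem ae_tendsto_blowUp_kernels [T2Space Y]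
    {Ω : Set (Space d)} (hΩ : IsOpen Ω) (A B : Kernel (Space d) Y) [IsSFiniteKernel A]
    [IsFiniteKernel B] (hA : ∫⁻ x in Ω, A x univ ≠ ⊤)
    (lam : Measure (Space d)) [IsFiniteMeasure lam] :
    ∀ᵐ x₀ ∂(volume.restrict Ω), ∀ F : Space d × Y →ᵇ ℝ,
      Tendsto (fun r : ℝ => (∫ y in unitCube d, ∫ w, F (y, w) ∂(A (x₀ + r • y))) +
          (r ^ d)⁻¹ * ∫ x in cubeAt x₀ r, ∫ w, F (blowUpMap x₀ r x, w) ∂(B x) ∂lam) (𝓝[>] 0)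
        (𝓝 ((∫ y in unitCube d, ∫ w, F (y, w) ∂(A x₀)) +
          (lam.rnDeriv volume x₀).toReal * ∫ y in unitCube d, ∫ w, F (y, w) ∂(B x₀))) := by
  have hΩm := hΩ.measurableSet
  set ρ : Space d → ℝ := fun x => (lam.rnDeriv volume x).toReal with hρ
  have hρm : Measurable ρ := (Measure.measurable_rnDeriv _ _).ennreal_toReal
  have hρ0 : ∀ x, 0 ≤ ρ x := fun x => ENNReal.toReal_nonneg
  have hρi : Integrable ρ volume := Measure.integrable_toReal_rnDeriv
  have hAm : Measurable fun x => A x univ := A.measurable_coe MeasurableSet.univ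
  have hBm : Measurable fun x => B x univ := B.measurable_coe MeasurableSet.univ
  have hAfin : ∀ᵐ x ∂(volume.restrict Ω), A x univ < ⊤ := ae_lt_top hAm hA
  -- Both absolutely continuous contributions are bundled into one field of functionals. The `A`
  -- part is cut off outside `Ω`, where its mass is not known to be integrable.
  set C : Space d → C(Y, ℝ) → ℝ := fun x h =>
    Ω.indicator (fun x => ∫ w, h w ∂(A x)) x + ρ x * ∫ w, h w ∂(B x) with hC
  set m : Space d → ℝ := fun x =>
    Ω.indicator (fun x => (A x).real univ) x + ρ x * (B x).real univ with hm
  have hAr : Integrable (Ω.indicator fun x => (A x).real univ) volume := by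
    rw [integrable_indicator_iff hΩm]
    exact integrable_toReal_of_lintegral_ne_top hAm.aemeasurable hA
  have hBle : ∀ x, (B x).real univ ≤ B.bound.toReal := fun x =>
    ENNReal.toReal_mono (Kernel.bound_ne_top B) (Kernel.measure_le_bound B x univ)
  have hBr : Integrable (fun x => ρ x * (B x).real univ) volume := by
    refine (hρi.mul_const B.bound.toReal).mono'
      (hρm.mul hBm.ennreal_toReal).aestronglyMeasurable (ae_of_all _ fun x => ?_)
    rw [Real.norm_of_nonneg (mul_nonneg (hρ0 x) measureReal_nonneg)]
    exact mul_le_mul_of_nonneg_left (hBle x) (hρ0 x)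
  have hm0 : ∀ x, 0 ≤ m x := fun x =>
    add_nonneg (indicator_nonneg (fun _ _ => measureReal_nonneg) x)
      (mul_nonneg (hρ0 x) measureReal_nonneg)
  have hmm : Measurable m :=
    (hAm.ennreal_toReal.indicator hΩm).add (hρm.mul hBm.ennreal_toReal)
  have hCm : ∀ h, Measurable fun x => C x h := fun h => by
    have hs : StronglyMeasurable h := h.continuous.stronglyMeasurable
    exact ((hs.integral_kernel (κ := A)).measurable.indicator hΩm).add
      (hρm.mul (hs.integral_kernel (κ := B)).measurable)
  have hlip : ∀ᵐ x, ∀ g h, |C x g - C x h| ≤ ‖g - h‖ * m x := by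
    filter_upwards [(ae_restrict_iff' hΩm).1 hAfin] with x hx g h
    have h2 := abs_integral_sub_integral_le (B x) g h
    have h3 : |ρ x * (∫ w, g w ∂(B x) - ∫ w, h w ∂(B x))| ≤
        ρ x * (‖g - h‖ * (B x).real univ) := by
      rw [abs_mul, abs_of_nonneg (hρ0 x)]
      exact mul_le_mul_of_nonneg_left h2 (hρ0 x)
    by_cases hxΩ : x ∈ Ω
    · have : IsFiniteMeasure (A x) := ⟨hx hxΩ⟩
      have h1 := abs_integral_sub_integral_le (A x) g h
      simp only [hC, hm, indicator_of_mem hxΩ]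
      rw [abs_le] at h1 h3 ⊢
      constructor <;> nlinarith [h1.1, h1.2, h3.1, h3.2]
    · simp only [hC, hm, indicator_of_notMem hxΩ, zero_add]
      rw [← mul_sub]
      linarith
  have hmi : Integrable m := hAr.add hBr
  have hC0 : ∀ x, C x 0 = 0 := fun x => by
    by_cases hx : x ∈ Ω <;> simp [hC, hx]
  have hCb : ∀ᵐ x, ∀ g, |C x g| ≤ ‖g‖ * m x := by
    filter_upwards [hlip] with x hx g
    simpa [hC0] using hx g 0
  have hCi : ∀ h, Integrable fun x => C x h := fun h =>
    (hmi.const_mul ‖h‖).mono' (hCm h).aestronglyMeasurable (hCb.mono fun x hx => hx h)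
  have hs1 : IsFiniteMeasure (lam.singularPart volume) := inferInstance
  filter_upwards [ae_restrict_of_ae (ae_tendsto_lintegral_unitCube_functional hCm hmm
      (fun h => (hCi h).locallyIntegrable) hmi.locallyIntegrable hm0 hlip),
    ae_restrict_of_ae (ae_tendsto_cubeAt_of_mutuallySingular (lam.singularPart volume)
      (Measure.mutuallySingular_singularPart lam volume)), hAfin,
    ae_restrict_mem hΩm] with x₀ hx₁ hx₂ hx₃ hx₀ F
  have hfinA : IsFiniteMeasure (A x₀) := ⟨hx₃⟩
  let G : Space d → C(Y, ℝ) := fun y => ⟨fun w => F (y, w), by fun_prop⟩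
  have hG : Continuous G := F.toContinuousMap.curry.continuous
  have hGF : ∀ y, ‖G y‖ ≤ ‖F‖ := fun y =>
    (ContinuousMap.norm_le _ (norm_nonneg _)).2 fun w => F.norm_coe_le_norm (y, w)
  have hA₀ : IntegrableOn (fun y => ∫ w, F (y, w) ∂(A x₀)) (unitCube d) := by
    have := integrable_integral_kernel_comp (Kernel.const (Space d) (A x₀)) F continuous_id
      (volume.restrict (unitCube d))
    rw [IntegrableOn]
    simpa using this
  have hB₀ : IntegrableOn (fun y => ∫ w, F (y, w) ∂(B x₀)) (unitCube d) := by
    have := integrable_integral_kernel_comp (Kernel.const (Space d) (B x₀)) F continuous_id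
      (volume.restrict (unitCube d))
    rw [IntegrableOn]
    simpa using this
  have hCx₀ : ∀ y, C x₀ (G y) = ∫ w, F (y, w) ∂(A x₀) + ρ x₀ * ∫ w, F (y, w) ∂(B x₀) := fun y => by
    simp only [hC, indicator_of_mem hx₀]
    rfl
  have hlimit : ∫ y in unitCube d, C x₀ (G y) = (∫ y in unitCube d, ∫ w, F (y, w) ∂(A x₀)) +
      ρ x₀ * ∫ y in unitCube d, ∫ w, F (y, w) ∂(B x₀) := by
    simp_rw [hCx₀]
    rw [integral_add hA₀ (hB₀.const_mul _), integral_const_mul]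
  have hint : ∀ r : ℝ, 0 < r → cubeAt x₀ r ⊆ Ω →
      IntegrableOn (fun y => ∫ w, F (y, w) ∂(A (x₀ + r • y))) (unitCube d) ∧
      IntegrableOn (fun y => ρ (x₀ + r • y) * ∫ w, F (y, w) ∂(B (x₀ + r • y))) (unitCube d) := by
    intro r hr hrΩ
    have hmr : Integrable (fun y => ‖F‖ * m (x₀ + r • y)) (volume.restrict (unitCube d)) :=
      (((hmi.comp_add_left x₀).comp_smul hr.ne').const_mul ‖F‖).restrict
    have hadd : Measurable fun y : Space d => x₀ + r • y := by fun_prop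
    have hmem : ∀ᵐ y ∂(volume.restrict (unitCube d)), x₀ + r • y ∈ Ω := by
      filter_upwards [ae_restrict_mem measurableSet_unitCube] with y hy
      exact hrΩ (add_smul_mem_cubeAt hr hy)
    have hfin := ae_unitCube_comp x₀ hr (ae_mono (Measure.restrict_mono hrΩ le_rfl) hAfin)
    refine ⟨hmr.mono' (stronglyMeasurable_integral_kernel_comp (A.comap _ hadd) F
      continuous_id).aestronglyMeasurable ?_, hmr.mono' ((hρm.comp hadd).stronglyMeasurable.mul
        (stronglyMeasurable_integral_kernel_comp (B.comap _ hadd) F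
        continuous_id)).aestronglyMeasurable ?_⟩
    · filter_upwards [hmem, hfin] with y hy hy'
      have : IsFiniteMeasure (A (x₀ + r • y)) := ⟨hy'⟩
      refine (norm_integral_le_of_bounded (A (x₀ + r • y)) F y).trans ?_
      refine mul_le_mul_of_nonneg_left ?_ (norm_nonneg _)
      simp only [hm, indicator_of_mem hy]
      exact le_add_of_nonneg_right (mul_nonneg (hρ0 _) measureReal_nonneg)
    · refine ae_of_all _ fun y => ?_
      rw [norm_mul, Real.norm_of_nonneg (hρ0 _)]
      refine (mul_le_mul_of_nonneg_left (norm_integral_le_of_bounded (B (x₀ + r • y)) F y)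
        (hρ0 _)).trans ?_
      rw [mul_left_comm]
      refine mul_le_mul_of_nonneg_left ?_ (norm_nonneg _)
      exact le_add_of_nonneg_left (indicator_nonneg (fun _ _ => measureReal_nonneg) _)
  have hCr : ∀ r : ℝ, 0 < r → cubeAt x₀ r ⊆ Ω → ∀ y ∈ unitCube d, C (x₀ + r • y) (G y) =
      ∫ w, F (y, w) ∂(A (x₀ + r • y)) + ρ (x₀ + r • y) * ∫ w, F (y, w) ∂(B (x₀ + r • y)) := by
    intro r hr hrΩ y hy
    simp only [hC, indicator_of_mem (hrΩ (add_smul_mem_cubeAt hr hy))]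
    rfl
  have hev : ∀ᶠ r in 𝓝[>] (0 : ℝ), 0 < r ∧ cubeAt x₀ r ⊆ Ω :=
    Eventually.and self_mem_nhdsWithin (eventually_cubeAt_subset hΩ hx₀)
  have hT : Tendsto (fun r : ℝ => ∫ y in unitCube d, C (x₀ + r • y) (G y)) (𝓝[>] 0)
      (𝓝 (∫ y in unitCube d, C x₀ (G y))) := by
    refine tendsto_integral_of_L1 _ ?_ ?_ (hx₁ G hG)
    · simp_rw [hCx₀]
      exact (hA₀.add (hB₀.const_mul _)).aestronglyMeasurable
    · filter_upwards [hev] with r hr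
      refine (((hint r hr.1 hr.2).1.add (hint r hr.1 hr.2).2).congr ?_)
      filter_upwards [ae_restrict_mem measurableSet_unitCube] with y hy
      exact (hCr r hr.1 hr.2 y hy).symm
  -- The inner integral is bounded by ‖F‖ times the bound of `B`, so the singular part contributes
  -- at most a constant times its vanishing density.
  have hS : Tendsto (fun r : ℝ => (r ^ d)⁻¹ * ∫ x in cubeAt x₀ r,
      ∫ w, F (blowUpMap x₀ r x, w) ∂(B x) ∂(lam.singularPart volume)) (𝓝[>] 0) (𝓝 0) := by
    have h1 : Tendsto (fun r : ℝ => (‖F‖ * B.bound.toReal) *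
        (ENNReal.ofReal (r ^ d)⁻¹ * lam.singularPart volume (cubeAt x₀ r)).toReal) (𝓝[>] 0)
        (𝓝 ((‖F‖ * B.bound.toReal) * (0 : ENNReal).toReal)) :=
      ((ENNReal.tendsto_toReal ENNReal.zero_ne_top).comp hx₂).const_mul _
    rw [ENNReal.toReal_zero, mul_zero] at h1
    refine squeeze_zero_norm' ?_ h1
    filter_upwards [self_mem_nhdsWithin] with r hr
    have hr : 0 < r := hr
    rw [norm_mul, Real.norm_of_nonneg (by positivity), ENNReal.toReal_mul,
      ENNReal.toReal_ofReal (by positivity), mul_left_comm]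
    refine mul_le_mul_of_nonneg_left ?_ (by positivity)
    refine norm_setIntegral_le_of_norm_le_const (measure_lt_top _ _) fun x _ => ?_
    refine (norm_integral_le_of_bounded (B x) F _).trans ?_
    exact mul_le_mul_of_nonneg_left (hBle x) (norm_nonneg _)
  rw [← hlimit, ← add_zero (∫ y in unitCube d, C x₀ (G y))]
  refine (hT.add hS).congr' ?_
  filter_upwards [hev] with r ⟨hr, hrΩ⟩
  have h1 : ∫ y in unitCube d, C (x₀ + r • y) (G y) =
      (∫ y in unitCube d, ∫ w, F (y, w) ∂(A (x₀ + r • y))) +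
        ∫ y in unitCube d, ρ (x₀ + r • y) * ∫ w, F (y, w) ∂(B (x₀ + r • y)) := by
    rw [← integral_add (hint r hr hrΩ).1 (hint r hr hrΩ).2]
    exact setIntegral_congr_fun measurableSet_unitCube (hCr r hr hrΩ)
  have h2 : ∫ y in unitCube d, ρ (x₀ + r • y) * ∫ w, F (y, w) ∂(B (x₀ + r • y)) =
      (r ^ d)⁻¹ * ∫ x in cubeAt x₀ r, ρ x * ∫ w, F (blowUpMap x₀ r x, w) ∂(B x) := by
    rw [← integral_unitCube_comp x₀ hr]
    simp_rw [blowUpMap_add_smul x₀ hr]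
  have h3 : ∫ x in cubeAt x₀ r, ∫ w, F (blowUpMap x₀ r x, w) ∂(B x) ∂lam =
      (∫ x in cubeAt x₀ r, ∫ w, F (blowUpMap x₀ r x, w) ∂(B x) ∂(lam.singularPart volume)) +
        ∫ x in cubeAt x₀ r, ρ x * ∫ w, F (blowUpMap x₀ r x, w) ∂(B x) := by
    have hi := integrable_integral_kernel_comp B F (continuous_blowUpMap x₀ r)
      (lam.restrict (cubeAt x₀ r))
    have hdec := Measure.haveLebesgueDecomposition_add lam volume
    have hK := (isClosed_cubeAt x₀ r).measurableSet
    have hres : lam.restrict (cubeAt x₀ r) = (lam.singularPart volume).restrict (cubeAt x₀ r) +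
        (volume.restrict (cubeAt x₀ r)).withDensity (lam.rnDeriv volume) := by
      conv_lhs => rw [hdec]
      rw [Measure.restrict_add, restrict_withDensity hK]
    rw [hres] at hi ⊢
    rw [integral_add_measure (integrable_add_measure.1 hi).1 (integrable_add_measure.1 hi).2,
      integral_withDensity_eq_integral_toReal_smul (Measure.measurable_rnDeriv _ _)
        (ae_restrict_of_ae (Measure.rnDeriv_lt_top lam volume))]
    rfl
  rw [h1, h2, h3]
  ring

end LebesguePoints

/-! ### Kernels representing two-scale Young measures -/

section Kernels

/-- An almost everywhere measurable family of probability measures agrees almost everywhere with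
a kernel. -/
theorem exists_kernel_ae_eq {α β : Type*} [MeasurableSpace α] [MeasurableSpace β]
    {f : α → Measure β} {m : Measure α} (hf : AEMeasurable f m)
    (hp : ∀ᵐ a ∂m, IsProbabilityMeasure (f a)) :
    ∃ κ : Kernel α β, IsFiniteKernel κ ∧ ∀ᵐ a ∂m, f a = κ a := by
  classical
  have hs : MeasurableSet {a | hf.mk f a univ = 1} :=
    (Measure.measurable_coe MeasurableSet.univ).comp hf.measurable_mk (measurableSet_singleton 1)
  -- Setting the value to 0 wherever the mass is not 1 makes the kernel finite everywhere and alters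
  -- the family only on a null set.
  let κ : Kernel α β := ⟨fun a => if hf.mk f a univ = 1 then hf.mk f a else 0,
    Measurable.ite hs hf.measurable_mk measurable_const⟩
  have hκ : ∀ a, κ a = if hf.mk f a univ = 1 then hf.mk f a else 0 := fun a => rfl
  refine ⟨κ, ⟨1, ENNReal.one_lt_top, fun a => ?_⟩, ?_⟩
  · rw [hκ]
    split_ifs with h
    · exact h.le
    · simp
  · filter_upwards [hf.ae_eq_mk, hp] with a ha hpa
    rw [hκ, ← ha, if_pos hpa.measure_univ]

theorem genProd_eq_compProd {X Z : Type*} [MeasurableSpace X] [MeasurableSpace Z]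
    (lam : Measure X) [SFinite lam] {rho : X → Measure Z} (κ : Kernel X Z) [IsSFiniteKernel κ]
    (h : ∀ᵐ x ∂lam, rho x = κ x) : genProd lam rho = lam ⊗ₘ κ := by
  rw [Measure.compProd_eq_comp_prod, genProd]
  refine Measure.bind_congr_right ?_
  filter_upwards [h] with x hx
  rw [hx, Kernel.prod_apply, Kernel.id_apply, Measure.dirac_prod]

variable {d : ℕ} {E : Type*} [NormedAddCommGroup E] [InnerProductSpace ℝ E]
  [FiniteDimensional ℝ E] [MeasurableSpace E] [BorelSpace E]

omit [FiniteDimensional ℝ E] in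
theorem measurable_fiberSquash :
    Measurable fun p : Torus d × E => ((p.1, squash p.2) : Fiber d E) :=
  measurable_fst.prodMk (continuous_squash.measurable.comp measurable_snd)

omit [InnerProductSpace ℝ E] [FiniteDimensional ℝ E] in
theorem measurable_fiberSphere : Measurable
    fun p : Torus d × Metric.sphere (0 : E) 1 => ((p.1, sphereIncl p.2) : Fiber d E) :=
  measurable_fst.prodMk (continuous_sphereIncl.measurable.comp measurable_snd)

/-- The kernel on the compactified fibre describing the oscillation part of a Young measure. -/
def acKernel (κ : Kernel (Space d × Torus d) E) [IsFiniteKernel κ] :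
    Kernel (Space d) (Fiber d E) :=
  (((Kernel.const (Space d) (volume : Measure (Torus d))) ⊗ₖ κ).withDensity
    fun _ p => ((1 + ‖p.2‖₊ : NNReal) : ENNReal)).map fun p => (p.1, squash p.2)

instance isSFiniteKernel_acKernel (κ : Kernel (Space d × Torus d) E) [IsFiniteKernel κ] :
    IsSFiniteKernel (acKernel κ) := by
  have := Kernel.IsSFiniteKernel.withDensity
    ((Kernel.const (Space d) (volume : Measure (Torus d))) ⊗ₖ κ)
    (f := fun _ p => ((1 + ‖p.2‖₊ : NNReal) : ENNReal)) (fun _ _ => ENNReal.coe_ne_top)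
  unfold acKernel
  infer_instance

/-- The kernel on the compactified fibre describing the concentration part of a Young measure. -/
def singKernel (ρ : Kernel (Space d) (Torus d))
    (κ : Kernel (Space d × Torus d) (Metric.sphere (0 : E) 1)) : Kernel (Space d) (Fiber d E) :=
  (ρ ⊗ₖ κ).map fun p => (p.1, sphereIncl p.2)

instance isFiniteKernel_singKernel (ρ : Kernel (Space d) (Torus d)) [IsFiniteKernel ρ]
    (κ : Kernel (Space d × Torus d) (Metric.sphere (0 : E) 1)) [IsFiniteKernel κ] :
    IsFiniteKernel (singKernel ρ κ) := by
  unfold singKernel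
  infer_instance

omit [FiniteDimensional ℝ E] in
theorem lintegral_acKernel (κ : Kernel (Space d × Torus d) E) [IsFiniteKernel κ] (x : Space d)
    {g : Fiber d E → ENNReal} (hg : Measurable g) :
    ∫⁻ w, g w ∂(acKernel κ x) =
      ∫⁻ ξ, ∫⁻ z, ((1 + ‖z‖₊ : NNReal) : ENNReal) * g (ξ, squash z) ∂(κ (x, ξ)) := by
  have hgs : Measurable fun p : Torus d × E => g (p.1, squash p.2) :=
    hg.comp measurable_fiberSquash
  rw [acKernel, Kernel.lintegral_map _ measurable_fiberSquash _ hg,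
    Kernel.lintegral_withDensity _ (by fun_prop) _ hgs, Kernel.lintegral_compProd _ _ _ ?_]
  · simp
  · exact Measurable.mul (by fun_prop) hgs

omit [InnerProductSpace ℝ E] [FiniteDimensional ℝ E] in
theorem lintegral_singKernel (ρ : Kernel (Space d) (Torus d)) [IsFiniteKernel ρ]
    (κ : Kernel (Space d × Torus d) (Metric.sphere (0 : E) 1)) [IsFiniteKernel κ] (x : Space d)
    {g : Fiber d E → ENNReal} (hg : Measurable g) :
    ∫⁻ w, g w ∂(singKernel ρ κ x) = ∫⁻ ξ, ∫⁻ z, g (ξ, sphereIncl z) ∂(κ (x, ξ)) ∂(ρ x) := by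
  have hgs : Measurable fun p : Torus d × Metric.sphere (0 : E) 1 => g (p.1, sphereIncl p.2) :=
    hg.comp measurable_fiberSphere
  rw [singKernel, Kernel.lintegral_map _ measurable_fiberSphere _ hg,
    Kernel.lintegral_compProd _ _ _ hgs]

theorem integral_acKernel (κ : Kernel (Space d × Torus d) E) [IsFiniteKernel κ] {x : Space d}
    (hx : acKernel κ x univ < ⊤) (g : C(Fiber d E, ℝ)) :
    ∫ w, g w ∂(acKernel κ x) = ∫ ξ, ∫ z, (1 + ‖z‖) * g (ξ, squash z) ∂(κ (x, ξ)) := by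
  have : IsFiniteMeasure (acKernel κ x) := ⟨hx⟩
  have hgi : Integrable g (acKernel κ x) :=
    (BoundedContinuousFunction.mkOfCompact g).integrable _
  have hgm := g.continuous.measurable
  have hms : AEMeasurable (fun p : Torus d × E => ((p.1, squash p.2) : Fiber d E))
      ((((Kernel.const (Space d) (volume : Measure (Torus d))) ⊗ₖ κ).withDensity
        fun _ p => ((1 + ‖p.2‖₊ : NNReal) : ENNReal)) x) := measurable_fiberSquash.aemeasurable
  rw [acKernel, Kernel.map_apply _ measurable_fiberSquash] at hgi ⊢
  rw [integrable_map_measure hgm.aestronglyMeasurable hms] at hgi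
  rw [Kernel.withDensity_apply _ (by fun_prop),
    integrable_withDensity_iff_integrable_smul (by fun_prop)] at hgi
  rw [integral_map hms hgm.aestronglyMeasurable, Kernel.withDensity_apply _ (by fun_prop),
    integral_withDensity_eq_integral_smul (by fun_prop)]
  refine (integral_compProd hgi).trans ?_
  simp [NNReal.smul_def]

theorem integral_singKernel (ρ : Kernel (Space d) (Torus d)) [IsFiniteKernel ρ]
    (κ : Kernel (Space d × Torus d) (Metric.sphere (0 : E) 1)) [IsFiniteKernel κ] (x : Space d)
    (g : C(Fiber d E, ℝ)) :
    ∫ w, g w ∂(singKernel ρ κ x) = ∫ ξ, ∫ z, g (ξ, sphereIncl z) ∂(κ (x, ξ)) ∂(ρ x) := by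
  have hgi : Integrable g (singKernel ρ κ x) :=
    (BoundedContinuousFunction.mkOfCompact g).integrable _
  have hgm := g.continuous.measurable
  rw [singKernel, Kernel.map_apply _ measurable_fiberSphere] at hgi ⊢
  rw [integrable_map_measure hgm.aestronglyMeasurable measurable_fiberSphere.aemeasurable] at hgi
  rw [integral_map measurable_fiberSphere.aemeasurable hgm.aestronglyMeasurable]
  exact integral_compProd hgi

/-- Translation of the microscopic variable on the fibre. -/
def fiberShift (ξ₀ : Torus d) (w : Fiber d E) : Fiber d E := (w.1 - ξ₀, w.2)

omit [InnerProductSpace ℝ E] [FiniteDimensional ℝ E] [MeasurableSpace E] [BorelSpace E] in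
theorem continuous_fiberShift (ξ₀ : Torus d) :
    Continuous (fiberShift ξ₀ : Fiber d E → Fiber d E) := by
  unfold fiberShift
  fun_prop

/-- The change of variables `(y, ξ) ↦ (S y, ξ + ξ₀)`. -/
def pullMap (S : Space d → Space d) (ξ₀ : Torus d) (p : Space d × Torus d) : Space d × Torus d :=
  (S p.1, p.2 + ξ₀)

theorem measurable_pullMap {S : Space d → Space d} (hS : Measurable S) (ξ₀ : Torus d) :
    Measurable (pullMap S ξ₀) :=
  (hS.comp measurable_fst).prodMk (measurable_snd.add_const ξ₀)

/-- The microscopic marginal is Lebesgue measure on the torus; its translation invariance absorbs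
the shift. -/
theorem acKernel_comap (κ : Kernel (Space d × Torus d) E) [IsFiniteKernel κ]
    {S : Space d → Space d} (hS : Measurable S) (ξ₀ : Torus d) (y : Space d) :
    acKernel (κ.comap (pullMap S ξ₀) (measurable_pullMap hS ξ₀)) y =
      (acKernel κ (S y)).map (fiberShift ξ₀) := by
  have hsh : Measurable (fiberShift ξ₀ : Fiber d E → Fiber d E) :=
    (continuous_fiberShift ξ₀).measurable
  refine Measure.ext_of_lintegral _ fun g hg => ?_
  have hgs : Measurable fun w : Fiber d E => g (fiberShift ξ₀ w) := hg.comp hsh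
  rw [lintegral_acKernel _ _ hg, lintegral_map hg hsh, lintegral_acKernel _ _ hgs]
  have := lintegral_add_right_eq_self (μ := (volume : Measure (Torus d)))
    (fun ξ => ∫⁻ z, ((1 + ‖z‖₊ : NNReal) : ENNReal) * g (fiberShift ξ₀ (ξ, squash z))
      ∂(κ (S y, ξ))) ξ₀
  rw [← this]
  refine lintegral_congr fun ξ => ?_
  simp only [Kernel.comap_apply, pullMap, fiberShift, add_sub_cancel_right]

/-- Since `ρ` need not be translation invariant, it must be pushed forward; the shift in `κ'` then
cancels the one in the integration variable. -/
theorem singKernel_comap (ρ : Kernel (Space d) (Torus d)) [IsFiniteKernel ρ]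
    (κ : Kernel (Space d × Torus d) (Metric.sphere (0 : E) 1)) [IsFiniteKernel κ]
    {S : Space d → Space d} (hS : Measurable S) (ξ₀ : Torus d) (y : Space d) :
    singKernel ((ρ.comap S hS).map fun ξ => ξ - ξ₀)
        (κ.comap (pullMap S ξ₀) (measurable_pullMap hS ξ₀)) y =
      (singKernel ρ κ (S y)).map (fiberShift ξ₀) := by
  have hsh : Measurable (fiberShift ξ₀ : Fiber d E → Fiber d E) :=
    (continuous_fiberShift ξ₀).measurable
  have hsub : Measurable fun ξ : Torus d => ξ - ξ₀ := measurable_id.sub_const ξ₀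
  refine Measure.ext_of_lintegral _ fun g hg => ?_
  have hgs : Measurable fun w : Fiber d E => g (fiberShift ξ₀ w) := hg.comp hsh
  rw [lintegral_singKernel _ _ _ hg, lintegral_map hg hsh,
    lintegral_singKernel _ _ _ hgs, Kernel.map_apply _ hsub, lintegral_map _ hsub]
  · refine lintegral_congr fun ξ => ?_
    simp only [Kernel.comap_apply, pullMap, fiberShift, sub_add_cancel]
  · exact Measurable.lintegral_kernel_prod_right' (κ := (κ.comap (pullMap S ξ₀)
      (measurable_pullMap hS ξ₀)).comap (Prod.mk y) measurable_prodMk_left)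
      (f := fun p => g (p.1, sphereIncl p.2)) (hg.comp measurable_fiberSphere)

end Kernels

/-! ### The measure on the compactification that represents a Young measure -/

section LiftYoung

variable {d : ℕ} {Y : Type*} [MeasurableSpace Y]

/-- The measure on `U × Y` with disintegration `A` over the Lebesgue measure and `B` over `lam`. -/
def liftKernels (U : Set (Space d)) (A B : Kernel (Space d) Y) (lam : Measure (Space d)) :
    Measure (Space d × Y) :=
  (volume.restrict U) ⊗ₘ A + lam ⊗ₘ B

theorem isFiniteMeasure_liftKernels {U : Set (Space d)} {A B : Kernel (Space d) Y}
    [IsSFiniteKernel A] [IsFiniteKernel B] (hA : ∫⁻ x in U, A x univ ≠ ⊤)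
    (lam : Measure (Space d)) [IsFiniteMeasure lam] :
    IsFiniteMeasure (liftKernels U A B lam) := by
  have h1 : IsFiniteMeasure ((volume.restrict U) ⊗ₘ A) := ⟨by
    rw [Measure.compProd_apply MeasurableSet.univ]
    simpa using hA.lt_top⟩
  unfold liftKernels
  infer_instance

theorem integral_liftKernels [TopologicalSpace Y] [BorelSpace Y] [SecondCountableTopology Y]
    {U : Set (Space d)} {A B : Kernel (Space d) Y}
    [IsSFiniteKernel A] [IsFiniteKernel B] (hA : ∫⁻ x in U, A x univ ≠ ⊤)
    (lam : Measure (Space d)) [IsFiniteMeasure lam] (F : Space d × Y →ᵇ ℝ) :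
    ∫ p, F p ∂(liftKernels U A B lam) =
      (∫ x in U, ∫ w, F (x, w) ∂(A x)) + ∫ x, ∫ w, F (x, w) ∂(B x) ∂lam := by
  have hfin := isFiniteMeasure_liftKernels (B := B) hA lam
  have hi := integrable_add_measure.1 (F.integrable (liftKernels U A B lam))
  rw [liftKernels, integral_add_measure hi.1 hi.2, Measure.integral_compProd hi.1,
    Measure.integral_compProd hi.2]

theorem ae_liftKernels_mem {U : Set (Space d)} (hU : MeasurableSet U) {A B : Kernel (Space d) Y}
    [IsSFiniteKernel A] [IsFiniteKernel B] {lam : Measure (Space d)} [IsFiniteMeasure lam]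
    (hlam : lam Uᶜ = 0) : ∀ᵐ p ∂(liftKernels U A B lam), p ∈ U ×ˢ (univ : Set Y) := by
  have hm : MeasurableSet {p : Space d × Y | p ∈ U ×ˢ (univ : Set Y)} := hU.prod MeasurableSet.univ
  rw [liftKernels, ae_add_measure_iff, Measure.ae_compProd_iff hm, Measure.ae_compProd_iff hm]
  refine ⟨?_, ?_⟩
  · filter_upwards [ae_restrict_mem hU] with x hx
    exact ae_of_all _ fun w => ⟨hx, mem_univ _⟩
  · filter_upwards [measure_eq_zero_iff_ae_notMem.1 hlam] with x hx
    exact ae_of_all _ fun w => ⟨by simpa using hx, mem_univ _⟩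

theorem liftKernels_prod_univ {U V : Set (Space d)} (hV : MeasurableSet V)
    {A B : Kernel (Space d) Y} [IsSFiniteKernel A] [IsFiniteKernel B] {lam : Measure (Space d)}
    [IsFiniteMeasure lam] (hvol : volume V = 0) (hlam : lam V = 0) :
    liftKernels U A B lam (V ×ˢ univ) = 0 := by
  have hm : MeasurableSet (V ×ˢ (univ : Set Y)) := hV.prod MeasurableSet.univ
  have hae : ∀ (m : Measure (Space d)) (K : Kernel (Space d) Y) [SFinite m] [IsSFiniteKernel K],
      m V = 0 → (m ⊗ₘ K) (V ×ˢ univ) = 0 := by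
    intro m K _ _ hmV
    rw [Measure.compProd_apply hm]
    refine (lintegral_congr_ae ?_).trans lintegral_zero
    filter_upwards [measure_eq_zero_iff_ae_notMem.1 hmV] with x hx
    simp [hx]
  rw [liftKernels, Measure.add_apply, hae _ _ (Measure.restrict_le_self.absolutelyContinuous hvol),
    hae _ _ hlam, add_zero]

variable {E : Type*} [NormedAddCommGroup E] [InnerProductSpace ℝ E]
  [FiniteDimensional ℝ E] [MeasurableSpace E] [BorelSpace E]

omit [FiniteDimensional ℝ E] in
theorem acKernel_univ (κ : Kernel (Space d × Torus d) E) [IsFiniteKernel κ] (x : Space d) :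
    acKernel κ x univ = ∫⁻ ξ, ∫⁻ z, ((1 + ‖z‖₊ : NNReal) : ENNReal) ∂(κ (x, ξ)) := by
  rw [← lintegral_one, lintegral_acKernel κ x measurable_const]
  simp

-- Because of the weight 1 + |z|, the total mass is the volume of the closure plus the first moment
-- of ν.
omit [FiniteDimensional ℝ E] in
theorem lintegral_acKernel_univ_ne_top {U : Set (Space d)} (hU : Bornology.IsBounded U)
    (ν : TwoScaleYoungMeasure U E) (κ : Kernel (Space d × Torus d) E) [IsFiniteKernel κ]
    (hκ : ∀ᵐ p ∂((volume.restrict (closure U)).prod volume), ν.nu p.1 p.2 = κ p) :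
    ∫⁻ x in closure U, acKernel κ x univ ≠ ⊤ := by
  have hfin : IsFiniteMeasure ((volume : Measure (Space d)).restrict (closure U)) :=
    ⟨by simpa using hU.closure.measure_lt_top⟩
  have hmeas : Measurable fun p : Space d × Torus d =>
      ∫⁻ z, ((1 + ‖z‖₊ : NNReal) : ENNReal) ∂(κ p) :=
    Measurable.lintegral_kernel (by fun_prop)
  simp_rw [acKernel_univ]
  rw [← lintegral_prod (fun p => ∫⁻ z, ((1 + ‖z‖₊ : NNReal) : ENNReal) ∂(κ p)) hmeas.aemeasurable]
  have h1 : ∫⁻ p, ∫⁻ z, ((1 + ‖z‖₊ : NNReal) : ENNReal) ∂(κ p)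
      ∂((volume.restrict (closure U)).prod volume) =
      ∫⁻ p : Space d × Torus d, (1 + ∫⁻ z, ‖z‖ₑ ∂(ν.nu p.1 p.2))
        ∂((volume.restrict (closure U)).prod volume) := by
    refine lintegral_congr_ae ?_
    filter_upwards [hκ, ν.prob_nu] with p hp hpp
    rw [← hp]
    simp only [ENNReal.coe_add, ENNReal.coe_one]
    rw [lintegral_add_left measurable_const, lintegral_one, hpp.measure_univ]
    rfl
  rw [h1, lintegral_add_left measurable_const, lintegral_one]
  exact ENNReal.add_ne_top.2 ⟨measure_ne_top _ _, ν.moment_nu.ne⟩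

/-- The duality pairing as an integral over the compactification. -/
theorem pairing_eq_integral_liftKernels {U : Set (Space d)} (hUm : MeasurableSet U)
    (hU : Bornology.IsBounded U)
    (ν : TwoScaleYoungMeasure U E) (κ : Kernel (Space d × Torus d) E) [IsFiniteKernel κ]
    (ρ : Kernel (Space d) (Torus d)) [IsFiniteKernel ρ]
    (κ' : Kernel (Space d × Torus d) (Metric.sphere (0 : E) 1)) [IsFiniteKernel κ']
    (hκ : ∀ᵐ p ∂((volume.restrict (closure U)).prod volume), ν.nu p.1 p.2 = κ p)
    (hρ : ∀ᵐ x ∂ν.lam, ν.rho x = ρ x)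
    (hκ' : ∀ᵐ p ∂(genProd ν.lam ν.rho), ν.nuInf p.1 p.2 = κ' p)
    {f : Space d → Torus d → E → ℝ} (F : Space d × Fiber d E →ᵇ ℝ) (hf : Represents U f F) :
    pairing U f ν = ∫ p, F p ∂(liftKernels U (acKernel κ) (singKernel ρ κ') ν.lam) := by
  have hlamfin := ν.finite_lam
  have htop := lintegral_acKernel_univ_ne_top hU ν κ hκ
  have htop' : ∫⁻ x in U, acKernel κ x univ ≠ ⊤ :=
    ne_top_of_le_ne_top htop (lintegral_mono' (Measure.restrict_mono subset_closure le_rfl) le_rfl)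
  have hAm : Measurable fun x => acKernel κ x univ :=
    (acKernel κ).measurable_coe MeasurableSet.univ
  rw [integral_liftKernels htop', pairing]
  congr 1
  · refine integral_congr_ae ?_
    have h1 := Measure.ae_ae_of_ae_prod hκ
    filter_upwards [ae_mono (Measure.restrict_mono subset_closure le_rfl) h1,
      ae_lt_top hAm htop', ae_restrict_mem hUm] with x hx hx' hxU
    have h2 := integral_acKernel κ hx' (F.toContinuousMap.curry x)
    refine Eq.trans ?_ h2.symm
    refine integral_congr_ae ?_
    filter_upwards [hx] with ξ hξ
    simp only [hξ, hf x hxU, toIntegrand]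
    rfl
  · have hsupp : ν.lam.restrict (closure U) = ν.lam := by
      refine Measure.restrict_eq_self_of_ae_mem ?_
      filter_upwards [measure_eq_zero_iff_ae_notMem.1 ν.support_lam] with x hx
      simpa using hx
    have hmem : ∀ᵐ x ∂ν.lam, x ∈ closure U := by
      filter_upwards [measure_eq_zero_iff_ae_notMem.1 ν.support_lam] with x hx
      simpa using hx
    rw [genProd_eq_compProd ν.lam ρ hρ] at hκ'
    rw [hsupp]
    refine integral_congr_ae ?_
    filter_upwards [Measure.ae_ae_of_ae_compProd hκ', hρ, hmem] with x hx hx' hxU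
    have h2 := integral_singKernel ρ κ' x (F.toContinuousMap.curry x)
    refine Eq.trans ?_ h2.symm
    rw [hx']
    refine integral_congr_ae ?_
    filter_upwards [hx] with ξ hξ
    simp only [hξ, hf.recession_sphere F.continuous hxU]
    rfl

theorem measurableSet_mass_eq_one {α β : Type*} [MeasurableSpace α] [MeasurableSpace β]
    (κ : Kernel α β) : MeasurableSet {a | κ a univ = 1} :=
  κ.measurable_coe MeasurableSet.univ (measurableSet_singleton 1)

/-- Construction of a Young measure from kernels by the change of variables
`(y, ξ) ↦ (S y, ξ + ξ₀)`. -/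
theorem exists_youngMeasure_pull {U : Set (Space d)} (hUm : MeasurableSet U)
    (hU : Bornology.IsBounded U) (κ : Kernel (Space d × Torus d) E) [IsFiniteKernel κ]
    (ρ : Kernel (Space d) (Torus d)) [IsFiniteKernel ρ]
    (κ' : Kernel (Space d × Torus d) (Metric.sphere (0 : E) 1)) [IsFiniteKernel κ']
    (lam : Measure (Space d)) [IsFiniteMeasure lam] {S : Space d → Space d} (hS : Measurable S)
    (ξ₀ : Torus d)
    (h1 : ∀ᵐ y ∂(volume.restrict (closure U)), ∀ᵐ ξ, κ (S y, ξ) univ = 1)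
    (h2 : ∫⁻ y in closure U, acKernel κ (S y) univ ≠ ⊤) (h3 : lam (closure U)ᶜ = 0)
    (h4 : ∀ᵐ y ∂lam, ρ (S y) univ = 1)
    (h5 : ∀ᵐ y ∂lam, ∀ᵐ ξ ∂(ρ (S y)), κ' (S y, ξ) univ = 1) :
    ∃ D : TwoScaleYoungMeasure U E, D.lam = lam ∧ (∀ y ξ, D.nu y ξ = κ (S y, ξ + ξ₀)) ∧
      (∀ y, D.rho y = (ρ (S y)).map fun ξ => ξ - ξ₀) ∧
      (∀ y ξ, D.nuInf y ξ = κ' (S y, ξ + ξ₀)) ∧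
      ∀ (f : Space d → Torus d → E → ℝ) (F : Space d × Fiber d E →ᵇ ℝ), Represents U f F →
        pairing U f D = ∫ p, F p ∂(liftKernels U (((acKernel κ).comap S hS).map (fiberShift ξ₀))
          (((singKernel ρ κ').comap S hS).map (fiberShift ξ₀)) lam) := by
  have hsub : Measurable fun ξ : Torus d => ξ - ξ₀ := measurable_id.sub_const ξ₀
  have hsh : Measurable (fiberShift ξ₀ : Fiber d E → Fiber d E) :=
    (continuous_fiberShift ξ₀).measurable
  let κS := κ.comap (pullMap S ξ₀) (measurable_pullMap hS ξ₀)
  let ρS := (ρ.comap S hS).map fun ξ => ξ - ξ₀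
  let κS' := κ'.comap (pullMap S ξ₀) (measurable_pullMap hS ξ₀)
  have hρS : ∀ y, ρS y = (ρ (S y)).map fun ξ => ξ - ξ₀ := fun y => by
    simp only [ρS, Kernel.map_apply _ hsub, Kernel.comap_apply]
  have hgen : genProd lam ρS = lam ⊗ₘ ρS := genProd_eq_compProd lam ρS (ae_of_all _ fun _ => rfl)
  have hAS : acKernel κS = ((acKernel κ).comap S hS).map (fiberShift ξ₀) := by
    ext1 y
    rw [Kernel.map_apply _ hsh, Kernel.comap_apply]
    exact acKernel_comap κ hS ξ₀ y
  have hBS : singKernel ρS κS' = ((singKernel ρ κ').comap S hS).map (fiberShift ξ₀) := by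
    ext1 y
    rw [Kernel.map_apply _ hsh, Kernel.comap_apply]
    exact singKernel_comap ρ κ' hS ξ₀ y
  have hprob : ∀ᵐ p : Space d × Torus d ∂((volume.restrict (closure U)).prod volume),
      κS p univ = 1 := by
    rw [Measure.ae_prod_iff_ae_ae (measurableSet_mass_eq_one κS)]
    filter_upwards [h1] with y hy
    exact (measurePreserving_add_right (volume : Measure (Torus d)) ξ₀).quasiMeasurePreserving.ae hy
  have hmom : ∫⁻ p : Space d × Torus d, (∫⁻ z, ‖z‖ₑ ∂(κS p))
      ∂((volume.restrict (closure U)).prod volume) < ⊤ := by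
    rw [lintegral_prod _ (Measurable.lintegral_kernel (by fun_prop)).aemeasurable]
    -- The first moment is dominated by the mass of `acKernel`, since |z| ≤ 1 + |z|; the shift
    -- leaves this mass unchanged.
    refine lt_of_le_of_lt ?_ h2.lt_top
    refine lintegral_mono fun y => ?_
    have h6 : acKernel κ (S y) univ = acKernel κS y univ := by
      rw [hAS, Kernel.map_apply' _ hsh _ MeasurableSet.univ, Kernel.comap_apply, preimage_univ]
    rw [h6, acKernel_univ]
    refine lintegral_mono fun ξ => lintegral_mono fun z => ?_
    rw [enorm_eq_nnnorm]
    exact ENNReal.coe_le_coe.2 (le_add_of_nonneg_left zero_le_one)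
  have hprob' : ∀ᵐ p ∂(lam ⊗ₘ ρS), κS' p univ = 1 := by
    rw [Measure.ae_compProd_iff (measurableSet_mass_eq_one κS')]
    filter_upwards [h5] with y hy
    have hs : MeasurableSet {b | κS' (y, b) univ = 1} :=
      measurable_prodMk_left (measurableSet_mass_eq_one κS')
    rw [hρS, ae_map_iff hsub.aemeasurable hs]
    filter_upwards [hy] with ξ hξ
    simpa [κS', pullMap] using hξ
  let D : TwoScaleYoungMeasure U E :=
    { nu := fun y ξ => κS (y, ξ)
      lam := lam
      rho := ρS
      nuInf := fun y ξ => κS' (y, ξ)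
      aemeasurable_nu := κS.measurable.aemeasurable
      prob_nu := hprob.mono fun p hp => ⟨hp⟩
      moment_nu := hmom
      finite_lam := inferInstance
      support_lam := h3
      aemeasurable_rho := ρS.measurable.aemeasurable
      prob_rho := by
        filter_upwards [h4] with y hy
        exact ⟨by rw [hρS, Measure.map_apply hsub MeasurableSet.univ, preimage_univ, hy]⟩
      aemeasurable_nuInf := κS'.measurable.aemeasurable
      prob_nuInf := by
        rw [hgen]
        exact hprob'.mono fun p hp => ⟨hp⟩ }
  refine ⟨D, rfl, fun y ξ => rfl, hρS, fun y ξ => rfl, fun f F hf => ?_⟩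
  have h := pairing_eq_integral_liftKernels hUm hU D κS ρS κS' (ae_of_all _ fun _ => rfl)
    (ae_of_all _ fun _ => rfl) (ae_of_all _ fun _ => rfl) F hf
  rw [h, hAS, hBS]

end LiftYoung

/-! ### Radii for which the boundary of the cube is negligible -/

section Radii

variable {d : ℕ}

theorem volume_coordinate_eq (i : Fin d) (c : ℝ) : volume {x : Space d | x i = c} = 0 := by
  have h : {x : Space d | x i = c} = WithLp.ofLp ⁻¹' {f : Fin d → ℝ | f i = c} := rfl
  have hm : MeasurableSet {f : Fin d → ℝ | f i = c} :=
    (measurableSet_singleton c).preimage (measurable_pi_apply i)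
  rw [h, (PiLp.volume_preserving_ofLp (Fin d)).measure_preimage hm.nullMeasurableSet]
  exact Measure.pi_hyperplane (fun _ : Fin d => (volume : Measure ℝ)) i c

theorem frontier_cubeAt_subset (x₀ : Space d) {r : ℝ} (hr : 0 < r) :
    frontier (cubeAt x₀ r) ⊆
      ⋃ i, ({x : Space d | x i = x₀ i} ∪ {x : Space d | x i = x₀ i + r}) := by
  have hmem : ∀ x : Space d, x ∈ cubeAt x₀ r ↔ ∀ i, x₀ i ≤ x i ∧ x i ≤ x₀ i + r := by
    intro x
    refine forall_congr' fun i => ?_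
    have : blowUpMap x₀ r x i = r⁻¹ * (x i - x₀ i) := by simp [blowUpMap]
    rw [this, mem_Icc, inv_mul_le_iff₀ hr, mul_nonneg_iff_of_pos_left (inv_pos.2 hr)]
    constructor <;> rintro ⟨h1, h2⟩ <;> constructor <;> linarith
  intro x hx
  by_contra hn
  rw [mem_iUnion, not_exists] at hn
  refine hx.2 ?_
  have hxc : x ∈ cubeAt x₀ r := (isClosed_cubeAt x₀ r).frontier_subset hx
  rw [mem_interior]
  refine ⟨⋂ i, {y : Space d | x₀ i < y i ∧ y i < x₀ i + r}, fun y hy => ?_, ?_, ?_⟩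
  · rw [hmem]
    intro i
    have := mem_iInter.1 hy i
    exact ⟨this.1.le, this.2.le⟩
  · refine isOpen_iInter_of_finite fun i => ?_
    have h1 : IsOpen {y : Space d | x₀ i < y i} := isOpen_lt continuous_const (by fun_prop)
    have h2 : IsOpen {y : Space d | y i < x₀ i + r} := isOpen_lt (by fun_prop) continuous_const
    exact h1.inter h2
  · refine mem_iInter.2 fun i => ?_
    have h1 := (hmem x).1 hxc i
    have h2 := hn i
    rw [mem_union, not_or] at h2
    exact ⟨lt_of_le_of_ne h1.1 (Ne.symm h2.1), lt_of_le_of_ne h1.2 h2.2⟩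

theorem measure_frontier_cubeAt_eq_zero (m : Measure (Space d)) (x₀ : Space d) {r : ℝ}
    (hr : 0 < r) (h1 : ∀ i, m {x | x i = x₀ i} = 0) (h2 : ∀ i, m {x | x i = x₀ i + r} = 0) :
    m (frontier (cubeAt x₀ r)) = 0 := by
  refine measure_mono_null (frontier_cubeAt_subset x₀ hr) ?_
  rw [measure_iUnion_null_iff]
  exact fun i => measure_union_null (h1 i) (h2 i)

/-- For each coordinate only countably many parallel hyperplanes are charged by `m`, and their union
is Lebesgue null. This concerns the faces through the corner `x₀`, which lie in the same hyperplanes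
for every radius. -/
theorem ae_coordinate_hyperplane_null (m : Measure (Space d)) [SFinite m] :
    ∀ᵐ x₀ : Space d, ∀ i, m {x | x i = x₀ i} = 0 := by
  rw [ae_all_iff]
  intro i
  have hc : {t : ℝ | 0 < m {x : Space d | x i = t}}.Countable :=
    Measure.countable_meas_level_set_pos (g := fun x : Space d => x i) (by fun_prop)
  have h0 : volume (⋃ t ∈ {t : ℝ | 0 < m {x : Space d | x i = t}}, {x : Space d | x i = t}) = 0 :=
    (measure_biUnion_null_iff hc).2 fun t _ => volume_coordinate_eq i t
  filter_upwards [measure_eq_zero_iff_ae_notMem.1 h0] with x₀ hx₀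
  by_contra hne
  exact hx₀ (mem_biUnion (pos_iff_ne_zero.2 hne) rfl)

/-- The opposite faces move with r, and only countably many radii put one of them in a charged
hyperplane; the remaining radii are dense. -/
theorem exists_radius (m : Measure (Space d)) [SFinite m] (x₀ : Space d)
    (h1 : ∀ i, m {x | x i = x₀ i} = 0) {p : ℝ → Prop} (hp : ∀ᶠ r in 𝓝[>] (0 : ℝ), p r) {δ : ℝ}
    (hδ : 0 < δ) : ∃ r, 0 < r ∧ r < δ ∧ p r ∧ m (frontier (cubeAt x₀ r)) = 0 := by
  obtain ⟨η, hη, hηp⟩ := mem_nhdsGT_iff_exists_Ioo_subset.1 hp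
  have hη : 0 < η := hη
  have hc : (⋃ i, (fun r => x₀ i + r) ⁻¹' {t : ℝ | 0 < m {x : Space d | x i = t}}).Countable :=
    countable_iUnion fun i => (Measure.countable_meas_level_set_pos
      (g := fun x : Space d => x i) (by fun_prop)).preimage (add_right_injective _)
  obtain ⟨r, hr, hr'⟩ := (hc.dense_compl ℝ).exists_mem_open isOpen_Ioo
    (nonempty_Ioo.2 (lt_min hδ hη))
  refine ⟨r, hr'.1, hr'.2.trans_le (min_le_left _ _),
    hηp ⟨hr'.1, hr'.2.trans_le (min_le_right _ _)⟩,
    measure_frontier_cubeAt_eq_zero m x₀ hr'.1 h1 fun i => ?_⟩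
  by_contra hne
  exact hr (mem_iUnion.2 ⟨i, pos_iff_ne_zero.2 hne⟩)

theorem ae_smul_blowUpPos_comp (m : Measure (Space d)) (x₀ : Space d) {r : ℝ} (hr : 0 < r)
    (c : ENNReal) {p : Space d → Prop} (h : ∀ᵐ x ∂m, p x) :
    ∀ᵐ y ∂(c • blowUpPos m x₀ r), p (x₀ + r • y) := by
  rw [blowUpPos, restrict_unitCube_eq_map _ x₀ hr]
  refine Measure.ae_smul_measure ?_ _
  rw [← coe_blowUpEquiv x₀ hr, (blowUpEquiv x₀ hr).measurableEmbedding.ae_map_iff]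
  simpa [add_smul_blowUpMap x₀ hr] using ae_restrict_of_ae h

theorem integral_blowUpPos (m : Measure (Space d)) (x₀ : Space d) {r : ℝ} (hr : 0 < r)
    (g : Space d → ℝ) :
    ∫ y, g y ∂(blowUpPos m x₀ r) = ∫ x in cubeAt x₀ r, g (blowUpMap x₀ r x) ∂m := by
  rw [blowUpPos, restrict_unitCube_eq_map _ x₀ hr, ← coe_blowUpEquiv x₀ hr, integral_map_equiv]

theorem exists_boundedContinuous_eqOn_unitCube {φ : Space d → ℝ} (hφ : Continuous φ) :
    ∃ ψ : Space d →ᵇ ℝ, EqOn φ ψ (unitCube d) := by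
  have hc : CompactSpace (unitCube d) := isCompact_iff_compactSpace.1 isCompact_unitCube
  obtain ⟨ψ, -, hψ⟩ := BoundedContinuousFunction.exists_norm_eq_domRestrict_eq_of_closed
    (BoundedContinuousFunction.mkOfCompact ⟨fun y : unitCube d => φ y, by fun_prop⟩)
    (isClosed_unitCube (d := d))
  exact ⟨ψ, fun y hy => (DFunLike.congr_fun hψ ⟨y, hy⟩).symm⟩

/-- Blow-ups of a finite positive measure at Lebesgue points. -/
theorem ae_tendsto_integral_blowUpPos {Ω : Set (Space d)} (hΩ : IsOpen Ω) (lam : Measure (Space d))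
    [IsFiniteMeasure lam] :
    ∀ᵐ x₀ ∂(volume.restrict Ω), ∀ φ : Space d → ℝ, Continuous φ →
      Tendsto (fun r : ℝ => (r ^ d)⁻¹ * ∫ y, φ y ∂(blowUpPos lam x₀ r)) (𝓝[>] 0)
        (𝓝 (∫ y, φ y ∂(lam.rnDeriv volume x₀ • volume.restrict (unitCube d)))) := by
  -- A one-point fibre with `A = 0` and `B` a Dirac mass reduces the kernel statement to one about
  -- `lam` alone.
  have h := ae_tendsto_blowUp_kernels hΩ (0 : Kernel (Space d) Unit)
    (Kernel.const (Space d) (Measure.dirac ())) (by simp) lam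
  filter_upwards [h] with x₀ hx₀ φ hφ
  obtain ⟨ψ, hψ⟩ := exists_boundedContinuous_eqOn_unitCube hφ
  have h1 := hx₀ (ψ.compContinuous ⟨Prod.fst, continuous_fst⟩)
  simp only [_root_.zero_apply, integral_zero_measure, integral_zero, zero_add,
    Kernel.const_apply, integral_dirac, BoundedContinuousFunction.compContinuous_apply,
    ContinuousMap.coe_mk] at h1
  rw [integral_smul_measure, smul_eq_mul, setIntegral_congr_fun measurableSet_unitCube hψ]
  refine h1.congr' ?_
  filter_upwards [self_mem_nhdsWithin] with r hr
  rw [integral_blowUpPos lam x₀ hr,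
    setIntegral_congr_fun (isClosed_cubeAt x₀ r).measurableSet fun x hx => hψ hx]

/-- Testing with φ = 1 gives the limit of the rescaled masses, and dividing by it cancels r⁻ᵈ and
`c`. Positivity of that limit makes all small blow-ups nonzero, so the radii are taken below a
threshold `η`. -/
theorem volume_restrict_unitCube_mem_Tan₁ {lam : Measure (Space d)} [IsFiniteMeasure lam]
    {x₀ : Space d} {c : ENNReal} (hc0 : c ≠ 0) (hc : c ≠ ⊤)
    (h : ∀ φ : Space d → ℝ, Continuous φ →
      Tendsto (fun r : ℝ => (r ^ d)⁻¹ * ∫ y, φ y ∂(blowUpPos lam x₀ r)) (𝓝[>] 0)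
        (𝓝 (∫ y, φ y ∂(c • volume.restrict (unitCube d))))) :
    volume.restrict (unitCube d) ∈ Tan₁ lam x₀ := by
  have hcpos : 0 < c.toReal := ENNReal.toReal_pos hc0 hc
  have h1 : Tendsto (fun r : ℝ => (r ^ d)⁻¹ * (blowUpPos lam x₀ r).real univ) (𝓝[>] 0)
      (𝓝 c.toReal) := by
    have := h (fun _ => 1) continuous_const
    simpa [integral_smul_measure, volume_unitCube, measureReal_def] using this
  have hmassev : ∀ᶠ r in 𝓝[>] (0 : ℝ), 0 < blowUpPos lam x₀ r univ := by
    filter_upwards [h1.eventually (lt_mem_nhds hcpos)] with r hr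
    rw [pos_iff_ne_zero]
    intro h0
    rw [measureReal_def, h0] at hr
    simp at hr
  obtain ⟨η, hη, hηp⟩ := mem_nhdsGT_iff_exists_Ioo_subset.1 hmassev
  have hη : 0 < η := hη
  have hrpos : ∀ j : ℕ, 0 < η / 2 * (1 / ((j : ℝ) + 1)) := fun j => by positivity
  have hr0 : Tendsto (fun j : ℕ => η / 2 * (1 / ((j : ℝ) + 1))) atTop (𝓝 0) := by
    simpa using tendsto_one_div_add_atTop_nhds_zero_nat.const_mul (η / 2)
  have hr1 : Tendsto (fun j : ℕ => η / 2 * (1 / ((j : ℝ) + 1))) atTop (𝓝[>] 0) :=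
    tendsto_nhdsWithin_iff.2 ⟨hr0, Eventually.of_forall hrpos⟩
  refine ⟨inferInstance, ?_, fun j => η / 2 * (1 / ((j : ℝ) + 1)), hrpos, hr0, fun j => ?_,
    fun φ hφ => ?_⟩
  · rw [Measure.restrict_apply measurableSet_unitCube.compl]
    simp
  · refine hηp ⟨hrpos j, ?_⟩
    have : 1 / ((j : ℝ) + 1) ≤ 1 := by
      rw [div_le_one (by positivity)]
      linarith [(Nat.cast_nonneg j : (0 : ℝ) ≤ j)]
    nlinarith
  · have h2 := ((h1.comp hr1).inv₀ hcpos.ne').mul ((h φ hφ).comp hr1)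
    rw [integral_smul_measure, smul_eq_mul, ← mul_assoc, inv_mul_cancel₀ hcpos.ne', one_mul] at h2
    refine h2.congr fun j => ?_
    simp only [Function.comp_apply, mul_inv, inv_inv]
    have := (pow_pos (hrpos j) d).ne'
    field_simp

end Radii

/-! ### Restriction of lifted Young measures to cylinders -/

section Restriction

variable {d : ℕ} {Y : Type*} [MeasurableSpace Y]

theorem restrict_compProd_prod_univ (m : Measure (Space d)) [SFinite m] (K : Kernel (Space d) Y)
    [IsSFiniteKernel K] {s : Set (Space d)} (hs : MeasurableSet s) :
    (m ⊗ₘ K).restrict (s ×ˢ univ) = (m.restrict s) ⊗ₘ K := by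
  ext t ht
  rw [Measure.restrict_apply ht, Measure.compProd_apply (ht.inter (hs.prod MeasurableSet.univ)),
    Measure.compProd_apply ht, ← lintegral_indicator hs]
  refine lintegral_congr fun x => ?_
  by_cases hx : x ∈ s <;> simp [hx]

theorem restrict_liftKernels {U K : Set (Space d)} (hK : MeasurableSet K) (hKU : K ⊆ U)
    (A B : Kernel (Space d) Y) [IsSFiniteKernel A] [IsFiniteKernel B] (lam : Measure (Space d))
    [IsFiniteMeasure lam] :
    (liftKernels U A B lam).restrict (K ×ˢ univ) = liftKernels K A B (lam.restrict K) := by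
  rw [liftKernels, Measure.restrict_add, restrict_compProd_prod_univ _ _ hK,
    restrict_compProd_prod_univ _ _ hK, Measure.restrict_restrict hK,
    inter_eq_self_of_subset_left hKU, liftKernels]

end Restriction

/-! ### Generation as weak convergence of measures -/

section Generation

variable {d : ℕ} {E : Type*} [NormedAddCommGroup E] [InnerProductSpace ℝ E]
  [FiniteDimensional ℝ E] [MeasurableSpace E] [BorelSpace E]

/-- The measure `M` on the compactification represents the duality pairing with `D`. -/
def IsLift {U : Set (Space d)} (D : TwoScaleYoungMeasure U E) (M : Measure (Space d × Fiber d E)) :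
    Prop :=
  ∀ (f : Space d → Torus d → E → ℝ) (F : Space d × Fiber d E →ᵇ ℝ), Represents U f F →
    pairing U f D = ∫ p, F p ∂M

/-- Every bounded continuous `F` defines an integrand and every integrand comes from such an `F`, so
the two families of tests coincide. -/
theorem IsLift.generates_iff {U : Set (Space d)} (hUm : MeasurableSet U)
    (hU : Bornology.IsBounded U) {D : TwoScaleYoungMeasure U E}
    {M : Measure (Space d × Fiber d E)} (hD : IsLift D M) (ε : ℕ → ℝ)
    (μ : ℕ → VectorMeasure (Space d) E) :
    Generates U ε μ D ↔ WeakTendsto (fun i => liftEnergy U (ε i) (μ i)) M := by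
  have hvol : volume U ≠ ⊤ := hU.measure_lt_top.ne
  constructor
  · intro h F
    have hF : Represents U (toIntegrand F) F := fun x _ ξ z => rfl
    have := h _ (isIntegrand_toIntegrand U F F.continuous)
    rw [hD _ F hF] at this
    simpa only [energy_eq_integral_liftEnergy hUm hvol _ _ F hF] using this
  · intro h f hf
    obtain ⟨F, hF⟩ := hf.exists_represents hU
    rw [hD f F hF]
    simpa only [energy_eq_integral_liftEnergy hUm hvol _ _ F hF] using h F

omit [BorelSpace E] in
theorem weakStarTendsto_of_weakTendsto {U : Set (Space d)} (hU : Bornology.IsBounded U)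
    {σ : ℕ → TwoScaleYoungMeasure U E} {D : TwoScaleYoungMeasure U E}
    {M' : ℕ → Measure (Space d × Fiber d E)} {M : Measure (Space d × Fiber d E)}
    (hσ : ∀ j, IsLift (σ j) (M' j)) (hD : IsLift D M) (h : WeakTendsto M' M) :
    WeakStarTendsto U σ D := by
  intro f hf
  obtain ⟨F, hF⟩ := hf.exists_represents hU
  rw [hD f F hF]
  simpa only [hσ _ f F hF] using h F

end Generation

/-! ### Blow-up at a fixed radius -/

section FixedRadius

variable {d : ℕ} {E : Type*} [NormedAddCommGroup E] [InnerProductSpace ℝ E]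
  [FiniteDimensional ℝ E] [MeasurableSpace E] [BorelSpace E]

-- By currying, the shift parameter maps continuously into continuous functions with the
-- compact-open topology, where convergence is uniform on compact sets.
omit [MeasurableSpace E] [BorelSpace E] in
theorem tendstoUniformlyOn_blowUpShift (F : Space d × Fiber d E →ᵇ ℝ) (x₀ : Space d) (r : ℝ)
    {τ : ℕ → Torus d} {ξ₀ : Torus d} (hτ : Tendsto τ atTop (𝓝 ξ₀)) {K : Set (Space d)}
    (hK : IsCompact K) :
    TendstoUniformlyOn (fun i p => F (blowUpShift x₀ r (τ i) p))
      (fun p => F (blowUpShift x₀ r ξ₀ p)) atTop (K ×ˢ univ) := by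
  let G : C(Torus d, C(Space d × Fiber d E, ℝ)) :=
    ContinuousMap.curry ⟨fun q : Torus d × (Space d × Fiber d E) => F (blowUpShift x₀ r q.1 q.2), by
      unfold blowUpShift blowUpMap
      fun_prop⟩
  have h := (G.continuous.tendsto ξ₀).comp hτ
  exact ContinuousMap.tendsto_iff_forall_isCompact_tendstoUniformlyOn.1 h _ (hK.prod isCompact_univ)

theorem isCompact_cubeAt (x₀ : Space d) {r : ℝ} (hr : 0 < r) : IsCompact (cubeAt x₀ r) := by
  have h := (blowUpHomeo x₀ hr).isCompact_preimage.2 (isCompact_unitCube (d := d))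
  exact h

/-- After the change of variables the test functions depend on `i` only through the translation,
which converges uniformly on the compact cylinder; the null frontier permits restriction to it. -/
theorem weakTendsto_liftEnergy_blowUp {Ω : Set (Space d)} (hΩ : volume Ω ≠ ⊤) {ε : ℕ → ℝ}
    {μ : ℕ → VectorMeasure (Space d) E} {M₀ : Measure (Space d × Fiber d E)} [IsFiniteMeasure M₀]
    (h : WeakTendsto (fun i => liftEnergy Ω (ε i) (μ i)) M₀) {x₀ : Space d} {ξ₀ : Torus d}
    (hξ₀ : Tendsto (fun i => toTorus ((ε i)⁻¹ • x₀)) atTop (𝓝 ξ₀)) {r : ℝ} (hr : 0 < r)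
    (hsub : cubeAt x₀ r ⊆ Ω) (hfr : M₀ (frontier (cubeAt x₀ r) ×ˢ univ) = 0)
    {M' : Measure (Space d × Fiber d E)}
    (hM' : ∀ F : Space d × Fiber d E →ᵇ ℝ, ∫ p, F p ∂M' =
      (r ^ d)⁻¹ * ∫ p in cubeAt x₀ r ×ˢ univ, F (blowUpShift x₀ r ξ₀ p) ∂M₀) :
    WeakTendsto (fun i => liftEnergy (unitCube d) (ε i / r) (blowUp (μ i) x₀ r)) M' := by
  intro F
  have hK := (isClosed_cubeAt x₀ r).measurableSet
  have hfin : ∀ i, IsFiniteMeasure (liftEnergy Ω (ε i) (μ i)) := fun i =>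
    isFiniteMeasure_liftEnergy hΩ _ _
  simp_rw [integral_liftEnergy_blowUp _ _ x₀ hr F, ← restrict_liftEnergy hK hsub]
  rw [hM' F]
  refine Tendsto.const_mul _ ?_
  exact h.tendsto_setIntegral_of_tendstoUniformlyOn (hK.prod MeasurableSet.univ)
    (by rwa [frontier_prod_univ_eq])
    (G := fun i => F.compContinuous ⟨_, continuous_blowUpShift x₀ r (toTorus ((ε i)⁻¹ • x₀))⟩)
    (F := F.compContinuous ⟨_, continuous_blowUpShift x₀ r ξ₀⟩)
    (tendstoUniformlyOn_blowUpShift F x₀ r hξ₀ (isCompact_cubeAt x₀ hr))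

omit [InnerProductSpace ℝ E] [FiniteDimensional ℝ E] in
theorem integral_liftKernels_pull {U : Set (Space d)} [SecondCountableTopology (Fiber d E)]
    (A B : Kernel (Space d) (Fiber d E)) [IsSFiniteKernel A] [IsFiniteKernel B]
    {S : Space d → Space d} (hS : Measurable S) (ξ₀ : Torus d)
    (hA : ∫⁻ y in U, A (S y) univ ≠ ⊤) (lam : Measure (Space d)) [IsFiniteMeasure lam]
    (F : Space d × Fiber d E →ᵇ ℝ) :
    ∫ p, F p ∂(liftKernels U ((A.comap S hS).map (fiberShift ξ₀))
        ((B.comap S hS).map (fiberShift ξ₀)) lam) =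
      (∫ y in U, ∫ w, F (y, fiberShift ξ₀ w) ∂(A (S y))) +
        ∫ y, ∫ w, F (y, fiberShift ξ₀ w) ∂(B (S y)) ∂lam := by
  have hsh : Measurable (fiberShift ξ₀ : Fiber d E → Fiber d E) :=
    (continuous_fiberShift ξ₀).measurable
  have hmap : ∀ (K : Kernel (Space d) (Fiber d E)) (y : Space d),
      ∫ w, F (y, w) ∂((K.comap S hS).map (fiberShift ξ₀) y) =
        ∫ w, F (y, fiberShift ξ₀ w) ∂(K (S y)) := by
    intro K y
    rw [Kernel.map_apply _ hsh, Kernel.comap_apply, integral_map hsh.aemeasurable]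
    exact (F.continuous.comp (by fun_prop : Continuous fun w : Fiber d E => (y, w))).aestronglyMeasurable
  rw [integral_liftKernels]
  · simp_rw [hmap]
  · simpa [Kernel.map_apply' _ hsh _ MeasurableSet.univ] using hA

theorem lintegral_unitCube_comp_ne_top {Ω : Set (Space d)} {x₀ : Space d} {r : ℝ} (hr : 0 < r)
    (hsub : cubeAt x₀ r ⊆ Ω) {g : Space d → ENNReal} (hg : ∫⁻ x in Ω, g x ≠ ⊤) :
    ∫⁻ y in unitCube d, g (x₀ + r • y) ≠ ⊤ := by
  rw [lintegral_unitCube_comp x₀ hr]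
  exact ENNReal.mul_ne_top ENNReal.ofReal_ne_top (ne_top_of_le_ne_top hg (lintegral_mono_set hsub))

end FixedRadius

/-! ### Tangent Young measures at regular points -/

section Tangent

variable {d : ℕ} {E : Type*} [NormedAddCommGroup E] [InnerProductSpace ℝ E]
  [FiniteDimensional ℝ E] [MeasurableSpace E] [BorelSpace E]

omit [InnerProductSpace ℝ E] [FiniteDimensional ℝ E] in
theorem integral_liftKernels_blowUp [SecondCountableTopology (Fiber d E)]
    (A B : Kernel (Space d) (Fiber d E)) [IsSFiniteKernel A] [IsFiniteKernel B]
    {x₀ : Space d} {r : ℝ} (hr : 0 < r) (hS : Measurable fun y : Space d => x₀ + r • y)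
    (ξ₀ : Torus d) (hA : ∫⁻ y in unitCube d, A (x₀ + r • y) univ ≠ ⊤) (lam : Measure (Space d))
    [IsFiniteMeasure lam]
    [IsFiniteMeasure (ENNReal.ofReal (r ^ d)⁻¹ • blowUpPos lam x₀ r)]
    (F : Space d × Fiber d E →ᵇ ℝ) :
    ∫ p, F p ∂(liftKernels (unitCube d) ((A.comap _ hS).map (fiberShift ξ₀))
        ((B.comap _ hS).map (fiberShift ξ₀)) (ENNReal.ofReal (r ^ d)⁻¹ • blowUpPos lam x₀ r)) =
      (∫ y in unitCube d, ∫ w, F (y, fiberShift ξ₀ w) ∂(A (x₀ + r • y))) +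
        (r ^ d)⁻¹ * ∫ x in cubeAt x₀ r, ∫ w, F (blowUpMap x₀ r x, fiberShift ξ₀ w) ∂(B x) ∂lam := by
  rw [integral_liftKernels_pull A B hS ξ₀ hA, integral_smul_measure,
    ENNReal.toReal_ofReal (by positivity), integral_blowUpPos lam x₀ hr, smul_eq_mul]
  simp_rw [add_smul_blowUpMap x₀ hr]

/-- The right-hand side is that of `integral_liftKernels_blowUp`: rescaling and shifting the lifted
Young measure gives the lift of the rescaled and shifted Young measure. -/
theorem integral_restrict_liftKernels_blowUpShift {Ω : Set (Space d)}
    (A B : Kernel (Space d) (Fiber d E)) [IsSFiniteKernel A] [IsFiniteKernel B]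
    {x₀ : Space d} {r : ℝ} (hr : 0 < r) (hsub : cubeAt x₀ r ⊆ Ω) (ξ₀ : Torus d)
    (hA : ∫⁻ x in Ω, A x univ ≠ ⊤) (lam : Measure (Space d)) [IsFiniteMeasure lam]
    (F : Space d × Fiber d E →ᵇ ℝ) :
    (r ^ d)⁻¹ * ∫ p in cubeAt x₀ r ×ˢ univ, F (blowUpShift x₀ r ξ₀ p) ∂(liftKernels Ω A B lam) =
      (∫ y in unitCube d, ∫ w, F (y, fiberShift ξ₀ w) ∂(A (x₀ + r • y))) +
        (r ^ d)⁻¹ * ∫ x in cubeAt x₀ r, ∫ w, F (blowUpMap x₀ r x, fiberShift ξ₀ w) ∂(B x) ∂lam := by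
  have hA' : ∫⁻ x in cubeAt x₀ r, A x univ ≠ ⊤ := ne_top_of_le_ne_top hA (lintegral_mono_set hsub)
  rw [restrict_liftKernels (isClosed_cubeAt x₀ r).measurableSet hsub]
  have h := integral_liftKernels (B := B) hA' (lam.restrict (cubeAt x₀ r))
    (F.compContinuous ⟨_, continuous_blowUpShift x₀ r ξ₀⟩)
  simp only [BoundedContinuousFunction.compContinuous_apply, ContinuousMap.coe_mk] at h
  rw [h, mul_add]
  congr 1
  have h2 := integral_unitCube_comp x₀ hr fun x =>
    ∫ w, F (blowUpMap x₀ r x, fiberShift ξ₀ w) ∂(A x)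
  simp only [blowUpMap_add_smul x₀ hr] at h2
  rw [h2]
  rfl

/-- Blowing up a sequence that generates the Young measure given by the kernels `κ`, `ρ`, `κ'` and
the measure `lam`, at a point where these are regular. -/
theorem exists_isTangent {Ω : Set (Space d)} (hΩ : IsOpen Ω) (hΩb : Bornology.IsBounded Ω)
    (κ : Kernel (Space d × Torus d) E) [IsFiniteKernel κ]
    (ρ : Kernel (Space d) (Torus d)) [IsFiniteKernel ρ]
    (κ' : Kernel (Space d × Torus d) (Metric.sphere (0 : E) 1)) [IsFiniteKernel κ']
    (lam : Measure (Space d)) [IsFiniteMeasure lam]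
    (hA : ∫⁻ x in Ω, acKernel κ x univ ≠ ⊤)
    (h1 : ∀ᵐ x ∂(volume.restrict Ω), ∀ᵐ ξ, κ (x, ξ) univ = 1)
    (h4 : ∀ᵐ x ∂lam, ρ x univ = 1) (h5 : ∀ᵐ x ∂lam, ∀ᵐ ξ ∂(ρ x), κ' (x, ξ) univ = 1)
    {ε : ℕ → ℝ} (hε : Tendsto ε atTop (𝓝 0)) (hε_pos : ∀ i, 0 < ε i)
    {μ : ℕ → VectorMeasure (Space d) E}
    (hW : WeakTendsto (fun i => liftEnergy Ω (ε i) (μ i))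
      (liftKernels Ω (acKernel κ) (singKernel ρ κ') lam))
    {x₀ : Space d} (hx₀ : x₀ ∈ Ω) {c : ENNReal} (hc : c ≠ ⊤)
    (hlim : ∀ F : Space d × Fiber d E →ᵇ ℝ,
      Tendsto (fun r : ℝ => (∫ y in unitCube d, ∫ w, F (y, w) ∂(acKernel κ (x₀ + r • y))) +
          (r ^ d)⁻¹ * ∫ x in cubeAt x₀ r, ∫ w, F (blowUpMap x₀ r x, w) ∂(singKernel ρ κ' x) ∂lam)
        (𝓝[>] 0)
        (𝓝 ((∫ y in unitCube d, ∫ w, F (y, w) ∂(acKernel κ x₀)) +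
          c.toReal * ∫ y in unitCube d, ∫ w, F (y, w) ∂(singKernel ρ κ' x₀))))
    (h1x : ∀ᵐ ξ, κ (x₀, ξ) univ = 1) (h2x : acKernel κ x₀ univ ≠ ⊤)
    (h4x : c ≠ 0 → ρ x₀ univ = 1) (h5x : c ≠ 0 → ∀ᵐ ξ ∂(ρ x₀), κ' (x₀, ξ) univ = 1)
    (hnull : ∀ i, lam {x | x i = x₀ i} = 0) :
    ∃ (ξ₀ : Torus d) (D : TwoScaleYoungMeasure (unitCube d) E), IsTangent ε μ x₀ D ∧
      D.lam = c • volume.restrict (unitCube d) ∧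
      (∀ y ξ, D.nu y ξ = κ (x₀, ξ + ξ₀)) ∧ (∀ y, D.rho y = (ρ x₀).map fun ξ => ξ - ξ₀) ∧
      ∀ y ξ, D.nuInf y ξ = κ' (x₀, ξ + ξ₀) := by
  have hΩv : volume Ω ≠ ⊤ := hΩb.measure_lt_top.ne
  have hQb : Bornology.IsBounded (unitCube d) := isCompact_unitCube.isBounded
  have hQcl : closure (unitCube d) = unitCube d := isClosed_unitCube.closure_eq
  have hM₀fin := isFiniteMeasure_liftKernels (B := singKernel ρ κ') hA lam
  -- The translations do not involve the radius, so one subsequence and one `ξ₀` serve all `j`.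
  obtain ⟨ξ₀, -, n, hn, hξ₀⟩ := isCompact_univ.tendsto_subseq
    (x := fun i => toTorus ((ε i)⁻¹ • x₀)) fun _ => mem_univ _
  have hrad : ∀ j : ℕ, ∃ r : ℝ, 0 < r ∧ r < 1 / ((j : ℝ) + 1) ∧ cubeAt x₀ r ⊆ Ω ∧
      lam (frontier (cubeAt x₀ r)) = 0 := fun j =>
    exists_radius lam x₀ hnull (eventually_cubeAt_subset hΩ hx₀) Nat.one_div_pos_of_nat
  choose r hr hrlt hrsub hrlam using hrad
  have hr0 : Tendsto r atTop (𝓝 0) := squeeze_zero (fun j => (hr j).le) (fun j => (hrlt j).le)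
    tendsto_one_div_add_atTop_nhds_zero_nat
  have hr1 : Tendsto r atTop (𝓝[>] 0) :=
    tendsto_nhdsWithin_iff.2 ⟨hr0, Eventually.of_forall hr⟩
  have hlamfin : ∀ j, IsFiniteMeasure
      (ENNReal.ofReal (r j ^ d)⁻¹ • blowUpPos lam x₀ (r j)) := fun j => by
    unfold blowUpPos
    exact Measure.smul_finite _ ENNReal.ofReal_ne_top
  have hcfin : IsFiniteMeasure (c • volume.restrict (unitCube d)) := Measure.smul_finite _ hc
  have hS : ∀ j, Measurable fun y : Space d => x₀ + r j • y := fun j => by fun_prop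
  have hAj : ∀ j, ∫⁻ y in unitCube d, acKernel κ (x₀ + r j • y) univ ≠ ⊤ := fun j =>
    lintegral_unitCube_comp_ne_top (hr j) (hrsub j) hA
  have hσ : ∀ j, ∃ σ : TwoScaleYoungMeasure (unitCube d) E, IsLift σ (liftKernels (unitCube d)
      (((acKernel κ).comap _ (hS j)).map (fiberShift ξ₀))
      (((singKernel ρ κ').comap _ (hS j)).map (fiberShift ξ₀))
      (ENNReal.ofReal (r j ^ d)⁻¹ • blowUpPos lam x₀ (r j))) := by
    intro j
    obtain ⟨σ, -, -, -, -, hσ⟩ := exists_youngMeasure_pull measurableSet_unitCube hQb κ ρ κ'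
      (ENNReal.ofReal (r j ^ d)⁻¹ • blowUpPos lam x₀ (r j)) (hS j) ξ₀
      (by
        rw [hQcl]
        exact ae_unitCube_comp x₀ (hr j)
          (ae_mono (Measure.restrict_mono (hrsub j) le_rfl) h1))
      (by rw [hQcl]; exact hAj j)
      (by
        rw [hQcl, blowUpPos, Measure.smul_apply,
          Measure.restrict_apply measurableSet_unitCube.compl]
        simp)
      (ae_smul_blowUpPos_comp lam x₀ (hr j) _ h4) (ae_smul_blowUpPos_comp lam x₀ (hr j) _ h5)
    exact ⟨σ, hσ⟩
  choose σ hσ using hσ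
  have hAc : ∫⁻ _ in unitCube d, acKernel κ x₀ univ ≠ ⊤ := by
    rw [lintegral_const]
    exact ENNReal.mul_ne_top h2x (measure_ne_top _ _)
  -- The same construction as for `σ`, with the affine map replaced by the constant map to `x₀`:
  -- this freezes the kernels.
  obtain ⟨D, hDlam, hDnu, hDrho, hDnuInf, hD⟩ := exists_youngMeasure_pull measurableSet_unitCube
    hQb κ ρ κ' (c • volume.restrict (unitCube d)) (measurable_const (a := x₀)) ξ₀
    (ae_of_all _ fun _ => h1x) (by rw [hQcl]; exact hAc)
    (by
      rw [hQcl, Measure.smul_apply, Measure.restrict_apply measurableSet_unitCube.compl]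
      simp)
    (by
      rcases eq_or_ne c 0 with rfl | hc0
      · simp
      · exact ae_of_all _ fun _ => h4x hc0)
    (by
      rcases eq_or_ne c 0 with rfl | hc0
      · simp
      · exact ae_of_all _ fun _ => h5x hc0)
  have hM'fin : ∀ j, IsFiniteMeasure (liftKernels (unitCube d)
      (((acKernel κ).comap _ (hS j)).map (fiberShift ξ₀))
      (((singKernel ρ κ').comap _ (hS j)).map (fiberShift ξ₀))
      (ENNReal.ofReal (r j ^ d)⁻¹ • blowUpPos lam x₀ (r j))) := fun j =>
    isFiniteMeasure_liftKernels (by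
      simpa [Kernel.map_apply' _ (continuous_fiberShift ξ₀).measurable _ MeasurableSet.univ]
        using hAj j) _
  have hMDfin : IsFiniteMeasure (liftKernels (unitCube d)
      (((acKernel κ).comap _ (measurable_const (a := x₀))).map (fiberShift ξ₀))
      (((singKernel ρ κ').comap _ (measurable_const (a := x₀))).map (fiberShift ξ₀))
      (c • volume.restrict (unitCube d))) :=
    isFiniteMeasure_liftKernels (by
      simpa [Kernel.map_apply' _ (continuous_fiberShift ξ₀).measurable _ MeasurableSet.univ]
        using hAc) _
  have hWj : ∀ j, WeakTendsto (fun i => liftEnergy (unitCube d) (ε (n i) / r j)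
      (blowUp (μ (n i)) x₀ (r j))) (liftKernels (unitCube d)
      (((acKernel κ).comap _ (hS j)).map (fiberShift ξ₀))
      (((singKernel ρ κ').comap _ (hS j)).map (fiberShift ξ₀))
      (ENNReal.ofReal (r j ^ d)⁻¹ • blowUpPos lam x₀ (r j))) := by
    intro j
    refine weakTendsto_liftEnergy_blowUp hΩv (ε := ε ∘ n) (μ := μ ∘ n)
      (fun F => (hW F).comp hn.tendsto_atTop) hξ₀ (hr j) (hrsub j)
      (liftKernels_prod_univ isClosed_frontier.measurableSet ?_ (hrlam j)) fun F => ?_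
    · exact measure_frontier_cubeAt_eq_zero _ x₀ (hr j) (fun i => volume_coordinate_eq i _)
        fun i => volume_coordinate_eq i _
    · rw [integral_liftKernels_blowUp _ _ (hr j) (hS j) ξ₀ (hAj j),
        integral_restrict_liftKernels_blowUpShift _ _ (hr j) (hrsub j) ξ₀ hA]
  have hWD : WeakTendsto (fun j => liftKernels (unitCube d)
      (((acKernel κ).comap _ (hS j)).map (fiberShift ξ₀))
      (((singKernel ρ κ').comap _ (hS j)).map (fiberShift ξ₀))
      (ENNReal.ofReal (r j ^ d)⁻¹ • blowUpPos lam x₀ (r j))) (liftKernels (unitCube d)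
      (((acKernel κ).comap _ (measurable_const (a := x₀))).map (fiberShift ξ₀))
      (((singKernel ρ κ').comap _ (measurable_const (a := x₀))).map (fiberShift ξ₀))
      (c • volume.restrict (unitCube d))) := by
    intro F
    have h := (hlim (F.compContinuous ⟨fun p => (p.1, fiberShift ξ₀ p.2),
      continuous_fst.prodMk ((continuous_fiberShift ξ₀).comp continuous_snd)⟩)).comp hr1
    rw [integral_liftKernels_pull _ _ _ ξ₀ hAc, integral_smul_measure, smul_eq_mul]
    refine h.congr fun j => ?_
    rw [integral_liftKernels_blowUp _ _ (hr j) (hS j) ξ₀ (hAj j)]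
    rfl
  -- This extra requirement on the diagonal forces its scales to tend to zero.
  have hq : ∀ j : ℕ, ∀ᶠ i in atTop, ε (n i) / r j < 1 / ((j : ℝ) + 1) := by
    intro j
    have h : Tendsto (fun i => ε (n i) / r j) atTop (𝓝 (0 / r j)) :=
      (hε.comp hn.tendsto_atTop).div_const _
    rw [zero_div] at h
    exact h.eventually (gt_mem_nhds Nat.one_div_pos_of_nat)
  have hfin : ∀ j i, IsFiniteMeasure (liftEnergy (unitCube d) (ε (n i) / r j)
      (blowUp (μ (n i)) x₀ (r j))) := fun j i =>
    isFiniteMeasure_liftEnergy volume_unitCube_ne_top _ _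
  obtain ⟨m, hm, hmq, hmW⟩ := exists_strictMono_weakTendsto_diagonal
    (isCompact_unitCube.prod (isCompact_univ (X := Fiber d E)))
    (fun j i => by
      rw [← restrict_liftEnergy measurableSet_unitCube Subset.rfl]
      exact ae_restrict_mem (measurableSet_unitCube.prod MeasurableSet.univ))
    (ae_liftKernels_mem measurableSet_unitCube (by
      rw [Measure.smul_apply, Measure.restrict_apply measurableSet_unitCube.compl]
      simp)) hWj hWD hq
  refine ⟨ξ₀, D, ⟨r, n, σ, hr, hr0, hn, fun j => ?_, ?_, m, hm, ?_, ?_⟩, hDlam, hDnu, hDrho,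
    hDnuInf⟩
  · exact ((hσ j).generates_iff measurableSet_unitCube hQb _ _).2 (hWj j)
  · exact weakStarTendsto_of_weakTendsto hQb hσ hD hWD
  · exact squeeze_zero (fun j => (div_pos (hε_pos _) (hr j)).le) (fun j => (hmq j).le)
      tendsto_one_div_add_atTop_nhds_zero_nat
  · exact (IsLift.generates_iff measurableSet_unitCube hQb hD _ _).2 hmW

/-- With a constant `rho` the generalized product is an ordinary product, and the property depends
only on the torus factor. If `c = 0` the measure vanishes, so nothing need be known about `ρ₀`. -/
theorem ae_genProd_smul_volume {lam : Measure (Space d)} {K : Set (Space d)} {c : ENNReal}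
    (hlam : lam = c • volume.restrict K) (ρ₀ : Measure (Torus d))
    [IsFiniteMeasure ρ₀] {rho : Space d → Measure (Torus d)} {ξ₀ : Torus d}
    (hrho : ∀ y, rho y = ρ₀.map fun ξ => ξ - ξ₀) {p : Torus d → Prop}
    (hp : c ≠ 0 → ∀ᵐ ξ ∂ρ₀, p ξ) : ∀ᵐ q ∂(genProd lam rho), p (q.2 + ξ₀) := by
  have hsub : MeasurableEmbedding fun ξ : Torus d => ξ - ξ₀ :=
    (MeasurableEquiv.subRight ξ₀).measurableEmbedding
  have hgen : genProd lam rho = lam.prod (ρ₀.map fun ξ => ξ - ξ₀) := by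
    subst hlam
    rw [genProd_eq_compProd _ (Kernel.const (Space d) (ρ₀.map fun ξ => ξ - ξ₀))
      (ae_of_all _ fun y => by simp [hrho y]), Measure.compProd_const]
  rcases eq_or_ne c 0 with rfl | hc0
  · rw [hgen, hlam]
    simp
  · rw [hgen]
    have h : ∀ᵐ ξ ∂(ρ₀.map fun ξ => ξ - ξ₀), p (ξ + ξ₀) := by
      rw [hsub.ae_map_iff]
      simpa using hp hc0
    exact Measure.quasiMeasurePreserving_snd.ae h

end Tangent

end TwoScale

end

/-! ### Selection of the regular points and conclusion -/

theorem lemma4p1 {d : ℕ} {E : Type*} [NormedAddCommGroup E] [InnerProductSpace ℝ E]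
    [FiniteDimensional ℝ E] [MeasurableSpace E] [BorelSpace E]
    (Ω : Set (TwoScale.Space d)) (hΩ_open : IsOpen Ω) (hΩ_bdd : Bornology.IsBounded Ω)
    (hΩ_frontier : volume (frontier Ω) = 0)
    (ν : TwoScale.TwoScaleYoungMeasure Ω E)
    (ε : ℕ → ℝ) (hε_pos : ∀ i, 0 < ε i) (hε : Tendsto ε atTop (𝓝 0))
    (μ : ℕ → VectorMeasure (TwoScale.Space d) E) (hμ : ∀ i, (μ i).restrict Ω = μ i)
    (hgen : TwoScale.Generates Ω ε μ ν) :
    ∀ᵐ x₀ ∂(volume.restrict Ω),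
      ∃ (ξ₀ : TwoScale.Torus d) (D : TwoScale.TwoScaleYoungMeasure (TwoScale.unitCube d) E),
        TwoScale.IsTangent ε μ x₀ D ∧
        D.lam = ν.lam.rnDeriv volume x₀ • volume.restrict (TwoScale.unitCube d) ∧
        (∀ φ : TwoScale.Space d → ℝ, Continuous φ →
          Tendsto (fun r : ℝ => (r ^ d)⁻¹ * ∫ y, φ y ∂(TwoScale.blowUpPos ν.lam x₀ r))
            (𝓝[>] 0) (𝓝 (∫ y, φ y ∂D.lam))) ∧
        (ν.lam.rnDeriv volume x₀ ≠ 0 →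
          (D.lam univ)⁻¹ • D.lam ∈ TwoScale.Tan₁ ν.lam x₀) ∧
        (∀ᵐ y ∂D.lam, D.rho y = (ν.rho x₀).map (fun ξ => ξ - ξ₀)) ∧
        (∀ᵐ p ∂((volume.restrict (TwoScale.unitCube d)).prod
            (volume : Measure (TwoScale.Torus d))),
          D.nu p.1 p.2 = ν.nu x₀ (p.2 + ξ₀)) ∧
        (∀ᵐ p ∂(TwoScale.genProd D.lam D.rho),
          D.nuInf p.1 p.2 = ν.nuInf x₀ (p.2 + ξ₀)) := by
  open TwoScale ProbabilityTheory in
  have hlamfin := ν.finite_lam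
  obtain ⟨κ, hκfin, hκ⟩ := exists_kernel_ae_eq ν.aemeasurable_nu ν.prob_nu
  obtain ⟨ρ, hρfin, hρ⟩ := exists_kernel_ae_eq ν.aemeasurable_rho ν.prob_rho
  obtain ⟨κ', hκ'fin, hκ'⟩ := exists_kernel_ae_eq ν.aemeasurable_nuInf ν.prob_nuInf
  have hA : ∫⁻ x in Ω, acKernel κ x univ ≠ ⊤ :=
    ne_top_of_le_ne_top (lintegral_acKernel_univ_ne_top hΩ_bdd ν κ hκ)
      (lintegral_mono_set subset_closure)
  have hlift : IsLift ν (liftKernels Ω (acKernel κ) (singKernel ρ κ') ν.lam) := fun f F hF =>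
    pairing_eq_integral_liftKernels hΩ_open.measurableSet hΩ_bdd ν κ ρ κ' hκ hρ hκ' F hF
  have hW := (hlift.generates_iff hΩ_open.measurableSet hΩ_bdd ε μ).1 hgen
  have hnu : ∀ᵐ x ∂(volume.restrict Ω), ∀ᵐ ξ, κ (x, ξ) univ = 1 ∧ ν.nu x ξ = κ (x, ξ) := by
    have h : ∀ᵐ p : Space d × Torus d ∂((volume.restrict (closure Ω)).prod volume),
        κ p univ = 1 ∧ ν.nu p.1 p.2 = κ p := by
      filter_upwards [hκ, ν.prob_nu] with p hp hp'
      exact ⟨by rw [← hp, hp'.measure_univ], hp⟩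
    exact ae_mono (Measure.restrict_mono subset_closure le_rfl) (Measure.ae_ae_of_ae_prod h)
  have hrho : ∀ᵐ x ∂ν.lam, ρ x univ = 1 ∧ ν.rho x = ρ x ∧
      ∀ᵐ ξ ∂(ρ x), κ' (x, ξ) univ = 1 ∧ ν.nuInf x ξ = κ' (x, ξ) := by
    have h : ∀ᵐ p : Space d × Torus d ∂(ν.lam ⊗ₘ ρ), κ' p univ = 1 ∧ ν.nuInf p.1 p.2 = κ' p := by
      rw [← genProd_eq_compProd ν.lam ρ hρ]
      filter_upwards [hκ', ν.prob_nuInf] with p hp hp'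
      exact ⟨by rw [← hp, hp'.measure_univ], hp⟩
    filter_upwards [hρ, ν.prob_rho, Measure.ae_ae_of_ae_compProd h] with x hx hx' hx''
    exact ⟨by rw [← hx, hx'.measure_univ], hx, hx''⟩
  -- Properties valid λ-almost everywhere hold for the absolutely continuous part of λ, hence
  -- Lebesgue-almost everywhere where its density is nonzero. Where it is zero, `ρ` and `κ'` are
  -- irrelevant.
  have hrhox : ∀ᵐ x ∂(volume.restrict Ω), ν.lam.rnDeriv volume x ≠ 0 →
      ρ x univ = 1 ∧ ν.rho x = ρ x ∧
        ∀ᵐ ξ ∂(ρ x), κ' (x, ξ) univ = 1 ∧ ν.nuInf x ξ = κ' (x, ξ) :=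
    ae_restrict_of_ae ((ae_withDensity_iff (Measure.measurable_rnDeriv _ _)).1
      (ae_mono (Measure.withDensity_rnDeriv_le ν.lam volume) hrho))
  filter_upwards [ae_tendsto_blowUp_kernels hΩ_open (acKernel κ) (singKernel ρ κ') hA ν.lam,
    ae_tendsto_integral_blowUpPos hΩ_open ν.lam, hnu, hrhox,
    ae_lt_top ((acKernel κ).measurable_coe MeasurableSet.univ) hA,
    ae_restrict_of_ae (Measure.rnDeriv_lt_top ν.lam volume),
    ae_restrict_of_ae (ae_coordinate_hyperplane_null ν.lam),
    ae_restrict_mem hΩ_open.measurableSet] with x₀ hlim hlam hnux hrhox h2x hc hnull hx₀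
  obtain ⟨ξ₀, D, hD, hDlam, hDnu, hDrho, hDnuInf⟩ := exists_isTangent hΩ_open hΩ_bdd κ ρ κ' ν.lam
    hA (hnu.mono fun x hx => hx.mono fun ξ hξ => hξ.1) (hrho.mono fun x hx => hx.1)
    (hrho.mono fun x hx => hx.2.2.mono fun ξ hξ => hξ.1) hε hε_pos hW hx₀ hc.ne hlim
    (hnux.mono fun ξ hξ => hξ.1) h2x.ne (fun h => (hrhox h).1)
    (fun h => (hrhox h).2.2.mono fun ξ hξ => hξ.1) hnull
  refine ⟨ξ₀, D, hD, hDlam, by rwa [hDlam], fun hc0 => ?_, ?_, ?_, ?_⟩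
  · have h : (D.lam univ)⁻¹ • D.lam = volume.restrict (unitCube d) := by
      rw [hDlam, Measure.smul_apply, measure_univ, smul_smul, smul_eq_mul, mul_one,
        ENNReal.inv_mul_cancel hc0 hc.ne, one_smul]
    rw [h]
    exact volume_restrict_unitCube_mem_Tan₁ hc0 hc.ne hlam
  · rcases eq_or_ne (ν.lam.rnDeriv volume x₀) 0 with hc0 | hc0
    · rw [hDlam, hc0]
      simp
    · exact ae_of_all _ fun y => by rw [hDrho, (hrhox hc0).2.1]
  · have h : ∀ᵐ ξ : Torus d, D.nu x₀ ξ = ν.nu x₀ (ξ + ξ₀) := by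
      filter_upwards [(measurePreserving_add_right (volume : Measure (Torus d))
        ξ₀).quasiMeasurePreserving.ae hnux] with ξ hξ
      rw [hDnu, hξ.2]
    filter_upwards [Measure.quasiMeasurePreserving_snd.ae h] with p hp
    rw [← hp, hDnu, hDnu]
  · filter_upwards [ae_genProd_smul_volume (p := fun ξ => ν.nuInf x₀ ξ = κ' (x₀, ξ)) hDlam
      (ρ x₀) hDrho fun h => (hrhox h).2.2.mono fun ξ hξ => hξ.2] with q hq
    rw [hDnuInf, hq]
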